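/- Let $V$ be a finite-dimensional complex vector space and let $X_i$ denote an operator $X$ on $V^{\otimes m}$ acting on the tensor factors $i,\dots,i+m-1$ of a tensor power of $V$. Let $\mathrm{Tr}_{(i_1,\dots,i_l)}$ be the trace over the tensor factors $i_1,\dots,i_l$, and let $P$ be the flip on $V\otimes V$. A Yang--Baxter matrix is an $R\in\mathrm{Aut}(V^{\otimes 2})$ with $R_1R_2R_1=R_2R_1R_2$. It is skew invertible if there is $\Psi_R\in\mathrm{End}(V^{\otimes2})$ with $\mathrm{Tr}_{(2)}R_1(\Psi_R)_2=\mathrm{Tr}_{(2)}(\Psi_R)_1R_2=P$; then $(D_R)_1:=\mathrm{Tr}_{(2)}(\Psi_R)_1\in\mathrm{End}(V)$. For $q\in\mathbb C\setminus\{0,\pm1\}$ and $\mu\in\mathbb C\setminus\{0,q,-q^{-1}\}$, the Birman--Murakami--Wenzl algebra $W_n(q,\mu)$ is the unital algebra generated by $\sigma_i^{\pm1},\kappa_i$ ($1\le i\le n-1$) with the braid relations $\sigma_i\sigma_{i+1}\sigma_i=\sigma_{i+1}\sigma_i\sigma_{i+1}$, $\sigma_i\sigma_j=\sigma_j\sigma_i$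 for $|i-j|>1$, and $$\kappa_i=\frac{(q-\sigma_i)(q^{-1}+\sigma_i)}{\mu(q-q^{-1})},\quad \sigma_i\kappa_i=\kappa_i\sigma_i=\mu\kappa_i,\quad \kappa_i\sigma_{i\pm1}^{\epsilon}=\kappa_i\kappa_{i\pm1}\sigma_i^{-\epsilon},\quad \sigma_{i\pm1}^{\epsilon}\kappa_i=\sigma_i^{-\epsilon}\kappa_{i\pm1}\kappa_i\ (\epsilon=\pm1),$$ $$\kappa_i\kappa_{i\pm1}\kappa_i=\kappa_i,\qquad \kappa_i^2=\frac{(q-\mu)(q^{-1}+\mu)}{\mu(q-q^{-1})}\,\kappa_i .$$ For $p\ge0$, $x\mapsto x^{\uparrow p}$ raises all indices of generators by $p$. Put $i_q:=(q^i-q^{-i})/(q-q^{-1})$, $$\sigma_i^-(x):=1+\frac{x-1}{q-q^{-1}}\,\sigma_i+\frac{\mu(x-1)}{\mu+qx}\,\kappa_i,\qquad a^{(1)}:=1,\qquad a^{(i+1)}:=\frac{q^i}{(i+1)_q}\,a^{(i)}\sigma_i^-(q^{-2i})\,a^{(i)}\in W_{i+1}(q,\mu).$$ A matrix $R\in\mathrm{Aut}(V^{\otimes2})$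 is of BMW type with parameters $q,\mu$ if, for every $n$, $\sigma_i\mapsto R_i$ extends to a homomorphism $\rho_R:W_n(q,\mu)\to\mathrm{End}(V^{\otimes n})$, and $K:=\rho_R(\kappa_1)\in\mathrm{End}(V^{\otimes2})$ is nonzero (equivalently, $\mu$ is an eigenvalue of $R$). Let $k\ge2$. The matrix $R$ is of type $O(k)$ (with parameter $q$) if it is skew invertible and of BMW type with $\mu=q^{1-k}$, if $q^{2i}\ne1$ and $\mu\ne-q^{1-2i}$ for $1\le i\le k$, and if $$\rho_R(a^{(i)})\ne0\ (2\le i\le k),\qquad \rho_R\bigl(a^{(k)\uparrow1}\sigma_1^-(q^{-2k})a^{(k)\uparrow1}\bigr)=0,\qquad \mathrm{rk}\,\rho_R(a^{(k)})=1 .$$ Two Yang--Baxter matrices form a compatible pair $\{R,F\}$ if $R_1F_2F_1=F_2F_1R_2$ and $R_2F_1F_2=F_1F_2R_1$. **Proposition.** Let $\{R,F\}$ be a compatible pair of Yang--Baxter matrices with $R$ of type $O(k)$. Define $O,G\in\mathrm{End}(V)$ by $$O_1:=\frac{k_q(1+q^{2-k})}{q+q^{1-k}}\,\mathrm{Tr}_{(2,\dots,k+1)}\bigl(\rho_R(a^{(k)\uparrow1})F_1^{-1}F_2^{-1}\cdots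 F_k^{-1}\bigr),\qquad G_1:=\mathrm{Tr}_{(2,3)}\bigl(K_2F_1^{-1}F_2^{-1}\bigr).$$ Then, on $V^{\otimes2}$, $$O_1F^{\varepsilon}=F^{\varepsilon}O_2\quad(\varepsilon=\pm1),\qquad R\,O_1O_2=O_1O_2\,R,$$ and, on $V$, $$[D_R,O]=0=[G,O],\qquad O^2=G^k .$$ -/

import Mathlib

/-! ## The Birman--Murakami--Wenzl algebra -/

namespace BMW

/-- Generators of `W_n(q, μ)`, `n - 1` of each kind: `sigma 1 i` and `sigma (-1) i` stand for
`σ_{i+1}` and `σ_{i+1}⁻¹`, and `kappa i` stands for `κ_{i+1}` (indices start at `0` here). -/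
inductive Gen (n : ℕ) : Type
  | sigma (ε : ℤˣ) (i : Fin (n - 1)) : Gen n
  | kappa (i : Fin (n - 1)) : Gen n

/-- The indices `i` and `j` differ by one. -/
def Neighbour {m : ℕ} (i j : Fin m) : Prop := i.val + 1 = j.val ∨ j.val + 1 = i.val

/-- The free generator `σ_i^ε`. -/
noncomputable def fs {n : ℕ} (ε : ℤˣ) (i : Fin (n - 1)) : FreeAlgebra ℂ (Gen n) :=
  FreeAlgebra.ι ℂ (Gen.sigma ε i)

/-- The free generator `κ_i`. -/
noncomputable def fk {n : ℕ} (i : Fin (n - 1)) : FreeAlgebra ℂ (Gen n) :=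
  FreeAlgebra.ι ℂ (Gen.kappa i)

/-- `η = (q - μ)(q⁻¹ + μ) / (μ (q - q⁻¹))`. -/
noncomputable def eta (q μ : ℂ) : ℂ := (q - μ) * (q⁻¹ + μ) / (μ * (q - q⁻¹))

/-- The defining relations of `W_n(q, μ)`. -/
inductive Rel (n : ℕ) (q μ : ℂ) : FreeAlgebra ℂ (Gen n) → FreeAlgebra ℂ (Gen n) → Prop
  | inverse (ε : ℤˣ) (i : Fin (n - 1)) : Rel n q μ (fs ε i * fs (-ε) i) 1
  | braid (i j : Fin (n - 1)) : Neighbour i j →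
      Rel n q μ (fs 1 i * fs 1 j * fs 1 i) (fs 1 j * fs 1 i * fs 1 j)
  | far (i j : Fin (n - 1)) : i.val + 1 < j.val →
      Rel n q μ (fs 1 i * fs 1 j) (fs 1 j * fs 1 i)
  | kappa_def (i : Fin (n - 1)) :
      Rel n q μ (fk i) ((μ * (q - q⁻¹))⁻¹ • ((q • 1 - fs 1 i) * (q⁻¹ • 1 + fs 1 i)))
  | sigma_kappa (i : Fin (n - 1)) : Rel n q μ (fs 1 i * fk i) (μ • fk i)
  | kappa_sigma (i : Fin (n - 1)) : Rel n q μ (fk i * fs 1 i) (μ • fk i)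
  | kappa_sigma_nb (ε : ℤˣ) (i j : Fin (n - 1)) : Neighbour i j →
      Rel n q μ (fk i * fs ε j) (fk i * fk j * fs (-ε) i)
  | sigma_nb_kappa (ε : ℤˣ) (i j : Fin (n - 1)) : Neighbour i j →
      Rel n q μ (fs ε j * fk i) (fs (-ε) i * fk j * fk i)
  | kappa_kappa_kappa (i j : Fin (n - 1)) : Neighbour i j →
      Rel n q μ (fk i * fk j * fk i) (fk i)
  | kappa_sq (i : Fin (n - 1)) : Rel n q μ (fk i * fk i) (eta q μ • fk i)

/-- The Birman--Murakami--Wenzl algebra `W_n(q, μ)`. -/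
abbrev Alg (n : ℕ) (q μ : ℂ) : Type := RingQuot (Rel n q μ)

variable {n : ℕ} {q μ : ℂ}

/-- The element `σ_{i+1}^ε` of `W_n(q, μ)`. -/
noncomputable def sigma (ε : ℤˣ) (i : Fin (n - 1)) : Alg n q μ :=
  RingQuot.mkAlgHom ℂ (Rel n q μ) (fs ε i)

/-- The element `κ_{i+1}` of `W_n(q, μ)`. -/
noncomputable def kappa (i : Fin (n - 1)) : Alg n q μ :=
  RingQuot.mkAlgHom ℂ (Rel n q μ) (fk i)

/-- The index `i` moved by `p`. -/
def shiftIdx {m : ℕ} (p : ℕ) (h : n + p ≤ m) (i : Fin (n - 1)) : Fin (m - 1) :=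
  ⟨i.val + p, by omega⟩

/-- The generators of `W_n` sent to those of `W_m`, with all indices raised by `p`. -/
noncomputable def shiftGen (q μ : ℂ) {m : ℕ} (p : ℕ) (h : n + p ≤ m) : Gen n → Alg m q μ
  | .sigma ε i => sigma ε (shiftIdx p h i)
  | .kappa i => kappa (shiftIdx p h i)

theorem shiftGen_rel {m : ℕ} (p : ℕ) (h : n + p ≤ m) ⦃x y : FreeAlgebra ℂ (Gen n)⦄
    (hxy : Rel n q μ x y) :
    FreeAlgebra.lift ℂ (shiftGen q μ p h) x = FreeAlgebra.lift ℂ (shiftGen q μ p h) y := by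
  have nb : ∀ i j : Fin (n - 1), Neighbour i j →
      Neighbour (shiftIdx p h i) (shiftIdx p h j) := by
    intro i j hij
    simp only [Neighbour, shiftIdx] at hij ⊢
    omega
  have key : ∀ {a b : FreeAlgebra ℂ (Gen m)}, Rel m q μ a b →
      RingQuot.mkAlgHom ℂ (Rel m q μ) a = RingQuot.mkAlgHom ℂ (Rel m q μ) b :=
    fun hab => RingQuot.mkAlgHom_rel ℂ hab
  have hs : ∀ ε (i : Fin (n - 1)), FreeAlgebra.lift ℂ (shiftGen q μ p h) (fs ε i) =
      RingQuot.mkAlgHom ℂ (Rel m q μ) (fs ε (shiftIdx p h i)) := by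
    intro ε i; simp [fs, shiftGen, sigma]
  have hk : ∀ (i : Fin (n - 1)), FreeAlgebra.lift ℂ (shiftGen q μ p h) (fk i) =
      RingQuot.mkAlgHom ℂ (Rel m q μ) (fk (shiftIdx p h i)) := by
    intro i; simp [fk, shiftGen, kappa]
  cases hxy with
  | inverse ε i => simpa [hs, hk] using key (Rel.inverse ε (shiftIdx p h i))
  | braid i j hij => simpa [hs, hk] using key (Rel.braid _ _ (nb i j hij))
  | far i j hij =>
      have hij' : (shiftIdx p h i).val + 1 < (shiftIdx p h j).val := by
        simp only [shiftIdx]; omega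
      simpa [hs, hk] using key (Rel.far _ _ hij')
  | kappa_def i => simpa [hs, hk] using key (Rel.kappa_def (shiftIdx p h i))
  | sigma_kappa i => simpa [hs, hk] using key (Rel.sigma_kappa (shiftIdx p h i))
  | kappa_sigma i => simpa [hs, hk] using key (Rel.kappa_sigma (shiftIdx p h i))
  | kappa_sigma_nb ε i j hij => simpa [hs, hk] using key (Rel.kappa_sigma_nb ε _ _ (nb i j hij))
  | sigma_nb_kappa ε i j hij => simpa [hs, hk] using key (Rel.sigma_nb_kappa ε _ _ (nb i j hij))
  | kappa_kappa_kappa i j hij =>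
      simpa [hs, hk] using key (Rel.kappa_kappa_kappa _ _ (nb i j hij))
  | kappa_sq i => simpa [hs, hk] using key (Rel.kappa_sq (shiftIdx p h i))

/-- The homomorphism `x ↦ x^{↑p}`, `W_n → W_m`, `σ_i ↦ σ_{i+p}`, `κ_i ↦ κ_{i+p}`
(for `p = 0` the standard map `W_n → W_m`). -/
noncomputable def shift {m : ℕ} (p : ℕ) (h : n + p ≤ m) : Alg n q μ →ₐ[ℂ] Alg m q μ :=
  RingQuot.liftAlgHom ℂ ⟨FreeAlgebra.lift ℂ (shiftGen q μ p h), shiftGen_rel p h⟩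

/-- The `q`-number `i_q = (q^i - q^{-i}) / (q - q⁻¹)`. -/
noncomputable def qNum (q : ℂ) (i : ℕ) : ℂ := (q ^ i - (q ^ i)⁻¹) / (q - q⁻¹)

/-- The baxterized element `σ⁻_{i+1}(x) = 1 + (x-1)/(q-q⁻¹) σ_{i+1} + μ(x-1)/(μ+qx) κ_{i+1}`. -/
noncomputable def baxterMinus (x : ℂ) (i : Fin (n - 1)) : Alg n q μ :=
  1 + ((x - 1) / (q - q⁻¹)) • sigma 1 i + (μ * (x - 1) / (μ + q * x)) • kappa i

/-- The `q`-antisymmetrizer `a^{(i)} ∈ W_i(q, μ)`: `a^{(1)} = 1` and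
`a^{(i+1)} = q^i / (i+1)_q · a^{(i)} σ⁻_i(q^{-2i}) a^{(i)}` for `i ≥ 1`.
(The value at `0` is a convention and is not used.) -/
noncomputable def antisymmetrizer (q μ : ℂ) : (i : ℕ) → Alg i q μ
  | 0 => 1
  | 1 => 1
  | i + 2 =>
      (q ^ (i + 1) / qNum q (i + 2)) •
        (shift 0 (by omega) (antisymmetrizer q μ (i + 1)) *
          baxterMinus ((q ^ (2 * (i + 1)))⁻¹) ⟨i, by omega⟩ *
          shift 0 (by omega) (antisymmetrizer q μ (i + 1)))

end BMW

/-! ## Operators on tensor powers -/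

/-- `End(V^{⊗n})` for `V = ℂ^ι`, in the basis of `V^{⊗n}` formed by the tensor products
`e_{a 0} ⊗ ⋯ ⊗ e_{a (n-1)}`, `a : Fin n → ι`. Tensor factors are numbered from `0`. -/
abbrev TensorOp (ι : Type*) (n : ℕ) := Matrix (Fin n → ι) (Fin n → ι) ℂ

namespace TensorOp

variable {ι : Type*} [Fintype ι] [DecidableEq ι] {m n : ℕ}

/-- The operator on `V^{⊗n}` that acts as `X ∈ End(V^{⊗m})` on the tensor factors
`e 0, …, e (m-1)` and as the identity on the others. -/
def onLegs (e : Fin m ↪ Fin n) (X : TensorOp ι m) : TensorOp ι n :=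
  fun a b => if ∀ j, (∀ i, e i ≠ j) → a j = b j then X (a ∘ e) (b ∘ e) else 0

/-- The trace over all tensor factors of `V^{⊗n}` except `e 0, …, e (m-1)`,
which become the factors `0, …, m-1` of the result. -/
def traceExcept (e : Fin m ↪ Fin n) (X : TensorOp ι n) : TensorOp ι m :=
  fun a b => ∑ x : Fin n → ι, ∑ y : Fin n → ι,
    if x ∘ e = a ∧ y ∘ e = b ∧ ∀ j, (∀ i, e i ≠ j) → x j = y j then X x y else 0

/-- The `m` consecutive tensor factors `p, p + 1, …, p + m - 1` of `V^{⊗n}`. -/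
def legs (p m n : ℕ) (h : p + m ≤ n) : Fin m ↪ Fin n :=
  ⟨fun j => ⟨p + j.val, by omega⟩, fun i j hij => by
    have := congrArg Fin.val hij
    simp only at this
    exact Fin.ext (by omega)⟩

/-- The two outer tensor factors of `V^{⊗3}`. -/
def outerLegs : Fin 2 ↪ Fin 3 := ⟨![0, 2], by decide⟩

/-- `X_{i+1}`: the operator `X ∈ End(V^{⊗m})` acting on the tensor factors
`i, …, i + m - 1` of `V^{⊗n}`. -/
def act (n i : ℕ) (X : TensorOp ι m) (h : i + m ≤ n) : TensorOp ι n := onLegs (legs i m n h) X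

/-- The permutation operator `P (u ⊗ v) = v ⊗ u`. -/
def perm : TensorOp ι 2 := fun a b => if a 0 = b 1 ∧ a 1 = b 0 then 1 else 0

/-! ## Yang--Baxter matrices -/

/-- `R ∈ Aut(V^{⊗2})` and `R_1 R_2 R_1 = R_2 R_1 R_2`. -/
structure IsYangBaxter (R : TensorOp ι 2) : Prop where
  isUnit : IsUnit R
  braid : act 3 0 R (by omega) * act 3 1 R (by omega) * act 3 0 R (by omega) =
    act 3 1 R (by omega) * act 3 0 R (by omega) * act 3 1 R (by omega)

/-- `Ψ` satisfies `Tr_(2) R_1 Ψ_2 = Tr_(2) Ψ_1 R_2 = P`. -/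
structure IsSkewInverse (R Ψ : TensorOp ι 2) : Prop where
  right : traceExcept outerLegs (act 3 0 R (by omega) * act 3 1 Ψ (by omega)) = perm
  left : traceExcept outerLegs (act 3 0 Ψ (by omega) * act 3 1 R (by omega)) = perm

/-- `R` is skew invertible. -/
def IsSkewInvertible (R : TensorOp ι 2) : Prop := ∃ Ψ, IsSkewInverse R Ψ

/-- `D_R = Tr_(2) Ψ_R ∈ End(V)`. -/
noncomputable def matD {R : TensorOp ι 2} (h : IsSkewInvertible R) : TensorOp ι 1 :=
  traceExcept (legs 0 1 2 (by omega)) h.choose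

/-- `R` is a Yang--Baxter matrix of BMW type with parameters `q`, `μ`: for each `n` the assignment
`σ_i ↦ R_i` extends to a homomorphism `W_n(q, μ) → End(V^{⊗n})`.
The last field says that the image `K` of `κ_1` is not zero, so that `μ` is a spectral value
of `R`; without it a Hecke type matrix would be of BMW type for each `μ`. -/
structure IsBMWType (R : TensorOp ι 2) (q μ : ℂ) : Prop where
  q_ne_zero : q ≠ 0
  q_ne_one : q ≠ 1
  q_ne_neg_one : q ≠ -1
  mu_ne_zero : μ ≠ 0
  mu_ne_q : μ ≠ q
  mu_ne_neg_inv : μ ≠ -q⁻¹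
  isUnit : IsUnit R
  exists_rep : ∀ n : ℕ, ∃ ρ : BMW.Alg n q μ →ₐ[ℂ] TensorOp ι n,
    ∀ i : Fin (n - 1), ρ (BMW.sigma 1 i) = act n i.val R (by omega)
  kappa_ne_zero : (μ * (q - q⁻¹))⁻¹ • ((q • 1 - R) * (q⁻¹ • 1 + R)) ≠ 0

/-- The Yang--Baxter representation `ρ_R : W_n(q, μ) → End(V^{⊗n})`. It is determined by
`σ_i ↦ R_i`, since the `σ_i^{±1}` generate `W_n(q, μ)`. -/
noncomputable def rho {R : TensorOp ι 2} {q μ : ℂ} (h : IsBMWType R q μ) (n : ℕ) :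
    BMW.Alg n q μ →ₐ[ℂ] TensorOp ι n :=
  (h.exists_rep n).choose

/-- `R` is a skew invertible Yang--Baxter matrix of BMW type, of height `k ≥ 2`. -/
structure HasHeight (R : TensorOp ι 2) (q μ : ℂ) (k : ℕ) : Prop where
  two_le : 2 ≤ k
  skewInvertible : IsSkewInvertible R
  bmw : IsBMWType R q μ
  q_pow_ne : ∀ i : ℕ, 1 ≤ i → i ≤ k → q ^ (2 * i) ≠ 1
  mu_ne : ∀ i : ℕ, 1 ≤ i → i ≤ k → μ ≠ -q ^ (1 - 2 * (i : ℤ))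
  rank_ne_zero : ∀ i : ℕ, 2 ≤ i → i ≤ k → (rho bmw i (BMW.antisymmetrizer q μ i)).rank ≠ 0
  vanish : rho bmw (k + 1)
    (BMW.shift 1 le_rfl (BMW.antisymmetrizer q μ k) *
      BMW.baxterMinus ((q ^ (2 * k))⁻¹) ⟨0, by omega⟩ *
      BMW.shift 1 le_rfl (BMW.antisymmetrizer q μ k)) = 0

/-- `R` is an orthogonal Yang--Baxter matrix of type `O(k)` (with parameter `q`):
it has height `k`, `μ = q^{1-k}`, and `ρ_R(a^{(k)})` has rank one. -/
structure IsOrthogonalType (R : TensorOp ι 2) (q : ℂ) (k : ℕ) : Prop where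
  hasHeight : HasHeight R q (q ^ (1 - (k : ℤ))) k
  rank_eq_one :
    (rho hasHeight.bmw k (BMW.antisymmetrizer q (q ^ (1 - (k : ℤ))) k)).rank = 1

/-- `{R, F}` is a compatible Yang--Baxter pair. -/
structure IsCompatiblePair (R F : TensorOp ι 2) : Prop where
  left : IsYangBaxter R
  right : IsYangBaxter F
  twist₁ : act 3 0 R (by omega) * act 3 1 F (by omega) * act 3 0 F (by omega) =
    act 3 1 F (by omega) * act 3 0 F (by omega) * act 3 1 R (by omega)
  twist₂ : act 3 1 R (by omega) * act 3 0 F (by omega) * act 3 1 F (by omega) =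
    act 3 0 F (by omega) * act 3 1 F (by omega) * act 3 0 R (by omega)

/-- `G_1 = Tr_(23) K_2 F_1⁻¹ F_2⁻¹`, where `K_2 = ρ_R(κ_2)`. -/
noncomputable def opG {R : TensorOp ι 2} {q μ : ℂ} (h : IsBMWType R q μ) (F : TensorOp ι 2) :
    TensorOp ι 1 :=
  traceExcept (legs 0 1 3 (by omega))
    (rho h 3 (BMW.kappa ⟨1, by omega⟩) * act 3 0 F⁻¹ (by omega) * act 3 1 F⁻¹ (by omega))

/-- `O_1 = k_q (1 + q^{2-k}) / (q + q^{1-k}) · Tr_(2,…,k+1) (ρ_R(a^{(k)↑1}) F_1⁻¹ F_2⁻¹ ⋯ F_k⁻¹)`. -/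
noncomputable def opO {R : TensorOp ι 2} {q : ℂ} {k : ℕ} (h : IsOrthogonalType R q k)
    (F : TensorOp ι 2) : TensorOp ι 1 :=
  (BMW.qNum q k * (1 + q ^ (2 - (k : ℤ))) / (q + q ^ (1 - (k : ℤ)))) •
    traceExcept (legs 0 1 (k + 1) (by omega))
      (rho h.hasHeight.bmw (k + 1)
          (BMW.shift 1 le_rfl (BMW.antisymmetrizer q (q ^ (1 - (k : ℤ))) k)) *
        (List.ofFn fun i : Fin k => act (k + 1) i.val F⁻¹ (by omega)).prod)

end TensorOp

/-! ## Families of generators indexed by the integers -/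

/-! All operators are placed in one algebra, `Ops ι`, acting on functions of words indexed by ℤ.
There R_i and K_i satisfy the BMW relations (`System`), chains of F or F⁻¹ slide past them
(`Twist`), and a nonzero matrix can be cancelled against anything commuting with its matrix algebra
(`eq_zero_of_map_mul_eq_zero`). Write A for ρ_R(a^{(k)}), A_i for its copy starting at factor i, and
c for `closure q μ k`, the scalar obtained by closing one strand of a^{(k)}.

Since A has rank one, A_2 X A_2 is A_2 times the partial trace of A_2 X (`op_traceExcept_mul`). The
constant in the definition of O is c⁻¹, so O_1 A_2 = c⁻¹ A_2 F_1⁻¹⋯F_k⁻¹ A_2 = c⁻¹ F_1⁻¹⋯F_k⁻¹ A_1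
A_2. The height condition yields A_1 A_2 = (-1)^{k-1} c R_k⋯R_1 A_2 (`op_alt_mul_op_alt`). Thus on
A_2 the operator O is, up to sign, the loop F_1⁻¹⋯F_k⁻¹ R_k⋯R_1, a strand encircling k others. A
trace count shows that K has rank one as well (`matK_rank_le_one`), and in the same way G_1 K_2 =
F_1⁻¹ F_2⁻¹ R_2 R_1 K_2.

The claims become statements about strands. A strand pulled past A or K carries the operator with
it, which gives O_1 F^{±1} = F^{±1} O_2 (`act_mul_eq_of_compress`). O_1 O_2 is a pair of parallel
loops, through which R_1 travels unchanged. Hence O is a symmetry of R; it is invertible because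
loops are, so it commutes with D_R, which is determined by Tr_(2) R_1 (D_R)_2 = 1, and with G, which
is built from K and F⁻¹.

For O² = G^k, a loop around 2k strands is evaluated twice on k nested cups: two adjacent
antisymmetrizers turn it into O², the cups turn it into G^k. One antisymmetrizer on the cups
produces the other by symmetry (`asym_mul_asym_mul_nest`), and it is finally removed by closing its
strands one at a time (`mul_nest_eq_zero`), which is possible because all closing scalars are
nonzero. -/

namespace BMW

/-- Families `s`, `t = s⁻¹`, `e` indexed by `ℤ` that satisfy the relations of the generators
`σ_i`, `σ_i⁻¹`, `κ_i` of the Birman--Murakami--Wenzl algebras. -/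
structure System {A : Type*} [Ring A] [Algebra ℂ A] (q μ : ℂ) (s t e : ℤ → A) : Prop where
  q_ne : q ≠ 0
  lam_ne : q - q⁻¹ ≠ 0
  mu_ne : μ ≠ 0
  st : ∀ i, s i * t i = 1
  ts : ∀ i, t i * s i = 1
  braid : ∀ i, s i * s (i + 1) * s i = s (i + 1) * s i * s (i + 1)
  far : ∀ i j, i + 1 < j → Commute (s i) (s j)
  e_def : ∀ i, e i = (μ * (q - q⁻¹))⁻¹ • ((q • 1 - s i) * (q⁻¹ • 1 + s i))
  se : ∀ i, s i * e i = μ • e i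
  es : ∀ i, e i * s i = μ • e i
  es_nb : ∀ i j, j = i + 1 ∨ i = j + 1 → e i * s j = e i * e j * t i
  et_nb : ∀ i j, j = i + 1 ∨ i = j + 1 → e i * t j = e i * e j * s i
  se_nb : ∀ i j, j = i + 1 ∨ i = j + 1 → s j * e i = t i * e j * e i
  te_nb : ∀ i j, j = i + 1 ∨ i = j + 1 → t j * e i = s i * e j * e i
  eee : ∀ i j, j = i + 1 ∨ i = j + 1 → e i * e j * e i = e i
  ee : ∀ i, e i * e i = eta q μ • e i

section
variable {A : Type*} [Ring A] [Algebra ℂ A]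

/-- `1 + (x-1)/(q-q⁻¹) s + μ(x-1)/(μ+qx) e`. -/
noncomputable def bax (q μ : ℂ) (s e : A) (x : ℂ) : A :=
  1 + ((x - 1) / (q - q⁻¹)) • s + (μ * (x - 1) / (μ + q * x)) • e

/-- The `q`-antisymmetrizer on the `n` strands `p, …, p + n - 1`. -/
noncomputable def asym (q μ : ℂ) (s e : ℤ → A) (p : ℤ) : ℕ → A
  | 0 => 1
  | 1 => 1
  | n + 2 => (q ^ (n + 1) / qNum q (n + 2)) •
      (asym q μ s e p (n + 1) * bax q μ (s (p + n)) (e (p + n)) ((q ^ (2 * (n + 1)))⁻¹) *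
        asym q μ s e p (n + 1))

/-- The parameters are generic enough for the antisymmetrizers on at most `n` strands. -/
def Generic (q μ : ℂ) (n : ℕ) : Prop :=
  ∀ i : ℕ, 1 ≤ i → i ≤ n → q ^ (2 * i) ≠ 1 ∧ μ ≠ -q ^ (1 - 2 * (i : ℤ))

theorem Generic.mono {q μ : ℂ} {m n : ℕ} (h : Generic q μ n) (hmn : m ≤ n) : Generic q μ m :=
  fun i h1 h2 => h i h1 (h2.trans hmn)

theorem Generic.qNum_ne {q μ : ℂ} {n i : ℕ} (h : Generic q μ n) (hq : q ≠ 0)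
    (hl : q - q⁻¹ ≠ 0) (h1 : 1 ≤ i) (h2 : i ≤ n) : qNum q i ≠ 0 := by
  have h3 := (h i h1 h2).1
  have h4 : q ^ i ≠ 0 := pow_ne_zero _ hq
  refine div_ne_zero (fun h5 => h3 ?_) hl
  field_simp at h5
  rw [mul_comm 2 i, pow_mul]
  linear_combination h5

theorem Generic.mu_add_ne {q μ : ℂ} {n i : ℕ} (h : Generic q μ n) (hq : q ≠ 0)
    (h1 : 1 ≤ i) (h2 : i ≤ n) : μ + q * (q ^ (2 * i))⁻¹ ≠ 0 := by
  intro h3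
  refine (h i h1 h2).2 ?_
  rw [zpow_sub₀ hq, zpow_one, zpow_mul, zpow_natCast]
  have : ((q ^ (2 : ℤ)) ^ i) = q ^ (2 * i) := by
    rw [pow_mul]; norm_cast
  rw [this]
  linear_combination h3

theorem bax_commute {q μ x : ℂ} {s e z : A} (hs : Commute z s) (he : Commute z e) :
    Commute z (bax q μ s e x) :=
  ((Commute.one_right z).add_right (hs.smul_right _)).add_right (he.smul_right _)

theorem asym_commute {q μ : ℂ} {s e : ℤ → A} {z : A} (p : ℤ) : ∀ n : ℕ,
    (∀ i, p ≤ i → i + 1 < p + n → Commute z (s i) ∧ Commute z (e i)) →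
    Commute z (asym q μ s e p n)
  | 0, _ => Commute.one_right z
  | 1, _ => Commute.one_right z
  | n + 2, h => by
      have ih := asym_commute (q := q) (μ := μ) p (n + 1)
        (fun i h1 h2 => h i h1 (by push_cast at h2 ⊢; omega))
      have h0 := h (p + n) (by omega) (by push_cast; omega)
      exact ((ih.mul_right (bax_commute h0.1 h0.2)).mul_right ih).smul_right _

/-- The recursion is palindromic. With `System.op` this turns every left-handed fact about
antisymmetrizers into its right-handed version. -/
theorem asym_op {q μ : ℂ} (s e : ℤ → A) (p : ℤ) : ∀ n : ℕ,
    asym q μ (fun i => MulOpposite.op (s i)) (fun i => MulOpposite.op (e i)) p n =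
      MulOpposite.op (asym q μ s e p n)
  | 0 => rfl
  | 1 => rfl
  | n + 2 => by
      simp only [asym, asym_op s e p (n + 1), bax]
      simp [mul_assoc]

/-- If `a` intertwines the generators, it intertwines the antisymmetrizers. -/
theorem asym_intertwine {q μ : ℂ} {s e s' e' : ℤ → A} {D : A} (p p' : ℤ) : ∀ n : ℕ,
    (∀ i : ℕ, i + 1 < n → D * s (p + i) = s' (p' + i) * D ∧ D * e (p + i) = e' (p' + i) * D) →
    D * asym q μ s e p n = asym q μ s' e' p' n * D
  | 0, _ => by simp [asym]
  | 1, _ => by simp [asym]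
  | n + 2, h => by
      have ih := asym_intertwine (q := q) (μ := μ) p p' (n + 1)
        (fun i hi => h i (by omega))
      obtain ⟨h1, h2⟩ := h n (by omega)
      have hb : D * bax q μ (s (p + n)) (e (p + n)) ((q ^ (2 * (n + 1)))⁻¹) =
          bax q μ (s' (p' + n)) (e' (p' + n)) ((q ^ (2 * (n + 1)))⁻¹) * D := by
        simp only [bax, mul_add, add_mul, mul_one, one_mul, mul_smul_comm, smul_mul_assoc, h1, h2]
      simp only [asym, mul_smul_comm, smul_mul_assoc]
      rw [← mul_assoc, ← mul_assoc, ih, mul_assoc _ D, hb, ← mul_assoc, mul_assoc _ D, ih,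
        mul_assoc, mul_assoc, mul_assoc]
end

/-! ### Symmetries and elementary consequences of the BMW relations -/

namespace System
variable {A : Type*} [Ring A] [Algebra ℂ A] {q μ : ℂ} {s t e : ℤ → A}

theorem op (h : System q μ s t e) : System q μ (fun i => MulOpposite.op (s i))
    (fun i => MulOpposite.op (t i)) (fun i => MulOpposite.op (e i)) where
  q_ne := h.q_ne
  lam_ne := h.lam_ne
  mu_ne := h.mu_ne
  st i := by simp only [← MulOpposite.op_mul, h.ts, MulOpposite.op_one]
  ts i := by simp only [← MulOpposite.op_mul, h.st, MulOpposite.op_one]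
  braid i := by simp only [← MulOpposite.op_mul, ← mul_assoc, h.braid]
  far i j hij := by
    simp only [Commute, SemiconjBy, ← MulOpposite.op_mul, (h.far i j hij).eq]
  e_def i := by
    rw [h.e_def i]
    apply MulOpposite.unop_injective
    simp only [MulOpposite.unop_op, MulOpposite.unop_smul, MulOpposite.unop_mul,
      MulOpposite.unop_add, MulOpposite.unop_sub, MulOpposite.unop_one]
    congr 1
    simp only [mul_add, add_mul, mul_sub, sub_mul, mul_smul_comm, smul_mul_assoc, mul_one, one_mul]
    module
  se i := by simp only [← MulOpposite.op_mul, h.es, MulOpposite.op_smul]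
  es i := by simp only [← MulOpposite.op_mul, h.se, MulOpposite.op_smul]
  es_nb i j hij := by simp only [← MulOpposite.op_mul, ← mul_assoc, h.se_nb i j hij]
  et_nb i j hij := by simp only [← MulOpposite.op_mul, ← mul_assoc, h.te_nb i j hij]
  se_nb i j hij := by simp only [← MulOpposite.op_mul, h.es_nb i j hij, mul_assoc]
  te_nb i j hij := by simp only [← MulOpposite.op_mul, h.et_nb i j hij, mul_assoc]
  eee i j hij := by simp only [← MulOpposite.op_mul, ← mul_assoc, h.eee i j hij]
  ee i := by simp only [← MulOpposite.op_mul, h.ee i, MulOpposite.op_smul]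

/-- Reflection of the strands; it turns statements about the last strand into statements about the
first. -/
theorem mirror (h : System q μ s t e) :
    System q μ (fun i => s (-i)) (fun i => t (-i)) (fun i => e (-i)) where
  q_ne := h.q_ne
  lam_ne := h.lam_ne
  mu_ne := h.mu_ne
  st i := h.st _
  ts i := h.ts _
  braid i := by
    have := h.braid (-(i + 1))
    rw [show -(i + 1) + 1 = -i by ring] at this
    exact this.symm
  far i j hij := (h.far (-j) (-i) (by omega)).symm
  e_def i := h.e_def _
  se i := h.se _
  es i := h.es _
  es_nb i j hij := h.es_nb _ _ (by omega)
  et_nb i j hij := h.et_nb _ _ (by omega)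
  se_nb i j hij := h.se_nb _ _ (by omega)
  te_nb i j hij := h.te_nb _ _ (by omega)
  eee i j hij := h.eee _ _ (by omega)
  ee i := h.ee _

theorem s_sq (h : System q μ s t e) (i : ℤ) : s i * s i = 1 + (q - q⁻¹) • s i - (μ * (q - q⁻¹)) • e i := by
  have h1 : μ * (q - q⁻¹) ≠ 0 := mul_ne_zero h.mu_ne h.lam_ne
  rw [h.e_def i, smul_smul, mul_inv_cancel₀ h1, one_smul]
  simp only [mul_add, sub_mul, mul_smul_comm, smul_mul_assoc, mul_one, one_mul]
  have := mul_inv_cancel₀ h.q_ne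
  match_scalars <;> first | ring1 | linear_combination this

theorem t_eq (h : System q μ s t e) (i : ℤ) :
    t i = s i - (q - q⁻¹) • (1 : A) + (q - q⁻¹) • e i := by
  have h1 : s i * (s i - (q - q⁻¹) • (1 : A) + (q - q⁻¹) • e i) = 1 := by
    rw [mul_add, mul_sub, h.s_sq, mul_smul_comm, mul_smul_comm, h.se, mul_one]
    module
  calc t i = t i * (s i * (s i - (q - q⁻¹) • (1 : A) + (q - q⁻¹) • e i)) := by rw [h1, mul_one]
    _ = _ := by rw [← mul_assoc, h.ts, one_mul]

theorem te (h : System q μ s t e) (i : ℤ) : t i * e i = μ⁻¹ • e i := by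
  have h1 := h.se i
  calc t i * e i = μ⁻¹ • (t i * (μ • e i)) := by
        rw [mul_smul_comm, smul_smul, inv_mul_cancel₀ h.mu_ne, one_smul]
    _ = _ := by rw [← h1, ← mul_assoc, h.ts, one_mul]

theorem commute_e_of (h : System q μ s t e) {z : A} {i : ℤ} (hz : Commute z (s i)) :
    Commute z (e i) := by
  rw [h.e_def]
  exact ((((Commute.one_right z).smul_right _).sub_right hz).mul_right
    (((Commute.one_right z).smul_right _).add_right hz)).smul_right _

theorem far' (h : System q μ s t e) {i j : ℤ} (hij : i + 1 < j ∨ j + 1 < i) :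
    Commute (s i) (s j) :=
  hij.elim (h.far i j) fun h' => (h.far j i h').symm

theorem se_far (h : System q μ s t e) {i j : ℤ} (hij : i + 1 < j ∨ j + 1 < i) :
    Commute (s i) (e j) := h.commute_e_of (h.far' hij)

theorem ee_far (h : System q μ s t e) {i j : ℤ} (hij : i + 1 < j ∨ j + 1 < i) :
    Commute (e i) (e j) := h.commute_e_of (h.se_far hij.symm).symm

/-- `e_i s_{i±1} e_i = μ⁻¹ e_i`. -/
theorem ese (h : System q μ s t e) {i j : ℤ} (hij : j = i + 1 ∨ i = j + 1) :
    e i * s j * e i = μ⁻¹ • e i := by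
  rw [h.es_nb i j hij, mul_assoc, h.te, mul_smul_comm, h.eee i j hij]

/-- `κ_1 κ_2 = σ_2 σ_1 κ_2`. -/
theorem ee_eq_sse (h : System q μ s t e) {i j : ℤ} (hij : j = i + 1 ∨ i = j + 1) :
    e i * e j = s j * s i * e j := by
  have h1 := h.se_nb j i hij.symm
  rw [mul_assoc, h1, ← mul_assoc, ← mul_assoc, h.st, one_mul]

/-- `κ_1 κ_2 = κ_1 σ_2 σ_1`. -/
theorem ee_eq_ess (h : System q μ s t e) {i j : ℤ} (hij : j = i + 1 ∨ i = j + 1) :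
    e i * e j = e i * s j * s i := by
  have h1 := h.es_nb i j hij
  rw [h1, mul_assoc, h.ts, mul_one]

theorem e_of_s_left (h : System q μ s t e) {z : A} {i : ℤ} (hz : s i * z = -q⁻¹ • z) :
    e i * z = 0 := by
  rw [h.e_def, smul_mul_assoc, mul_assoc, add_mul, hz, smul_mul_assoc, one_mul, ← add_smul,
    add_neg_cancel, zero_smul, mul_zero, smul_zero]

theorem e_of_s_right (h : System q μ s t e) {z : A} {i : ℤ} (hz : z * s i = -q⁻¹ • z) :
    z * e i = 0 :=
  MulOpposite.op_injective (by
    simpa using h.op.e_of_s_left (z := MulOpposite.op z) (i := i)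
      (by rw [← MulOpposite.op_mul, hz, MulOpposite.op_smul]))

theorem t_of_s_left (h : System q μ s t e) {z : A} {i : ℤ} (hz : s i * z = -q⁻¹ • z) :
    t i * z = -q • z := by
  have h1 : z = -q • (s i * z) := by
    rw [hz, smul_smul, neg_mul_neg, mul_inv_cancel₀ h.q_ne, one_smul]
  calc t i * z = t i * (-q • (s i * z)) := by rw [← h1]
    _ = -q • z := by rw [mul_smul_comm, ← mul_assoc, h.ts, one_mul]

/-- `σ_i + q⁻¹` annihilates the baxterized element at `q⁻²`. -/
theorem bax_mul_self (h : System q μ s t e) (hμ : μ + q * (q ^ 2)⁻¹ ≠ 0) (i : ℤ) :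
    bax q μ (s i) (e i) (q ^ 2)⁻¹ * s i = -q⁻¹ • bax q μ (s i) (e i) (q ^ 2)⁻¹ := by
  have hq := h.q_ne
  have hl := h.lam_ne
  have hm := h.mu_ne
  have h2 : (q ^ 2)⁻¹ - 1 = -q⁻¹ * (q - q⁻¹) := by field_simp; ring
  have h3 : q * (q ^ 2)⁻¹ = q⁻¹ := by field_simp
  rw [h3] at hμ
  simp only [bax, add_mul, smul_mul_assoc, one_mul, h.s_sq, h.es, h2, h3]
  have h4 : q * μ + 1 ≠ 0 := fun h0 => hμ (by field_simp; linear_combination h0)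
  simp only [div_eq_mul_inv, mul_assoc, mul_inv_cancel₀ hl]
  match_scalars <;> field_simp <;> ring

/-- Where σ acts as -q⁻¹, κ vanishes because it contains the factor q⁻¹ + σ, so the baxterized
element is a scalar. -/
theorem bax_value (h : System q μ s t e) {z : A} {i : ℤ} (hz : s i * z = -q⁻¹ • z) (x : ℂ) :
    bax q μ (s i) (e i) x * z = (1 - q⁻¹ * ((x - 1) / (q - q⁻¹))) • z := by
  simp only [bax, add_mul, smul_mul_assoc, one_mul, hz, h.e_of_s_left hz, smul_zero]
  module

/-- The step in the absorption property of the antisymmetrizers. -/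
theorem bax_bax_absorb (h : System q μ s t e) {a : A} {i j : ℤ} (hij : j = i + 1)
    (ha : a * s i = -q⁻¹ • a) {x : ℂ} (hx : μ + q * x ≠ 0) (hx' : μ + q * ((q ^ 2)⁻¹ * x) ≠ 0) :
    a * bax q μ (s j) (e j) ((q ^ 2)⁻¹ * x) * bax q μ (s i) (e i) x * s j =
      -q⁻¹ • (a * bax q μ (s j) (e j) ((q ^ 2)⁻¹ * x) * bax q μ (s i) (e i) x) := by
  have hq := h.q_ne
  have hl := h.lam_ne
  have hm := h.mu_ne
  have hij' : j = i + 1 ∨ i = j + 1 := Or.inl hij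
  have ha0 : a * e i = 0 := h.e_of_s_right ha
  have hat : a * t i = -q • a := by
    have h1 : a = -q • (a * s i) := by
      rw [ha, smul_smul, neg_mul_neg, mul_inv_cancel₀ h.q_ne, one_smul]
    calc a * t i = (-q • (a * s i)) * t i := by rw [← h1]
      _ = -q • a := by rw [smul_mul_assoc, mul_assoc, h.st, mul_one]
  -- The identities `m1` to `m6` reduce all terms to a and the monomials a s_j s_i, a e_j s_i, a e_j
  -- e_i, a s_j, a e_j; the claim is then a comparison of coefficients.
  have m1 : a * s j * s i * s j = -q⁻¹ • (a * s j * s i) := by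
    have := h.braid i
    rw [← hij] at this
    rw [mul_assoc, mul_assoc, ← mul_assoc (s j), ← this, ← mul_assoc, ← mul_assoc, ha,
      smul_mul_assoc, smul_mul_assoc]
  have m2 : a * e j * s i * s j = a * e j * e i := by
    rw [mul_assoc, mul_assoc, ← mul_assoc (e j), ← h.ee_eq_ess hij'.symm, mul_assoc]
  have m3 : a * s j * e i = -q • (a * e j * e i) := by
    rw [mul_assoc, h.se_nb i j hij', ← mul_assoc, ← mul_assoc, hat, smul_mul_assoc,
      smul_mul_assoc]
  have m4 : a * e j * e i * s j = a * e j * s i - (q - q⁻¹) • (a * e j)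
      + (q - q⁻¹) • (a * e j * e i) := by
    have : e j * e i * s j = e j * t i := (h.et_nb j i hij'.symm).symm
    rw [mul_assoc, mul_assoc, ← mul_assoc (e j), this, h.t_eq, mul_add, mul_sub, mul_smul_comm,
      mul_smul_comm, mul_add, mul_sub, mul_smul_comm, mul_smul_comm, mul_one, ← mul_assoc,
      ← mul_assoc]
  have m5 : a * s j * s j = a + (q - q⁻¹) • (a * s j) - (μ * (q - q⁻¹)) • (a * e j) := by
    rw [mul_assoc, h.s_sq, mul_sub, mul_add, mul_smul_comm, mul_smul_comm, mul_one]
  have m6 : a * e j * s j = μ • (a * e j) := by rw [mul_assoc, h.es, mul_smul_comm]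
  simp only [bax, mul_add, add_mul, mul_smul_comm, smul_mul_assoc, mul_one, ha, ha0, m1, m2, m3,
    m4, m5, m6, smul_zero, smul_add, smul_sub, smul_smul, zero_mul]
  generalize a * s j * s i = y1
  generalize a * e j * s i = y2
  generalize a * e j * e i = y3
  generalize a * s j = y4
  generalize a * e j = y5
  have hl' : q ^ 2 - 1 ≠ 0 := fun h0 => hl (by field_simp; linear_combination h0)
  have hx1 : μ * q + x ≠ 0 := fun h0 => hx' (by field_simp; linear_combination h0)
  have hx2 : q * μ + x ≠ 0 := by rwa [mul_comm q]
  have hx3 : μ + x * q ≠ 0 := by rwa [mul_comm x]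
  match_scalars <;> field_simp <;> ring

end System
end BMW

/-! ### Antisymmetrizers: absorption, idempotence and closing a strand -/

namespace BMW
namespace System
variable {A : Type*} [Ring A] [Algebra ℂ A] {q μ : ℂ} {s t e : ℤ → A}

/-- The normalisation in the recursion is the inverse of the value of σ⁻(q^{-2(n+1)}) at σ = -q⁻¹, κ
= 0; this makes the antisymmetrizers idempotent. -/
theorem asym_coeff (h : System q μ s t e) (n : ℕ) (hn : qNum q (n + 2) ≠ 0) :
    q ^ (n + 1) / qNum q (n + 2) *
      (1 - q⁻¹ * (((q ^ (2 * (n + 1)))⁻¹ - 1) / (q - q⁻¹))) = 1 := by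
  have hq := h.q_ne
  have hl := h.lam_ne
  rw [div_mul_eq_mul_div, div_eq_one_iff_eq hn, qNum, eq_div_iff hl, mul_assoc, sub_mul, mul_assoc,
    div_mul_cancel₀ _ hl]
  have : q ^ n ≠ 0 := pow_ne_zero _ hq
  rw [show 2 * (n + 1) = n + n + 2 by ring]
  simp only [pow_add]
  field_simp
  ring

/-- The antisymmetrizer acts as the identity where all `s_i` act as `-q⁻¹`. -/
theorem asym_mul_of (h : System q μ s t e) (p : ℤ) {z : A} : ∀ n : ℕ, Generic q μ n →
    (∀ i : ℕ, i + 1 < n → s (p + i) * z = -q⁻¹ • z) → asym q μ s e p n * z = z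
  | 0, _, _ => one_mul z
  | 1, _, _ => one_mul z
  | n + 2, hg, hz => by
      have ih := asym_mul_of h p (n + 1) (hg.mono (by omega)) (fun i hi => hz i (by omega))
      have h1 := h.bax_value (hz n (by omega)) ((q ^ (2 * (n + 1)))⁻¹)
      rw [asym, smul_mul_assoc, mul_assoc, ih, mul_assoc, h1, mul_smul_comm, ih, smul_smul,
        h.asym_coeff n (hg.qNum_ne h.q_ne h.lam_ne (by omega) le_rfl), one_smul]

theorem mul_asym_of (h : System q μ s t e) (p : ℤ) {z : A} (n : ℕ) (hg : Generic q μ n)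
    (hz : ∀ i : ℕ, i + 1 < n → z * s (p + i) = -q⁻¹ • z) : z * asym q μ s e p n = z := by
  apply MulOpposite.op_injective
  rw [MulOpposite.op_mul, ← asym_op]
  refine h.op.asym_mul_of p n hg fun i hi => ?_
  rw [← MulOpposite.op_mul, hz i hi, MulOpposite.op_smul]

/-- The antisymmetrizer absorbs the generators. -/
theorem asym_mul_s (h : System q μ s t e) (p : ℤ) : ∀ n : ℕ, Generic q μ n →
    ∀ i : ℕ, i + 1 < n → asym q μ s e p n * s (p + i) = -q⁻¹ • asym q μ s e p n
  | 0, _, i, hi => by omega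
  | 1, _, i, hi => by omega
  | n + 2, hg, i, hi => by
      have ih := asym_mul_s h p (n + 1) (hg.mono (by omega))
      rcases Nat.lt_or_ge (i + 1) (n + 1) with hi' | hi'
      · rw [asym, smul_mul_assoc, mul_assoc, ih i hi', mul_smul_comm, smul_comm]
      obtain rfl : i = n := by omega
      rw [asym, smul_mul_assoc, smul_comm]
      congr 1
      rcases i with - | m
      · simp only [asym, one_mul, mul_one]
        exact h.bax_mul_self (hg.mu_add_ne h.q_ne (i := 1) (by omega) (by omega)) _
      -- Only the newest generator is not absorbed by the right factor a. Expand that factor as a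
      -- multiple of b y b: the left b commutes with x and is absorbed by a, the right b commutes
      -- with the newest generator, and a x y is left for `bax_bax_absorb`.
      · have hb := h.mul_asym_of p (z := asym q μ s e p (m + 2)) (m + 1) (hg.mono (by omega))
          (fun i hi => ih i (by omega))
        have hx : ((q ^ (2 * (m + 1 + 1)))⁻¹ : ℂ) = (q ^ 2)⁻¹ * (q ^ (2 * (m + 1)))⁻¹ := by
          rw [← mul_inv, ← pow_add]; congr 2; ring
        have hj : p + ((m + 1 : ℕ) : ℤ) = (p + m) + 1 := by push_cast; ring
        have key := h.bax_bax_absorb (i := p + m) (j := p + ((m + 1 : ℕ) : ℤ)) hj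
          (a := asym q μ s e p (m + 2)) (ih m (by omega)) (x := (q ^ (2 * (m + 1)))⁻¹)
          (hg.mu_add_ne h.q_ne (by omega) (by omega))
          (by rw [← hx]; exact hg.mu_add_ne h.q_ne (by omega) (by omega))
        rw [hx]
        set a := asym q μ s e p (m + 2) with ha
        set b := asym q μ s e p (m + 1) with hb'
        set x := bax q μ (s (p + ((m + 1 : ℕ) : ℤ))) (e (p + ((m + 1 : ℕ) : ℤ)))
          ((q ^ 2)⁻¹ * (q ^ (2 * (m + 1)))⁻¹) with hx'
        set y := bax q μ (s (p + m)) (e (p + m)) ((q ^ (2 * (m + 1)))⁻¹) with hy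
        have hcs : Commute (s (p + ((m + 1 : ℕ) : ℤ))) b := asym_commute p (m + 1)
          fun i h1 h2 => ⟨h.far' (by push_cast at *; omega), h.se_far (by push_cast at *; omega)⟩
        have hce : Commute (e (p + ((m + 1 : ℕ) : ℤ))) b := asym_commute p (m + 1)
          fun i h1 h2 => ⟨(h.se_far (by push_cast at *; omega)).symm,
            h.ee_far (by push_cast at *; omega)⟩
        have hcx : Commute b x := bax_commute hcs.symm hce.symm
        have hae : a = (q ^ (m + 1) / qNum q (m + 2)) • (b * y * b) := rfl
        have h1 : a * x * (b * y * b) = a * x * y * b := by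
          rw [← mul_assoc, ← mul_assoc, mul_assoc a x b, ← hcx.eq, ← mul_assoc a b x, hb]
        calc a * x * a * s (p + ((m + 1 : ℕ) : ℤ))
            = a * x * ((q ^ (m + 1) / qNum q (m + 2)) • (b * y * b)) *
                s (p + ((m + 1 : ℕ) : ℤ)) := by rw [← hae]
          _ = (q ^ (m + 1) / qNum q (m + 2)) • (a * x * y * s (p + ((m + 1 : ℕ) : ℤ)) * b) := by
              rw [mul_smul_comm, smul_mul_assoc, h1, mul_assoc _ b, ← hcs.eq, ← mul_assoc]
          _ = -q⁻¹ • (a * x * ((q ^ (m + 1) / qNum q (m + 2)) • (b * y * b))) := by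
              rw [key, smul_mul_assoc, smul_comm, ← h1, mul_smul_comm]
          _ = _ := by rw [← hae]

theorem s_mul_asym (h : System q μ s t e) (p : ℤ) (n : ℕ) (hg : Generic q μ n)
    (i : ℕ) (hi : i + 1 < n) : s (p + i) * asym q μ s e p n = -q⁻¹ • asym q μ s e p n := by
  apply MulOpposite.op_injective
  rw [MulOpposite.op_mul, MulOpposite.op_smul, ← asym_op]
  exact h.op.asym_mul_s p n hg i hi

theorem asym_idem (h : System q μ s t e) (p : ℤ) (n : ℕ) (hg : Generic q μ n) :
    asym q μ s e p n * asym q μ s e p n = asym q μ s e p n :=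
  h.asym_mul_of p n hg fun i hi => h.s_mul_asym p n hg i hi

/-- The antisymmetrizer is symmetric under the reversal of the strands. -/
theorem asym_mirror (h : System q μ s t e) (p : ℤ) (n : ℕ) (hg : Generic q μ n) :
    asym q μ (fun i => s (-i)) (fun i => e (-i)) p n = asym q μ s e (2 - p - n) n := by
  -- Each of the two antisymmetrizers is fixed by the other, because both give -q⁻¹ on every
  -- generator; their product therefore equals both.
  have h1 := h.asym_mul_of (2 - p - n)
    (z := asym q μ (fun i => s (-i)) (fun i => e (-i)) p n) n hg fun i hi => by
      have := h.mirror.s_mul_asym p n hg (n - 2 - i) (by omega)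
      rwa [show -(p + ((n - 2 - i : ℕ) : ℤ)) = 2 - p - n + i by omega] at this
  have h2 := h.mirror.mul_asym_of p (z := asym q μ s e (2 - p - n) n) n hg fun i hi => by
      have := h.asym_mul_s (2 - p - n) n hg (n - 2 - i) (by omega)
      rwa [show 2 - p - n + ((n - 2 - i : ℕ) : ℤ) = -(p + i) by omega] at this
  rw [← h1, h2]

/-- The scalars in `e_{p+n-1} a^{(n)} e_{p+n-1} = c_n e_{p+n-1} a^{(n-1)}`. -/
noncomputable def _root_.BMW.closure (q μ : ℂ) : ℕ → ℂ
  | 0 => 1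
  | 1 => eta q μ
  | n + 2 => q ^ (n + 1) / qNum q (n + 2) *
      (eta q μ + ((q ^ (2 * (n + 1)))⁻¹ - 1) / (q - q⁻¹) * μ⁻¹ +
        μ * ((q ^ (2 * (n + 1)))⁻¹ - 1) / (μ + q * (q ^ (2 * (n + 1)))⁻¹))

/-- Closing the last strand of an antisymmetrizer. -/
theorem e_asym_e (h : System q μ s t e) (p : ℤ) : ∀ n : ℕ, Generic q μ n →
    e (p + n) * asym q μ s e p (n + 1) * e (p + n) =
      closure q μ (n + 1) • (e (p + n) * asym q μ s e p n)
  | 0, _ => by simp [asym, closure, h.ee]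
  | n + 1, hg => by
      have hc : Commute (e (p + ((n + 1 : ℕ) : ℤ))) (asym q μ s e p (n + 1)) :=
        asym_commute p (n + 1) fun i h1 h2 => ⟨(h.se_far (by push_cast at *; omega)).symm,
          h.ee_far (by push_cast at *; omega)⟩
      have hid := h.asym_idem p (n + 1) hg
      have hj : p + n = p + ((n + 1 : ℕ) : ℤ) + 1 ∨ p + ((n + 1 : ℕ) : ℤ) = p + n + 1 := by
        right; push_cast; ring
      rw [asym, closure]
      set E := e (p + ((n + 1 : ℕ) : ℤ))
      set a := asym q μ s e p (n + 1)
      -- The inner a commutes with E, so only the baxterized factor is compressed, by E² = ηE, E σ E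
      -- = μ⁻¹E and E κ E = E.
      have hb : E * bax q μ (s (p + n)) (e (p + n)) ((q ^ (2 * (n + 1)))⁻¹) * E =
          (eta q μ + ((q ^ (2 * (n + 1)))⁻¹ - 1) / (q - q⁻¹) * μ⁻¹ +
            μ * ((q ^ (2 * (n + 1)))⁻¹ - 1) / (μ + q * (q ^ (2 * (n + 1)))⁻¹)) • E := by
        simp only [bax, mul_add, add_mul, mul_smul_comm, smul_mul_assoc, mul_one]
        rw [h.ee, h.ese hj, h.eee _ _ hj]
        module
      set x := bax q μ (s (p + n)) (e (p + n)) ((q ^ (2 * (n + 1)))⁻¹)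
      rw [mul_smul_comm, smul_mul_assoc, mul_smul]
      congr 1
      calc E * (a * x * a) * E = a * (E * x * E) * a := by
            rw [← mul_assoc, ← mul_assoc, hc.eq, mul_assoc _ a E, ← hc.eq]
            simp only [mul_assoc]
            rw [← mul_assoc E a, hc.eq, mul_assoc]
        _ = _ := by rw [hb, mul_smul_comm, smul_mul_assoc, ← hc.eq, mul_assoc, hid]

/-- Closing the first strand of an antisymmetrizer. -/
theorem e_asym_e_left (h : System q μ s t e) (p : ℤ) (n : ℕ) (hg : Generic q μ (n + 1)) :
    e p * asym q μ s e (p + 1) (n + 1) * e p =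
      closure q μ (n + 1) • (e p * asym q μ s e (p + 2) n) := by
  have h1 := h.mirror.e_asym_e (-p - n) n (hg.mono (by omega))
  rw [h.asym_mirror _ _ hg, h.asym_mirror _ _ (hg.mono (by omega))] at h1
  rwa [show 2 - (-p - n) - ((n + 1 : ℕ) : ℤ) = p + 1 by push_cast; ring,
    show 2 - (-p - (n : ℤ)) - n = p + 2 by ring, show -(-p - (n : ℤ) + n) = p by ring] at h1

end System

/-- The factored form exhibits the zeros of the closing scalars; it serves both for their
nonvanishing and for their value at the top. -/
theorem closure_eq {q μ : ℂ} (hq : q ≠ 0) (hl : q - q⁻¹ ≠ 0) (hm : μ ≠ 0) (n : ℕ)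
    (hn : qNum q (n + 1) ≠ 0) (h2 : μ + q * (q ^ (2 * n))⁻¹ ≠ 0) :
    closure q μ (n + 1) = q ^ n / qNum q (n + 1) *
      ((μ + q⁻¹ * (q ^ (2 * n))⁻¹) * (q ^ 2 * (q ^ (2 * n))⁻¹ - μ ^ 2) /
        ((q - q⁻¹) * (μ * (μ + q * (q ^ (2 * n))⁻¹)))) := by
  have hl' : q ^ 2 - 1 ≠ 0 := fun h0 => hl (by field_simp; linear_combination h0)
  rcases n with - | n
  · have h1 : qNum q 1 = 1 := by simp [qNum, div_self hl]
    have h3 : μ + q ≠ 0 := by simpa using h2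
    simp only [closure, eta, zero_add, h1, mul_zero, pow_zero, inv_one, mul_one, one_mul, div_one]
    field_simp
    ring
  · simp only [closure, eta]
    congr 1
    generalize (q ^ (2 * (n + 1)))⁻¹ = y at *
    have h3 : μ + y * q ≠ 0 := by rwa [mul_comm y]
    field_simp
    ring

end BMW

/-! ### Strands sliding past generators -/

namespace BMW
section
variable {A : Type*} [Ring A]

/-- `f_{p+n-1} ⋯ f_{p+1} f_p`. -/
def desc (f : ℤ → A) (p : ℤ) : ℕ → A
  | 0 => 1
  | n + 1 => f (p + n) * desc f p n

/-- `f_p f_{p+1} ⋯ f_{p+n-1}`. -/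
def asc (f : ℤ → A) (p : ℤ) : ℕ → A
  | 0 => 1
  | n + 1 => asc f p n * f (p + n)

theorem desc_commute {f : ℤ → A} {z : A} (p : ℤ) : ∀ n : ℕ,
    (∀ i, p ≤ i → i < p + n → Commute z (f i)) → Commute z (desc f p n)
  | 0, _ => Commute.one_right z
  | n + 1, h => (h (p + n) (by omega) (by push_cast; omega)).mul_right
      (desc_commute p n fun i h1 h2 => h i h1 (by push_cast; omega))

theorem asc_commute {f : ℤ → A} {z : A} (p : ℤ) : ∀ n : ℕ,
    (∀ i, p ≤ i → i < p + n → Commute z (f i)) → Commute z (asc f p n)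
  | 0, _ => Commute.one_right z
  | n + 1, h => (asc_commute p n fun i h1 h2 => h i h1 (by push_cast; omega)).mul_right
      (h (p + n) (by omega) (by push_cast; omega))

theorem desc_add (f : ℤ → A) (p : ℤ) (m : ℕ) : ∀ n : ℕ,
    desc f p (m + n) = desc f (p + m) n * desc f p m
  | 0 => by simp [desc]
  | n + 1 => by
      rw [← add_assoc, desc, desc, desc_add f p m n, mul_assoc]
      push_cast
      rw [add_assoc]

theorem asc_add (f : ℤ → A) (p : ℤ) (m : ℕ) : ∀ n : ℕ,
    asc f p (m + n) = asc f p m * asc f (p + m) n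
  | 0 => by simp [asc]
  | n + 1 => by
      rw [← add_assoc, asc, asc, asc_add f p m n, mul_assoc]
      push_cast
      rw [add_assoc]

theorem desc_succ_right (f : ℤ → A) (p : ℤ) (n : ℕ) :
    desc f p (n + 1) = desc f (p + 1) n * f p := by
  rw [add_comm n 1, desc_add]; simp [desc]

theorem desc_mul_asc {f g : ℤ → A} (h : ∀ i, f i * g i = 1) (p : ℤ) : ∀ n : ℕ,
    desc f p n * asc g p n = 1
  | 0 => one_mul 1
  | n + 1 => by
      rw [desc, asc, mul_assoc, ← mul_assoc (desc f p n), desc_mul_asc h p n, one_mul, h]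

theorem asc_mul_desc {f g : ℤ → A} (h : ∀ i, f i * g i = 1) (p : ℤ) : ∀ n : ℕ,
    asc f p n * desc g p n = 1
  | 0 => one_mul 1
  | n + 1 => by
      rw [desc, asc, mul_assoc, ← mul_assoc (f _), h, one_mul, asc_mul_desc h p n]

/-- The family `f` moves a strand past the operators `x`. -/
structure Slides (f x : ℤ → A) : Prop where
  slide : ∀ i, f (i + 1) * f i * x (i + 1) = x i * (f (i + 1) * f i)
  far : ∀ i j, i + 1 < j ∨ j + 1 < i → Commute (f i) (x j)

/-- The operator x_{i+1} passes the factors with index below i, is lowered to x_i by f_{i+1} f_i,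
and passes the remaining factors. -/
theorem Slides.desc_mul {f x : ℤ → A} (h : Slides f x) (p : ℤ) : ∀ (n : ℕ) (i : ℤ),
    p ≤ i → i + 1 < p + n → desc f p n * x (i + 1) = x i * desc f p n
  | 0, i, h1, h2 => by exfalso; push_cast at h2; omega
  | n + 1, i, h1, h2 => by
      rcases lt_or_ge (i + 1) (p + n) with h3 | h3
      · rw [desc, mul_assoc, h.desc_mul p n i h1 h3, ← mul_assoc,
          (h.far (p + n) i (Or.inr h3)).eq, mul_assoc]
      · obtain ⟨m, rfl⟩ : ∃ m, n = m + 1 := ⟨n - 1, by push_cast at h2; omega⟩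
        have hi : p + m = i := by push_cast at h2 h3; omega
        have hi' : p + ((m + 1 : ℕ) : ℤ) = i + 1 := by push_cast; omega
        have hc : Commute (x (i + 1)) (desc f p m) := desc_commute p m fun j h4 h5 =>
          (h.far j (i + 1) (by omega)).symm
        rw [desc, desc, hi, hi', mul_assoc, mul_assoc, ← hc.eq, ← mul_assoc, ← mul_assoc, h.slide]
        simp only [mul_assoc]

theorem Slides.mul_asc {f g x : ℤ → A} (h : Slides f x) (hfg : ∀ i, f i * g i = 1)
    (hgf : ∀ i, g i * f i = 1) (p : ℤ) (n : ℕ) (i : ℤ) (h1 : p ≤ i) (h2 : i + 1 < p + n) :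
    x (i + 1) * asc g p n = asc g p n * x i := by
  calc x (i + 1) * asc g p n
      = asc g p n * (desc f p n * x (i + 1)) * asc g p n := by
        rw [← mul_assoc, asc_mul_desc hgf, one_mul]
    _ = _ := by rw [h.desc_mul p n i h1 h2, mul_assoc, mul_assoc, desc_mul_asc hfg, mul_one]
/-! ### Nested cups -/

/-- An element that creates `n` nested cups on the strands `p, …, p + 2 n - 1`. -/
def nest (s e : ℤ → A) (p : ℤ) : ℕ → A
  | 0 => 1
  | n + 1 => desc s (p + 1) (2 * n) * e p * nest s e (p + 2) n

theorem nest_commute {z : A} : ∀ (n : ℕ) (p : ℤ),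
    (∀ i, p ≤ i → i + 1 < p + 2 * n → Commute z (s i) ∧ Commute z (e i)) →
    Commute z (nest s e p n)
  | 0, _, _ => Commute.one_right z
  | n + 1, p, h => by
      refine ((desc_commute _ _ fun i h1 h2 => (h i (by omega) ?_).1).mul_right
        (h p le_rfl ?_).2).mul_right
        (nest_commute n (p + 2) fun i h1 h2 => h i (by omega) ?_)
      all_goals push_cast at *; omega

end

section
variable {A : Type*} [Ring A] [Algebra ℂ A] {q μ : ℂ} {s t e : ℤ → A}

theorem System.slides_s (h : System q μ s t e) : Slides s s where
  slide i := by rw [← h.braid, mul_assoc]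
  far _ _ hij := h.far' hij

/-- Each e_i is a polynomial in s_i, so whatever slides past s also slides past e. -/
theorem System.slides_e_of (h : System q μ s t e) {f : ℤ → A} (hf : Slides f s) : Slides f e where
  slide i := by
    have h1 := hf.slide i
    simp only [h.e_def, mul_smul_comm, smul_mul_assoc]
    congr 1
    set y := f (i + 1) * f i
    have h2 : y * (q • 1 - s (i + 1)) = (q • 1 - s i) * y := by
      rw [mul_sub, sub_mul, h1, mul_smul_comm, smul_mul_assoc, mul_one, one_mul]
    have h3 : y * (q⁻¹ • 1 + s (i + 1)) = (q⁻¹ • 1 + s i) * y := by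
      rw [mul_add, add_mul, h1, mul_smul_comm, smul_mul_assoc, mul_one, one_mul]
    rw [← mul_assoc, h2, mul_assoc, h3, mul_assoc]
  far i j hij := h.commute_e_of (hf.far i j hij)

theorem System.desc_mul_asym (h : System q μ s t e) {f : ℤ → A} (hf : Slides f s) (p : ℤ) (m n : ℕ)
    (r : ℤ) (h1 : p ≤ r) (h2 : r + n ≤ p + m) :
    desc f p m * asym q μ s e (r + 1) n = asym q μ s e r n * desc f p m :=
  asym_intertwine (r + 1) r n fun i hi => by
    rw [show r + 1 + (i : ℤ) = r + i + 1 by ring]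
    exact ⟨hf.desc_mul p m (r + i) (by omega) (by omega),
      (h.slides_e_of hf).desc_mul p m (r + i) (by omega) (by omega)⟩

theorem System.asym_mul_asc (h : System q μ s t e) {f g : ℤ → A} (hf : Slides f s)
    (hfg : ∀ i, f i * g i = 1) (hgf : ∀ i, g i * f i = 1) (p : ℤ) (m n : ℕ)
    (r : ℤ) (h1 : p ≤ r) (h2 : r + n ≤ p + m) :
    asym q μ s e (r + 1) n * asc g p m = asc g p m * asym q μ s e r n := by
  calc asym q μ s e (r + 1) n * asc g p m
      = asc g p m * (desc f p m * asym q μ s e (r + 1) n) * asc g p m := by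
        rw [← mul_assoc, asc_mul_desc hgf, one_mul]
    _ = _ := by rw [h.desc_mul_asym hf p m n r h1 h2, mul_assoc, mul_assoc, desc_mul_asc hfg,
      mul_one]

theorem System.desc_mul_nest (h : System q μ s t e) {f : ℤ → A} (hf : Slides f s) (p : ℤ) (m : ℕ) :
    ∀ (n : ℕ) (r : ℤ), p ≤ r → r + 2 * n ≤ p + m →
      desc f p m * nest s e (r + 1) n = nest s e r n * desc f p m
  | 0, r, _, _ => by simp [nest]
  | n + 1, r, h1, h2 => by
      push_cast at h2
      have hd : ∀ j : ℕ, r + 1 + j < p + m →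
          desc f p m * desc s (r + 1 + 1) j = desc s (r + 1) j * desc f p m := by
        intro j
        induction j with
        | zero => simp [desc]
        | succ j ih =>
          intro hj
          push_cast at hj
          rw [desc, desc, ← mul_assoc, show r + 1 + 1 + (j : ℤ) = r + 1 + j + 1 by ring,
            hf.desc_mul p m (r + 1 + j) (by omega) (by omega), mul_assoc, ih (by omega), mul_assoc]
      have h3 := (h.slides_e_of hf).desc_mul p m r h1 (by omega)
      have ih := h.desc_mul_nest hf p m n (r + 2) (by omega) (by omega)
      rw [nest, nest, show r + 1 + 2 = r + 2 + 1 by ring, ← mul_assoc, ← mul_assoc]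
      rcases Nat.eq_zero_or_pos n with rfl | hn
      · simp [desc, nest, h3]
      · rw [hd _ (by push_cast; omega), mul_assoc _ (desc f p m), h3]
        simp only [mul_assoc]
        rw [ih]

/-- Nested cups built from the inside. -/
theorem System.nest_succ (h : System q μ s t e) (p : ℤ) (n : ℕ) :
    nest s e p (n + 1) = nest s e (p + 1) n * desc s (p + 1) (2 * n) * e p := by
  have h1 := h.desc_mul_nest h.slides_s (p + 1) (2 * n) n (p + 1) le_rfl (by push_cast; omega)
  have h2 : Commute (e p) (nest s e (p + 2) n) := nest_commute n _ fun i h3 h4 =>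
    ⟨(h.se_far (by omega)).symm, h.ee_far (by omega)⟩
  rw [nest, mul_assoc, h2.eq, ← mul_assoc, show p + 2 = p + 1 + 1 by ring, h1]

/-- A crossing is carried along two parallel strands by repeated braid relations. -/
theorem System.s_mul_desc_desc (h : System q μ s t e) (p : ℤ) : ∀ m : ℕ,
    s (p + m) * (desc s p m * desc s (p + 1) m) = desc s p m * desc s (p + 1) m * s p
  | 0 => by simp [desc]
  | m + 1 => by
      have ih := h.s_mul_desc_desc p m
      have hc : Commute (s (p + m + 1)) (desc s p m) := desc_commute p m fun i h1 h2 =>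
        h.far' (by omega)
      have hb : desc s p (m + 1) * desc s (p + 1) (m + 1) =
          s (p + m) * s (p + m + 1) * (desc s p m * desc s (p + 1) m) := by
        rw [desc, desc, show p + 1 + (m : ℤ) = p + m + 1 by ring]
        calc s (p + m) * desc s p m * (s (p + m + 1) * desc s (p + 1) m)
            = s (p + m) * (desc s p m * s (p + m + 1)) * desc s (p + 1) m := by
              simp only [mul_assoc]
          _ = _ := by rw [← hc.eq]; simp only [mul_assoc]
      rw [hb, show p + ((m + 1 : ℕ) : ℤ) = p + m + 1 by push_cast; ring]
      set X := desc s p m * desc s (p + 1) m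
      calc s (p + m + 1) * (s (p + m) * s (p + m + 1) * X)
          = s (p + m + 1) * s (p + m) * s (p + m + 1) * X := by simp only [mul_assoc]
        _ = s (p + m) * s (p + m + 1) * (s (p + m) * X) := by
          rw [← h.braid]; simp only [mul_assoc]
        _ = _ := by rw [ih]; simp only [mul_assoc]

/-- A generator on the left half of nested cups can be moved to the right half. -/
theorem System.s_mul_nest (h : System q μ s t e) : ∀ (n : ℕ) (p : ℤ) (i : ℕ), i + 2 ≤ 2 * n →
    s (p + i) * nest s e p n = s (p + 2 * n - 2 - i) * nest s e p n
  | 0, _, i, hi => by omega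
  | 1, p, i, hi => by
      obtain rfl : i = 0 := by omega
      rw [show p + 2 * ((1 : ℕ) : ℤ) - 2 - ((0 : ℕ) : ℤ) = p + ((0 : ℕ) : ℤ) by push_cast; ring]
  | n + 2, p, i, hi => by
      have outer : s p * nest s e p (n + 2) = s (p + 2 * n + 2) * nest s e p (n + 2) := by
        rw [h.nest_succ p (n + 1), h.nest_succ (p + 1) n]
        set N := nest s e (p + 1 + 1) n
        have hc1 : Commute (s p) N := nest_commute _ _ fun i h3 h4 =>
          ⟨h.far' (by omega), h.se_far (by omega)⟩
        have hc2 : Commute (s (p + 2 * n + 2)) N := nest_commute _ _ fun i h3 h4 =>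
          ⟨h.far' (by omega), h.se_far (by omega)⟩
        have hX : desc s (p + 1 + 1) (2 * n) * e (p + 1) * desc s (p + 1) (2 * (n + 1)) * e p =
            desc s (p + 2) (2 * n) * desc s (p + 3) (2 * n) * (e (p + 1) * e (p + 2) * e p) := by
          rw [show 2 * (n + 1) = 2 + 2 * n by ring, desc_add]
          have hd : desc s (p + 1) 2 = s (p + 2) * s (p + 1) := by
            simp [desc, show p + 1 + 1 = p + 2 by ring]
          have hc3 : Commute (e (p + 1)) (desc s (p + 3) (2 * n)) := desc_commute _ _
            fun i h3 h4 => (h.se_far (by omega)).symm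
          rw [hd, show p + 1 + ((2 : ℕ) : ℤ) = p + 3 by push_cast; ring,
            show p + 1 + 1 = p + 2 by ring, h.ee_eq_ess (i := p + 1) (j := p + 2) (by omega)]
          calc desc s (p + 2) (2 * n) * e (p + 1) * (desc s (p + 3) (2 * n) *
                (s (p + 2) * s (p + 1))) * e p
              = desc s (p + 2) (2 * n) * (e (p + 1) * desc s (p + 3) (2 * n)) *
                (s (p + 2) * s (p + 1) * e p) := by simp only [mul_assoc]
            _ = _ := by rw [hc3.eq]; simp only [mul_assoc]
        set B := desc s (p + 2) (2 * n) * desc s (p + 3) (2 * n) with hB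
        have hc4 : Commute (s p) B := (desc_commute _ _ fun i h3 h4 => h.far' (by omega)).mul_right
          (desc_commute _ _ fun i h3 h4 => h.far' (by omega))
        have hc5 : s (p + 2 * n + 2) * B = B * s (p + 2) := by
          have := h.s_mul_desc_desc (p + 2) (2 * n)
          rwa [show p + 2 + ((2 * n : ℕ) : ℤ) = p + 2 * n + 2 by push_cast; ring,
            show p + 2 + 1 = p + 3 by ring] at this
        -- After `hX` and the commutations, the outermost generators act on the local element
        -- e_{p+1} e_{p+2} e_p as s_p and s_{p+2}; both results are t_{p+1} e_p e_{p+2}.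
        have hx1 : s p * (e (p + 1) * e (p + 2) * e p) = t (p + 1) * e p * e (p + 2) := by
          have hc6 : Commute (e p) (e (p + 2)) := h.ee_far (by omega)
          calc s p * (e (p + 1) * e (p + 2) * e p)
              = s p * e (p + 1) * (e (p + 2) * e p) := by simp only [mul_assoc]
            _ = t (p + 1) * (e p * e (p + 1) * e p) * e (p + 2) := by
              rw [← hc6.eq, h.se_nb (p + 1) p (by omega)]; simp only [mul_assoc]
            _ = _ := by rw [h.eee p (p + 1) (by omega)]
        have hx2 : s (p + 2) * (e (p + 1) * e (p + 2) * e p) = t (p + 1) * e p * e (p + 2) := by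
          have hc6 : Commute (e p) (e (p + 2)) := h.ee_far (by omega)
          rw [← mul_assoc, ← mul_assoc, h.se_nb (p + 1) (p + 2) (by omega),
            mul_assoc _ (e (p + 1)), mul_assoc (t (p + 1)), ← mul_assoc (e (p + 2)),
            h.eee (p + 2) (p + 1) (by omega), mul_assoc, mul_assoc, hc6.eq]
        have hN : ∀ z : A, Commute z N → z * (N * desc s (p + 1 + 1) (2 * n) * e (p + 1) *
            desc s (p + 1) (2 * (n + 1)) * e p) = N * (z * (B * (e (p + 1) * e (p + 2) * e p))) := by
          intro z hz
          rw [← hX]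
          simp only [← mul_assoc]
          rw [hz.eq]
        rw [hN _ hc1, hN _ hc2, ← mul_assoc (s p), hc4.eq, ← mul_assoc (s _) B, hc5,
          mul_assoc B, mul_assoc B, hx1, hx2]
      rcases Nat.eq_zero_or_pos i with rfl | hi0
      · rw [show p + ((0 : ℕ) : ℤ) = p by simp, outer]
        congr 2; push_cast; ring
      rcases Nat.lt_or_ge i (2 * n + 2) with hi1 | hi1
      -- A generator not involving the first or last strand acts on the inner n + 1 cups, which are
      -- the leftmost factor in `nest_succ`.
      · have ih := h.s_mul_nest (n + 1) (p + 1) (i - 1) (by omega)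
        rw [show p + 1 + ((i - 1 : ℕ) : ℤ) = p + i by omega,
          show p + 1 + 2 * ((n + 1 : ℕ) : ℤ) - 2 - ((i - 1 : ℕ) : ℤ) =
            p + 2 * ((n + 2 : ℕ) : ℤ) - 2 - i by push_cast; omega] at ih
        rw [h.nest_succ, mul_assoc (nest s e (p + 1) (n + 1)), ← mul_assoc, ih, mul_assoc]
      · obtain rfl : i = 2 * n + 2 := by omega
        rw [show p + 2 * ((n + 2 : ℕ) : ℤ) - 2 - ((2 * n + 2 : ℕ) : ℤ) = p by push_cast; ring, outer]
        congr 2; push_cast; ring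

/-- Antisymmetrizers on nested cups can be removed one strand after the other. -/
theorem System.mul_nest_eq_zero (h : System q μ s t e) {Z : A} (p : ℤ) (k : ℕ)
    (hg : Generic q μ k) (hc : ∀ n : ℕ, 1 ≤ n → n ≤ k → closure q μ n ≠ 0)
    (hZ : ∀ i, p + 1 ≤ i → Commute Z (s i))
    (h0 : Z * asym q μ s e p k * nest s e p k = 0) : Z * nest s e p k = 0 := by
  have hZe : ∀ i, p + 1 ≤ i → Commute Z (e i) := fun i hi => h.commute_e_of (hZ i hi)
  -- The j innermost cups form a left factor of the whole nest.
  have split : ∀ j : ℕ, j ≤ k → ∃ W, nest s e p k = nest s e (p + k - j) j * W := by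
    intro j hj
    induction hj using Nat.decreasingInduction with
    | self => exact ⟨1, by rw [mul_one]; congr 1; ring⟩
    | of_succ m hm ih =>
      obtain ⟨W, hW⟩ := ih
      rw [h.nest_succ, show p + k - ((m + 1 : ℕ) : ℤ) + 1 = p + k - m by push_cast; ring] at hW
      exact ⟨_, by rw [hW, mul_assoc, mul_assoc]⟩
  have step : ∀ j : ℕ, j + 1 ≤ k → Z * asym q μ s e p (k - j) * nest s e p k = 0 := by
    intro j
    induction j with
    | zero => intro _; exact h0
    | succ j ih =>
      intro hj
      have ih := ih (by omega)
      obtain ⟨W, hW⟩ := split (j + 1) (by omega)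
      obtain ⟨r, hr⟩ : ∃ r, k - j = r + 2 := ⟨k - j - 2, by omega⟩
      have hp : p + k - ((j + 1 : ℕ) : ℤ) = p + ((r + 1 : ℕ) : ℤ) := by push_cast; omega
      rw [hp, nest] at hW
      rw [show k - (j + 1) = r + 1 by omega]
      rw [hr] at ih
      set P := p + ((r + 1 : ℕ) : ℤ) with hP
      push_cast at hP
      set D := desc s (P + 1) (2 * j)
      -- With j cups used up, the next cup e_P joins the last strand P of the remaining
      -- antisymmetrizer to strand P + 1. The factor D is invertible and lies to the right of that
      -- antisymmetrizer, so it can be cancelled; multiplication by e_P from the left then closes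
      -- strand P at the cost of a nonzero scalar.
      have hDZ : Commute Z D := desc_commute _ _ fun i h1 h2 => hZ i (by omega)
      have hDa : ∀ n : ℕ, n ≤ r + 2 → Commute D (asym q μ s e p n) := fun n hn =>
        asym_commute p n fun i h1 h2 =>
          ⟨(desc_commute _ _ fun l h3 h4 => h.far' (by omega)).symm,
            (desc_commute _ _ fun l h3 h4 => (h.se_far (by omega)).symm).symm⟩
      have hDu : asc t (P + 1) (2 * j) * D = 1 := asc_mul_desc h.ts _ _
      have key : ∀ n : ℕ, n ≤ r + 2 → Z * asym q μ s e p n * nest s e p k =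
          D * (Z * asym q μ s e p n * (e P * nest s e (P + 2) j * W)) := fun n hn => by
        rw [hW, ← mul_assoc D, ← mul_assoc D, ← hDZ.eq, mul_assoc Z D, (hDa n hn).eq]
        simp only [mul_assoc]
      rw [key (r + 1) (by omega)]
      rw [key (r + 2) (by omega)] at ih
      have h1 : Z * asym q μ s e p (r + 2) * (e P * nest s e (P + 2) j * W) = 0 := by
        rw [← one_mul (Z * _ * _), ← hDu, mul_assoc, ih, mul_zero]
      have h2 := h.e_asym_e p (r + 1) (hg.mono (by omega))
      have h3 : closure q μ (r + 2) • (Z * asym q μ s e p (r + 1) *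
          (e P * nest s e (P + 2) j * W)) = 0 := by
        have hcomm : Commute (e P) (asym q μ s e p (r + 1)) := asym_commute p (r + 1)
          fun i h4 h5 => ⟨(h.se_far (by push_cast at h5; omega)).symm,
            h.ee_far (by push_cast at h5; omega)⟩
        calc _ = Z * (closure q μ (r + 2) • (e P * asym q μ s e p (r + 1))) *
              (nest s e (P + 2) j * W) := by
              rw [hcomm.eq, mul_smul_comm, smul_mul_assoc]; simp only [mul_assoc]
          _ = Z * (e P * asym q μ s e p (r + 1 + 1) * e P) * (nest s e (P + 2) j * W) := by
              rw [h2]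
          _ = e P * (Z * asym q μ s e p (r + 2) * (e P * nest s e (P + 2) j * W)) := by
              simp only [← mul_assoc]
              rw [(hZe P (by omega)).eq]
          _ = 0 := by rw [h1, mul_zero]
      rw [(smul_eq_zero.mp h3).resolve_left (hc _ (by omega) (by omega)), mul_zero]
  rcases Nat.eq_zero_or_pos k with rfl | hk
  · simpa [asym] using h0
  · have := step (k - 1) (by omega)
    rw [show k - (k - 1) = 1 by omega] at this
    simpa [asym] using this

/-- On nested cups the antisymmetrizer of the right half follows from that of the left half. -/
theorem System.asym_mul_asym_mul_nest (h : System q μ s t e) (p : ℤ) (k : ℕ)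
    (hg : Generic q μ k) :
    asym q μ s e (p + k) k * (asym q μ s e p k * nest s e p k) =
      asym q μ s e p k * nest s e p k := by
  refine h.asym_mul_of (p + k) k hg fun i hi => ?_
  have hc : Commute (s (p + k + i)) (asym q μ s e p k) := asym_commute p k fun j h1 h2 =>
    ⟨h.far' (by omega), h.se_far (by omega)⟩
  have h1 := h.s_mul_nest k p (k + i) (by omega)
  rw [show p + ((k + i : ℕ) : ℤ) = p + k + i by push_cast; ring,
    show p + 2 * (k : ℤ) - 2 - ((k + i : ℕ) : ℤ) = p + ((k - 2 - i : ℕ) : ℤ) by omega] at h1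
  rw [← mul_assoc, hc.eq, mul_assoc, h1, ← mul_assoc, h.asym_mul_s p k hg _ (by omega),
    smul_mul_assoc]

end
end BMW

/-! ### Local operators on words indexed by the integers -/

namespace TensorOp

/-- `V^{⊗2}` has a second tensor factor. -/
theorem second_leg_le : 1 + 1 ≤ 2 := le_rfl

section
variable {ι J : Type*} {m n : ℕ}

theorem extend_comp_embedding (e : Fin m ↪ J) (b : Fin m → ι) (a : J → ι) :
    Function.extend e b a ∘ e = b := Function.extend_comp e.injective b a

theorem extend_extend (e : Fin m ↪ J) (b c : Fin m → ι) (a : J → ι) :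
    Function.extend e c (Function.extend e b a) = Function.extend e c a := by
  funext j
  by_cases h : ∃ i, e i = j
  · obtain ⟨i, rfl⟩ := h
    simp [e.injective.extend_apply]
  · simp [Function.extend_apply' _ _ _ h]

theorem extend_self (e : Fin m ↪ J) (a : J → ι) : Function.extend e (a ∘ e) a = a := by
  funext j
  by_cases h : ∃ i, e i = j
  · obtain ⟨i, rfl⟩ := h
    simp [e.injective.extend_apply]
  · simp [Function.extend_apply' _ _ _ h]

theorem extend_extend_trans (e : Fin m ↪ Fin n) (e' : Fin n ↪ J) (c : Fin m → ι) (a : J → ι) :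
    Function.extend e' (Function.extend e c (a ∘ e')) a = Function.extend (e.trans e') c a := by
  funext j
  by_cases h : ∃ i, e' i = j
  · obtain ⟨i, rfl⟩ := h
    rw [e'.injective.extend_apply]
    by_cases h' : ∃ l, e l = i
    · obtain ⟨l, rfl⟩ := h'
      rw [e.injective.extend_apply]
      exact ((e.trans e').injective.extend_apply c a l).symm
    · rw [Function.extend_apply' _ _ _ h', Function.extend_apply']
      · rfl
      · rintro ⟨l, hl⟩
        exact h' ⟨l, e'.injective hl⟩
  · rw [Function.extend_apply' _ _ _ h, Function.extend_apply']
    rintro ⟨l, hl⟩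
    exact h ⟨e l, hl⟩

theorem extend_comm (e : Fin m ↪ J) (e' : Fin n ↪ J) (hd : ∀ i j, e i ≠ e' j) (b : Fin m → ι)
    (c : Fin n → ι) (a : J → ι) :
    Function.extend e' c (Function.extend e b a) = Function.extend e b (Function.extend e' c a) := by
  funext j
  by_cases h : ∃ i, e i = j
  · obtain ⟨i, rfl⟩ := h
    rw [Function.extend_apply' (f := e') _ _ _ (by rintro ⟨l, hl⟩; exact hd i l hl.symm),
      e.injective.extend_apply, e.injective.extend_apply]
  · rw [Function.extend_apply' (f := e) _ _ _ h]
    by_cases h' : ∃ l, e' l = j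
    · obtain ⟨l, rfl⟩ := h'
      rw [e'.injective.extend_apply, e'.injective.extend_apply]
    · rw [Function.extend_apply' _ _ _ h', Function.extend_apply' _ _ _ h',
        Function.extend_apply' _ _ _ h]

theorem extend_comp_disjoint (e : Fin m ↪ J) (e' : Fin n ↪ J) (hd : ∀ i j, e i ≠ e' j)
    (b : Fin m → ι) (a : J → ι) : Function.extend e b a ∘ e' = a ∘ e' := by
  funext l
  exact Function.extend_apply' _ _ _ (by rintro ⟨i, hi⟩; exact hd i l hi)

variable [Fintype ι] [DecidableEq ι]

/-- The endomorphism of the functions of `J`-indexed words that acts as `X` on the letters at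
`e 0, …, e (m-1)`. -/
noncomputable def opLegs (e : Fin m ↪ J) : TensorOp ι m →ₐ[ℂ] Module.End ℂ ((J → ι) → ℂ) :=
  AlgHom.ofLinearMap
    { toFun := fun X =>
        { toFun := fun f a => ∑ b, X (a ∘ e) b * f (Function.extend e b a)
          map_add' := fun f g => by
            funext a; simp [mul_add, Finset.sum_add_distrib]
          map_smul' := fun c f => by
            funext a; simp [Finset.mul_sum, mul_left_comm] }
      map_add' := fun X Y => by
        ext f a; simp [add_mul, Finset.sum_add_distrib]
      map_smul' := fun c X => by
        ext f a; simp [Finset.mul_sum, mul_assoc] }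
    (by
      refine LinearMap.ext fun f => funext fun a => ?_
      simp [Matrix.one_apply, extend_self])
    (fun X Y => by
      refine LinearMap.ext fun f => funext fun a => ?_
      simp only [LinearMap.coe_mk, AddHom.coe_mk, Module.End.mul_apply, extend_comp_embedding,
        extend_extend, Matrix.mul_apply, Finset.sum_mul, Finset.mul_sum]
      rw [Finset.sum_comm]
      simp only [mul_assoc])

theorem opLegs_apply (e : Fin m ↪ J) (X : TensorOp ι m) (f : (J → ι) → ℂ) (a : J → ι) :
    opLegs e X f a = ∑ b, X (a ∘ e) b * f (Function.extend e b a) := rfl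

theorem opLegs_onLegs (e : Fin m ↪ Fin n) (e' : Fin n ↪ J) (X : TensorOp ι m) :
    opLegs e' (onLegs e X) = opLegs (e.trans e') X := by
  refine LinearMap.ext fun f => funext fun a => ?_
  rw [opLegs_apply, opLegs_apply]
  symm
  -- Only words that agree with a outside the legs e contribute to the larger sum.
  refine Fintype.sum_of_injective (fun c => Function.extend e c (a ∘ e'))
    (Function.extend_injective e.injective _) _ _ (fun b hb => ?_) (fun c => ?_)
  · simp only [onLegs]
    rw [if_neg, zero_mul]
    intro h
    refine hb ⟨b ∘ e, ?_⟩
    funext j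
    by_cases h' : ∃ i, e i = j
    · obtain ⟨i, rfl⟩ := h'
      exact e.injective.extend_apply _ _ _
    · refine (Function.extend_apply' _ _ _ h').trans ?_
      exact h j fun i hi => h' ⟨i, hi⟩
  · simp only [onLegs]
    rw [if_pos, extend_comp_embedding, extend_extend_trans]
    · rfl
    · intro j hj
      rw [Function.extend_apply' _ _ _ (by rintro ⟨i, hi⟩; exact hj i hi)]

theorem opLegs_commute (e : Fin m ↪ J) (e' : Fin n ↪ J) (hd : ∀ i j, e i ≠ e' j)
    (X : TensorOp ι m) (Y : TensorOp ι n) : Commute (opLegs e X) (opLegs e' Y) := by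
  refine LinearMap.ext fun f => funext fun a => ?_
  simp only [Module.End.mul_apply, opLegs_apply, Finset.mul_sum]
  rw [Finset.sum_comm]
  refine Finset.sum_congr rfl fun c _ => Finset.sum_congr rfl fun b _ => ?_
  rw [extend_comp_disjoint e e' hd, extend_comp_disjoint e' e (fun i j h => hd j i h.symm),
    extend_comm e e' hd]
  ring

end

section
variable {ι : Type*} [Fintype ι] [DecidableEq ι] {m n : ℕ}

/-- The letters `p, …, p + m - 1` of a word indexed by `ℤ`. -/
def intLegs (p : ℤ) (m : ℕ) : Fin m ↪ ℤ :=
  ⟨fun j => p + j.val, fun i j hij => Fin.ext (by simpa using hij)⟩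

variable (ι) in
/-- The algebra in which all operators on finitely many consecutive factors live. -/
abbrev Ops : Type _ := Module.End ℂ ((ℤ → ι) → ℂ)

/-- The operator `X` on the tensor factors `p, …, p + m - 1`. -/
noncomputable def op (p : ℤ) : TensorOp ι m →ₐ[ℂ] Ops ι := opLegs (intLegs p m)

theorem op_act (p : ℤ) (i : ℕ) (X : TensorOp ι m) (h : i + m ≤ n) :
    op p (act n i X h) = op (p + i) X := by
  rw [op, act, opLegs_onLegs, op]
  congr 1
  congr 1
  ext j
  change p + ((i + j.val : ℕ) : ℤ) = p + i + j.val
  push_cast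
  ring

theorem op_commute {p r : ℤ} (X : TensorOp ι m) (Y : TensorOp ι n)
    (h : p + m ≤ r ∨ r + n ≤ p) : Commute (op p X) (op r Y) := by
  refine opLegs_commute _ _ (fun i j hij => ?_) X Y
  have h1 : p + (i.val : ℤ) = r + j.val := hij
  have := i.isLt
  have := j.isLt
  omega

end

theorem sum_cons {ι : Type*} [Fintype ι] {m : ℕ} (f : (Fin (m + 1) → ι) → ℂ) :
    ∑ x, f x = ∑ i, ∑ c : Fin m → ι, f (Fin.cons i c) := by
  rw [← Fintype.sum_prod_type', ← (Fin.consEquiv (fun _ : Fin (m + 1) => ι)).sum_comp]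
  rfl

theorem act_one_apply {ι : Type*} [DecidableEq ι] {m : ℕ} (A : TensorOp ι m) (h : 1 + m ≤ m + 1) (i j : ι) (a b : Fin m → ι) :
    act (m + 1) 1 A h (Fin.cons i a) (Fin.cons j b) = if i = j then A a b else 0 := by
  have h1 : ∀ (i : ι) (a : Fin m → ι),
      (Fin.cons i a : Fin (m + 1) → ι) ∘ (legs 1 m (m + 1) h) = a := by
    intro i a
    funext l
    have : legs 1 m (m + 1) h l = l.succ := Fin.ext (by simp [legs, add_comm])
    simp [this]
  simp only [act, onLegs, h1]
  congr 1
  apply propext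
  constructor
  · intro h2
    simpa using h2 0 fun l hl => by
      have h3 : 1 + l.val = 0 := congrArg Fin.val hl
      omega
  · rintro rfl l hl
    refine Fin.cases (fun _ => by simp) (fun l hl => ?_) l hl
    exact absurd (Fin.ext (by simp [legs, add_comm])) (hl l)

theorem act_zero_apply {ι : Type*} [DecidableEq ι] {m : ℕ} (Y : TensorOp ι 1) (h : 0 + 1 ≤ m + 1) (i j : ι) (a b : Fin m → ι) :
    act (m + 1) 0 Y h (Fin.cons i a) (Fin.cons j b) =
      if a = b then Y (fun _ => i) (fun _ => j) else 0 := by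
  have h1 : ∀ (i : ι) (a : Fin m → ι),
      (Fin.cons i a : Fin (m + 1) → ι) ∘ (legs 0 1 (m + 1) h) = fun _ => i := by
    intro i a
    funext l
    have : legs 0 1 (m + 1) h l = 0 := Fin.ext (by simp [legs])
    simp [this]
  simp only [act, onLegs, h1]
  congr 1
  apply propext
  constructor
  · intro h2
    funext l
    simpa using h2 l.succ fun r hr => by simpa [legs] using congrArg Fin.val hr
  · rintro rfl l hl
    refine Fin.cases (fun hl => ?_) (fun l hl => by simp) l hl
    exact absurd (Fin.ext (by simp [legs])) (hl 0)

/-- An element that commutes with a matrix algebra and is annihilated by a nonzero matrix is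
zero. -/
theorem eq_zero_of_map_mul_eq_zero {N B : Type*} [Fintype N] [DecidableEq N] [Ring B] [Algebra ℂ B]
    (φ : Matrix N N ℂ →ₐ[ℂ] B) {Y : Matrix N N ℂ} {Z : B} (hZ : ∀ X, Commute Z (φ X))
    (h : φ Y * Z = 0) (hY : Y ≠ 0) : Z = 0 := by
  obtain ⟨i, j, hij⟩ : ∃ i j, Y i j ≠ 0 := by
    by_contra! hc
    exact hY (Matrix.ext hc)
  -- A nonzero entry of Y lets matrix units produce every diagonal unit; these annihilate Z and add
  -- up to 1.
  have h1 : ∀ a, Matrix.single a i 1 * Y * Matrix.single j a (Y i j)⁻¹ = Matrix.single a a 1 := by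
    intro a
    rw [Matrix.single_mul_mul_single]
    congr 1
    rw [one_mul, mul_inv_cancel₀ hij]
  have h2 : ∀ a, φ (Matrix.single a a 1) * Z = 0 := by
    intro a
    rw [← h1, map_mul, map_mul, mul_assoc, ← (hZ _).eq, ← mul_assoc, mul_assoc _ (φ Y), h, mul_zero,
      zero_mul]
  have h3 : (1 : Matrix N N ℂ) = ∑ a, Matrix.single a a 1 := by
    rw [Matrix.sum_single_one]
  calc Z = φ 1 * Z := by rw [map_one, one_mul]
    _ = 0 := by
      rw [h3, map_sum, Finset.sum_mul]
      exact Finset.sum_eq_zero fun a _ => h2 a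

section
variable {ι : Type*} [Fintype ι] [DecidableEq ι] {m n : ℕ}

/-- A nonzero matrix in the kernel would annihilate 1, by the simplicity argument above. -/
theorem op_injective [Nonempty ι] (p : ℤ) : Function.Injective (op p : TensorOp ι m → Ops ι) := by
  intro X Y h
  by_contra hne
  refine one_ne_zero (α := Ops ι) (eq_zero_of_map_mul_eq_zero (op p : TensorOp ι m →ₐ[ℂ] Ops ι)
    (Y := X - Y) (fun X => Commute.one_left _) ?_ (sub_ne_zero.mpr hne))
  rw [map_sub, h, sub_self, zero_mul]

theorem traceExcept_apply (X : TensorOp ι (m + 1)) (h : 0 + 1 ≤ m + 1) (a b : Fin 1 → ι) :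
    traceExcept (legs 0 1 (m + 1) h) X a b =
      ∑ c : Fin m → ι, X (Fin.cons (a 0) c) (Fin.cons (b 0) c) := by
  have h1 : ∀ (i : ι) (c : Fin m → ι) (a : Fin 1 → ι),
      (Fin.cons i c : Fin (m + 1) → ι) ∘ (legs 0 1 (m + 1) h) = a ↔ i = a 0 := by
    intro i c a
    rw [funext_iff, Fin.forall_fin_one]
    have : legs 0 1 (m + 1) h 0 = 0 := Fin.ext (by simp [legs])
    simp [this]
  have h2 : ∀ (i j : ι) (c d : Fin m → ι), (∀ l, (∀ r, legs 0 1 (m + 1) h r ≠ l) →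
      (Fin.cons i c : Fin (m + 1) → ι) l = (Fin.cons j d : Fin (m + 1) → ι) l) ↔ c = d := by
    intro i j c d
    constructor
    · intro h2
      funext l
      simpa using h2 l.succ fun r hr => by simpa [legs] using congrArg Fin.val hr
    · rintro rfl l hl
      refine Fin.cases (fun hl => ?_) (fun l hl => by simp) l hl
      exact absurd (Fin.ext (by simp [legs])) (hl 0)
  simp only [traceExcept, sum_cons, h1, h2, ite_and]
  rw [Finset.sum_eq_single (a 0)]
  · refine Finset.sum_congr rfl fun c _ => ?_
    rw [Finset.sum_eq_single (b 0)]
    · simp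
    · intro j _ hj; simp [hj]
    · simp
  · intro i _ hi; simp [hi]
  · simp

/-- Compressing by a rank one operator is a partial trace. -/
theorem act_mul_mul_act (v w : (Fin m → ι) → ℂ) (X : TensorOp ι (m + 1)) (h : 1 + m ≤ m + 1)
    (h' : 0 + 1 ≤ m + 1) :
    act (m + 1) 1 (Matrix.vecMulVec v w) h * X * act (m + 1) 1 (Matrix.vecMulVec v w) h =
      act (m + 1) 0 (traceExcept (legs 0 1 (m + 1) h') (act (m + 1) 1 (Matrix.vecMulVec v w) h * X))
        h' * act (m + 1) 1 (Matrix.vecMulVec v w) h := by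
  ext a b
  obtain ⟨i, a, rfl⟩ : ∃ i a', a = Fin.cons i a' := ⟨a 0, Fin.tail a, (Fin.cons_self_tail a).symm⟩
  obtain ⟨j, b, rfl⟩ : ∃ i b', b = Fin.cons i b' := ⟨b 0, Fin.tail b, (Fin.cons_self_tail b).symm⟩
  simp only [Matrix.mul_apply, sum_cons, act_one_apply, act_zero_apply, traceExcept_apply,
    Matrix.vecMulVec_apply, ite_mul, mul_ite, zero_mul, mul_zero, Finset.sum_ite_irrel,
    Finset.sum_const_zero, Finset.sum_ite_eq, Finset.sum_ite_eq', Finset.mem_univ, if_true,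
    Finset.sum_mul]
  exact Finset.sum_congr rfl fun _ _ => Finset.sum_congr rfl fun _ _ => by ring

end
end TensorOp

/-! ### From the representations ρ_R to families of local operators -/

namespace BMW
section
variable {B : Type*} [Ring B] [Algebra ℂ B] {q μ : ℂ} {n : ℕ}

theorem mk_rel {x y : FreeAlgebra ℂ (Gen n)} (h : Rel n q μ x y) :
    RingQuot.mkAlgHom ℂ (Rel n q μ) x = RingQuot.mkAlgHom ℂ (Rel n q μ) y :=
  RingQuot.mkAlgHom_rel ℂ h

theorem shift_sigma {m : ℕ} (p : ℕ) (h : n + p ≤ m) (ε : ℤˣ) (i : Fin (n - 1)) :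
    shift (q := q) (μ := μ) p h (sigma ε i) = sigma ε (shiftIdx p h i) := by
  simp [shift, sigma, fs, shiftGen]

theorem shift_kappa {m : ℕ} (p : ℕ) (h : n + p ≤ m) (i : Fin (n - 1)) :
    shift (q := q) (μ := μ) p h (kappa i) = kappa (shiftIdx p h i) := by
  simp [shift, kappa, fk, shiftGen]

theorem kappa_eq (i : Fin (n - 1)) : (kappa i : Alg n q μ) =
    (μ * (q - q⁻¹))⁻¹ • ((q • 1 - sigma 1 i) * (q⁻¹ • 1 + sigma 1 i)) := by
  have := mk_rel (Rel.kappa_def (q := q) (μ := μ) i)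
  simpa [kappa, sigma] using this

/-- A representation sends the antisymmetrizer to the one built from the images of the
generators. -/
theorem map_antisymmetrizer {s e : ℤ → B} : ∀ (n : ℕ) (p : ℤ) (φ : Alg n q μ →ₐ[ℂ] B),
    (∀ i : Fin (n - 1), φ (sigma 1 i) = s (p + i.val)) →
    (∀ i : Fin (n - 1), φ (kappa i) = e (p + i.val)) →
    φ (antisymmetrizer q μ n) = asym q μ s e p n
  | 0, _, φ, _, _ => by simp [antisymmetrizer, asym]
  | 1, _, φ, _, _ => by simp [antisymmetrizer, asym]
  | n + 2, p, φ, hs, he => by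
      have ih := map_antisymmetrizer (s := s) (e := e) (n + 1) p
        (φ.comp (shift 0 (by omega) : Alg (n + 1) q μ →ₐ[ℂ] Alg (n + 2) q μ))
        (fun i => by
          rw [AlgHom.comp_apply, shift_sigma, hs]; rfl)
        (fun i => by
          rw [AlgHom.comp_apply, shift_kappa, he]; rfl)
      rw [AlgHom.comp_apply] at ih
      simp only [antisymmetrizer, asym, map_smul, map_mul, ih, baxterMinus, bax, map_add, map_one,
        hs, he]
end
end BMW

namespace TensorOp
variable {ι : Type*} [Fintype ι] [DecidableEq ι] {n : ℕ} {q μ : ℂ} {R : TensorOp ι 2}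

open BMW

/-- `K = (q - R)(q⁻¹ + R) / (μ (q - q⁻¹))`. -/
noncomputable def matK (R : TensorOp ι 2) (q μ : ℂ) : TensorOp ι 2 :=
  (μ * (q - q⁻¹))⁻¹ • ((q • 1 - R) * (q⁻¹ • 1 + R))

/-- V = 0 is excluded by K ≠ 0. -/
theorem IsBMWType.nonempty (h : IsBMWType R q μ) : Nonempty ι := by
  by_contra hι
  rw [not_nonempty_iff] at hι
  exact h.kappa_ne_zero (Subsingleton.elim _ _)

theorem IsBMWType.rho_sigma (h : IsBMWType R q μ) (n : ℕ) (i : Fin (n - 1)) :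
    rho h n (sigma 1 i) = act n i.val R (by omega) := (h.exists_rep n).choose_spec i

theorem IsBMWType.op_rho_sigma (h : IsBMWType R q μ) (n : ℕ) (p : ℤ) (i : Fin (n - 1)) :
    op p (rho h n (sigma 1 i)) = op (p + i.val) R := by rw [h.rho_sigma, op_act]

theorem IsBMWType.op_rho_kappa (h : IsBMWType R q μ) (n : ℕ) (p : ℤ) (i : Fin (n - 1)) :
    op p (rho h n (kappa i)) = op (p + i.val) (matK R q μ) := by
  rw [kappa_eq, matK]
  simp only [map_smul, map_mul, map_sub, map_add, map_one, h.op_rho_sigma]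

theorem op_mul_inv (h : IsUnit R) (i : ℤ) : op i R * op i R⁻¹ = (1 : Ops ι) := by
  rw [← map_mul, Matrix.mul_nonsing_inv _ ((Matrix.isUnit_iff_isUnit_det _).mp h), map_one]

theorem op_inv_mul (h : IsUnit R) (i : ℤ) : op i R⁻¹ * op i R = (1 : Ops ι) := by
  rw [← map_mul, Matrix.nonsing_inv_mul _ ((Matrix.isUnit_iff_isUnit_det _).mp h), map_one]

theorem IsBMWType.op_rho_sigma_inv (h : IsBMWType R q μ) (n : ℕ) (p : ℤ) (i : Fin (n - 1)) :
    op p (rho h n (sigma (-1) i)) = op (p + i.val) R⁻¹ := by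
  have h1 : (sigma 1 i * sigma (-1) i : Alg n q μ) = 1 := by
    simpa [sigma] using mk_rel (Rel.inverse (q := q) (μ := μ) 1 i)
  have h2 := congrArg (fun x => op p (rho h n x)) h1
  simp only [map_mul, h.op_rho_sigma, map_one] at h2
  calc _ = op (p + i.val) R⁻¹ * (op (p + i.val) R * op p (rho h n (sigma (-1) i))) := by
        rw [← mul_assoc, op_inv_mul h.isUnit, one_mul]
    _ = _ := by rw [h2, mul_one]

/-- The operators `R_i`, `R_i⁻¹`, `K_i` satisfy the BMW relations. -/
theorem IsBMWType.system (h : IsBMWType R q μ) :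
    System q μ (fun i => op i R : ℤ → Ops ι) (fun i => op i R⁻¹) (fun i => op i (matK R q μ)) := by
  -- Each nonlocal relation other than far commutativity concerns two neighbouring generators, so
  -- the representation on V^{⊗3}, translated along ℤ, gives it; far commutativity holds since the
  -- factors are disjoint.
  let a : Fin (3 - 1) := ⟨0, by omega⟩
  let b : Fin (3 - 1) := ⟨1, by omega⟩
  have nb : Neighbour a b ∧ Neighbour b a := ⟨Or.inl rfl, Or.inr rfl⟩
  have tr : ∀ (p : ℤ) {x y : FreeAlgebra ℂ (Gen 3)}, Rel 3 q μ x y →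
      op p (rho h 3 (RingQuot.mkAlgHom ℂ _ x)) = op p (rho h 3 (RingQuot.mkAlgHom ℂ _ y)) :=
    fun p _ _ hr => by rw [mk_rel hr]
  have s1 : ∀ (p : ℤ) (i : Fin (3 - 1)), op p (rho h 3 (RingQuot.mkAlgHom ℂ (Rel 3 q μ) (fs 1 i))) =
      op (p + i.val) R := fun p i => h.op_rho_sigma 3 p i
  have s2 : ∀ (p : ℤ) (i : Fin (3 - 1)),
      op p (rho h 3 (RingQuot.mkAlgHom ℂ (Rel 3 q μ) (fs (-1) i))) = op (p + i.val) R⁻¹ :=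
    fun p i => h.op_rho_sigma_inv 3 p i
  have s3 : ∀ (p : ℤ) (i : Fin (3 - 1)), op p (rho h 3 (RingQuot.mkAlgHom ℂ (Rel 3 q μ) (fk i))) =
      op (p + i.val) (matK R q μ) := fun p i => h.op_rho_kappa 3 p i
  have ha : ∀ p : ℤ, p + ((a.val : ℕ) : ℤ) = p := fun p => by simp [a]
  have hb : ∀ p : ℤ, p + ((b.val : ℕ) : ℤ) = p + 1 := fun p => by simp [b]
  have two : ∀ {P : ℤ → ℤ → Prop}, (∀ p, P p (p + 1)) → (∀ p, P (p + 1) p) →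
      ∀ i j, j = i + 1 ∨ i = j + 1 → P i j := by
    rintro P h1 h2 i j (rfl | rfl)
    exacts [h1 _, h2 _]
  constructor
  · exact h.q_ne_zero
  · intro h0
    have h1 : (q - 1) * (q + 1) = 0 := by
      have := mul_inv_cancel₀ h.q_ne_zero
      linear_combination q * h0 + this
    rcases mul_eq_zero.mp h1 with h2 | h2
    · exact h.q_ne_one (by linear_combination h2)
    · exact h.q_ne_neg_one (by linear_combination h2)
  · exact h.mu_ne_zero
  · exact op_mul_inv h.isUnit
  · exact op_inv_mul h.isUnit
  · intro i
    simpa only [map_mul, s1, ha, hb] using tr i (Rel.braid a b nb.1)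
  · intro i j hij
    exact op_commute _ _ (Or.inl (by push_cast; omega))
  · intro i
    simp only [matK, map_smul, map_mul, map_sub, map_add, map_one]
  · intro i
    simpa only [map_mul, map_smul, s1, s3, ha] using tr i (Rel.sigma_kappa a)
  · intro i
    simpa only [map_mul, map_smul, s1, s3, ha] using tr i (Rel.kappa_sigma a)
  · refine two (fun i => ?_) (fun i => ?_)
    · simpa only [map_mul, s1, s2, s3, ha, hb] using tr i (Rel.kappa_sigma_nb 1 a b nb.1)
    · simpa only [map_mul, s1, s2, s3, ha, hb] using tr i (Rel.kappa_sigma_nb 1 b a nb.2)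
  · refine two (fun i => ?_) (fun i => ?_)
    · simpa only [map_mul, s1, s2, s3, ha, hb, neg_neg] using
        tr i (Rel.kappa_sigma_nb (-1) a b nb.1)
    · simpa only [map_mul, s1, s2, s3, ha, hb, neg_neg] using
        tr i (Rel.kappa_sigma_nb (-1) b a nb.2)
  · refine two (fun i => ?_) (fun i => ?_)
    · simpa only [map_mul, s1, s2, s3, ha, hb] using tr i (Rel.sigma_nb_kappa 1 a b nb.1)
    · simpa only [map_mul, s1, s2, s3, ha, hb] using tr i (Rel.sigma_nb_kappa 1 b a nb.2)
  · refine two (fun i => ?_) (fun i => ?_)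
    · simpa only [map_mul, s1, s2, s3, ha, hb, neg_neg] using
        tr i (Rel.sigma_nb_kappa (-1) a b nb.1)
    · simpa only [map_mul, s1, s2, s3, ha, hb, neg_neg] using
        tr i (Rel.sigma_nb_kappa (-1) b a nb.2)
  · refine two (fun i => ?_) (fun i => ?_)
    · simpa only [map_mul, s3, ha, hb] using tr i (Rel.kappa_kappa_kappa a b nb.1)
    · simpa only [map_mul, s3, ha, hb] using tr i (Rel.kappa_kappa_kappa b a nb.2)
  · intro i
    simpa only [map_mul, map_smul, s3, ha] using tr i (Rel.kappa_sq a)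

theorem IsBMWType.op_rho_antisymmetrizer (h : IsBMWType R q μ) (n : ℕ) (p : ℤ) :
    op p (rho h n (antisymmetrizer q μ n)) =
      asym q μ (fun i => op i R : ℤ → Ops ι) (fun i => op i (matK R q μ)) p n :=
  map_antisymmetrizer n p ((op p).comp (rho h n)) (fun i => h.op_rho_sigma n p i)
    (fun i => h.op_rho_kappa n p i)

theorem IsBMWType.rho_shift_antisymmetrizer (h : IsBMWType R q μ) (n : ℕ) :
    rho h (n + 1) (shift 1 le_rfl (antisymmetrizer q μ n)) =
      act (n + 1) 1 (rho h n (antisymmetrizer q μ n)) (by omega) := by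
  have := h.nonempty
  apply op_injective (0 : ℤ)
  rw [op_act, h.op_rho_antisymmetrizer]
  refine map_antisymmetrizer n _
    (((op 0).comp (rho h (n + 1))).comp (shift 1 le_rfl)) (fun i => ?_) (fun i => ?_)
  · rw [AlgHom.comp_apply, AlgHom.comp_apply, shift_sigma, h.op_rho_sigma]
    congr 2; simp [shiftIdx]; ring
  · rw [AlgHom.comp_apply, AlgHom.comp_apply, shift_kappa, h.op_rho_kappa]
    congr 2; simp [shiftIdx]; ring

end TensorOp

namespace BMW

/-! ### The scalars in the orthogonal case -/

section
variable {q : ℂ} {k : ℕ}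

theorem zpow_one_sub (hq : q ≠ 0) (k : ℕ) : q ^ (1 - (k : ℤ)) = q / q ^ k := by
  rw [zpow_sub₀ hq, zpow_one, zpow_natCast]

theorem zpow_two_sub (hq : q ≠ 0) (k : ℕ) : q ^ (2 - (k : ℤ)) = q ^ 2 / q ^ k := by
  rw [zpow_sub₀ hq, zpow_natCast]; norm_cast

theorem Generic.pow_add_one_ne (hg : Generic q (q ^ (1 - (k : ℤ))) k) (hk : 2 ≤ k) :
    q ^ k + 1 ≠ 0 := fun h => (hg k (by omega) le_rfl).1 (by
  rw [mul_comm, pow_mul]; linear_combination (q ^ k - 1) * h)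

theorem closure_ne_zero (hq : q ≠ 0) (hl : q - q⁻¹ ≠ 0) (hk : 2 ≤ k)
    (hg : Generic q (q ^ (1 - (k : ℤ))) k) (n : ℕ) (h1 : 1 ≤ n) (h2 : n ≤ k) :
    closure q (q ^ (1 - (k : ℤ))) n ≠ 0 := by
  obtain ⟨n, rfl⟩ : ∃ m, n = m + 1 := ⟨n - 1, by omega⟩
  have hm : q ^ (1 - (k : ℤ)) ≠ 0 := zpow_ne_zero _ hq
  have hqk : q ^ k ≠ 0 := pow_ne_zero _ hq
  have hqn : q ^ (2 * n) ≠ 0 := pow_ne_zero _ hq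
  have hn := hg.qNum_ne hq hl h1 h2
  have h3 : q ^ (1 - (k : ℤ)) + q * (q ^ (2 * n))⁻¹ ≠ 0 := by
    rcases n with - | n
    -- `Generic` does not cover index 0; here μ + q = q (q^k + 1) / q^k.
    · rw [zpow_one_sub hq]
      have := hg.pow_add_one_ne hk
      intro h0
      field_simp at h0
      apply this
      have h4 : q * (q ^ k + 1) = 0 := by linear_combination h0
      exact (mul_eq_zero.mp h4).resolve_left hq
    · exact hg.mu_add_ne hq (by omega) (by omega)
  rw [closure_eq hq hl hm n hn h3]
  have h4 := hg.mu_add_ne hq h1 h2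
  -- As q⁻¹ q^{-2n} = q · q^{-2(n+1)}, this is the genericity condition at n + 1.
  have h5 : q ^ (1 - (k : ℤ)) + q⁻¹ * (q ^ (2 * n))⁻¹ ≠ 0 := by
    convert h4 using 2
    rw [show 2 * (n + 1) = 2 * n + 2 by ring, pow_add]
    field_simp
  have h6 : q ^ 2 * (q ^ (2 * n))⁻¹ - (q ^ (1 - (k : ℤ))) ^ 2 ≠ 0 := by
    rw [zpow_one_sub hq]
    intro h0
    -- A zero would give q^{2k} = q^{2n}, hence q^{2(k-n)} = 1 with 1 ≤ k - n ≤ k.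
    refine (hg (k - n) (by omega) (by omega)).1 ?_
    have h7 : q ^ (2 * (k - n)) * q ^ (2 * n) = (q ^ k) ^ 2 := by
      rw [← pow_add, ← pow_mul]; congr 1; omega
    have h8 : (q ^ k) ^ 2 = q ^ (2 * n) := by
      field_simp at h0
      rw [mul_zero] at h0
      exact sub_eq_zero.mp ((mul_eq_zero.mp h0).resolve_left (pow_ne_zero _ hq))
    rw [h8] at h7
    exact (mul_eq_right₀ hqn).mp h7
  exact mul_ne_zero (div_ne_zero (pow_ne_zero _ hq) hn)
    (div_ne_zero (mul_ne_zero h5 h6) (mul_ne_zero hl (mul_ne_zero hm h3)))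

/-- The first part identifies the normalising constant of O with c⁻¹. In the second, r is the scalar
of A_2 R_1 A_2: the hypothesis on r is the height condition, the conclusion says that A_2 R_1⁻¹ A_2
has scalar μc. -/
theorem closure_top (hq : q ≠ 0) (hl : q - q⁻¹ ≠ 0) (hk : 2 ≤ k)
    (hg : Generic q (q ^ (1 - (k : ℤ))) k) :
    qNum q k * (1 + q ^ (2 - (k : ℤ))) / (q + q ^ (1 - (k : ℤ))) *
      closure q (q ^ (1 - (k : ℤ))) k = 1 ∧
    ∀ r : ℂ, 1 + ((q ^ (2 * k))⁻¹ - 1) / (q - q⁻¹) * r +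
        q ^ (1 - (k : ℤ)) * ((q ^ (2 * k))⁻¹ - 1) / (q ^ (1 - (k : ℤ)) + q * (q ^ (2 * k))⁻¹) *
          closure q (q ^ (1 - (k : ℤ))) k = 0 →
      r - (q - q⁻¹) + (q - q⁻¹) * closure q (q ^ (1 - (k : ℤ))) k =
        q ^ (1 - (k : ℤ)) * closure q (q ^ (1 - (k : ℤ))) k := by
  obtain ⟨n, rfl⟩ : ∃ m, k = m + 1 := ⟨k - 1, by omega⟩
  have hm : q ^ (1 - ((n + 1 : ℕ) : ℤ)) ≠ 0 := zpow_ne_zero _ hq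
  have hn := hg.qNum_ne hq hl (i := n + 1) (by omega) le_rfl
  have h3 := hg.mu_add_ne hq (i := n) (by omega) (by omega)
  have h4 := hg.pow_add_one_ne hk
  have h5 := (hg (n + 1) (by omega) le_rfl).1
  rw [closure_eq hq hl hm n hn h3]
  rw [zpow_one_sub hq] at *
  rw [zpow_two_sub hq]
  have hu : q ^ (n + 1) ≠ 0 := pow_ne_zero _ hq
  have e1 : q ^ n = q ^ (n + 1) / q := by rw [pow_succ]; field_simp
  have e2 : q ^ (2 * n) = (q ^ (n + 1)) ^ 2 / q ^ 2 := by
    rw [← pow_mul, eq_div_iff (by positivity), ← pow_add]; congr 1; ring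
  have e3 : q ^ (2 * (n + 1)) = (q ^ (n + 1)) ^ 2 := by rw [← pow_mul]; congr 1; ring
  have hl' : q ^ 2 - 1 ≠ 0 := fun h0 => hl (by field_simp; linear_combination h0)
  rw [e3] at h5
  rw [e2] at h3
  rw [qNum] at hn
  rw [e1, e2, e3, qNum]
  generalize q ^ (n + 1) = u at *
  have h6 : u ^ 2 - 1 ≠ 0 := sub_ne_zero.mpr h5
  have h7 : u + q ^ 2 ≠ 0 := by
    intro h0; apply h3; field_simp; linear_combination q * h0
  have h8 : u - 1 ≠ 0 := fun h0 => h6 (by linear_combination (u + 1) * h0)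
  -- In terms of u = q^k the closing scalar is c = u (q² - 1) / ((u - 1)(u + q²)).
  have hc : u / q / ((u - u⁻¹) / (q - q⁻¹)) *
      ((q / u + q⁻¹ * (u ^ 2 / q ^ 2)⁻¹) * (q ^ 2 * (u ^ 2 / q ^ 2)⁻¹ - (q / u) ^ 2) /
        ((q - q⁻¹) * (q / u * (q / u + q * (u ^ 2 / q ^ 2)⁻¹)))) =
      u * (q ^ 2 - 1) / ((u - 1) * (u + q ^ 2)) := by
    have h9 : (q / u + q * (u ^ 2 / q ^ 2)⁻¹) = q * (u + q ^ 2) / u ^ 2 := by field_simp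
    have h10 : u - u⁻¹ = (u - 1) * (u + 1) / u := by field_simp; ring
    rw [h9, h10]
    field_simp
  rw [hc]
  constructor
  · have h10 : u - u⁻¹ = (u - 1) * (u + 1) / u := by field_simp; ring
    have h11 : q + q / u = q * (u + 1) / u := by field_simp
    rw [h10, h11]
    field_simp
  · intro r hr
    have h12 : q / u + q * (u ^ 2)⁻¹ = q * (u + 1) / u ^ 2 := by field_simp
    rw [h12] at hr
    have hr' : r = q / u * (u * (q ^ 2 - 1) / ((u - 1) * (u + q ^ 2))) + (q - q⁻¹) -
        (q - q⁻¹) * (u * (q ^ 2 - 1) / ((u - 1) * (u + q ^ 2))) := by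
      field_simp at hr ⊢
      refine mul_left_cancel₀ (mul_ne_zero h6 h4) ?_
      linear_combination -hr
    rw [hr']; ring
end
end BMW

/-! ### Matrices of rank one and idempotents -/

namespace Matrix

theorem exists_eq_vecMulVec_of_rank_le_one {N : Type*} [Fintype N] {X : Matrix N N ℂ}
    (h : X.rank ≤ 1) : ∃ v w : N → ℂ, X = vecMulVec v w := by
  classical
  obtain ⟨⟨v, hv⟩, hvX⟩ := finrank_le_one_iff.mp h
  have h1 : ∀ j, ∃ c : ℂ, c • v = X.mulVecLin (Pi.single j 1) := fun j => by
    obtain ⟨c, hc⟩ := hvX ⟨X.mulVecLin (Pi.single j 1), LinearMap.mem_range_self _ _⟩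
    exact ⟨c, congrArg Subtype.val hc⟩
  choose w hw using h1
  refine ⟨v, w, Matrix.ext fun i j => ?_⟩
  have := congrFun (hw j) i
  simp only [Pi.smul_apply, smul_eq_mul, mulVecLin_apply, mulVec_single_one, col_apply] at this
  rw [vecMulVec_apply, mul_comm, this]

theorem rank_eq_trace_of_isIdempotentElem {N : Type*} [Fintype N] [DecidableEq N]
    {X : Matrix N N ℂ} (h : X * X = X) : (X.rank : ℂ) = X.trace := by
  have h1 : IsIdempotentElem (Matrix.toLin' X) := by
    rw [IsIdempotentElem, Module.End.mul_eq_comp, ← Matrix.toLin'_mul, h]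
  rw [← Matrix.trace_toLin'_eq, (LinearMap.IsIdempotentElem.isProj_range _ h1).trace]
  rfl

end Matrix

/-! ### Compression, nested cups and nondegeneracy of the antisymmetrizer -/

namespace TensorOp
variable {ι : Type*} [Fintype ι] [DecidableEq ι]

theorem trace_act_mul_act {m l n : ℕ} (X : TensorOp ι m) (Y : TensorOp ι l) (h : m + l = n) :
    (act n 0 X (by omega) * act n m Y (by omega)).trace = X.trace * Y.trace := by
  subst h
  have h0 : ∀ (a : Fin m → ι) (b : Fin l → ι), Fin.append a b ∘ legs 0 m (m + l) (by omega) = a := by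
    intro a b
    funext i
    have : legs 0 m (m + l) (by omega) i = Fin.castAdd l i := Fin.ext (by simp [legs])
    simp [this]
  have h1 : ∀ (a : Fin m → ι) (b : Fin l → ι), Fin.append a b ∘ legs m l (m + l) (by omega) = b := by
    intro a b
    funext i
    have : legs m l (m + l) (by omega) i = Fin.natAdd m i := rfl
    simp [this]
  have h2 : ∀ (f : (Fin (m + l) → ι) → ℂ), ∑ x, f x = ∑ a, ∑ b, f (Fin.append a b) := by
    intro f
    rw [← Fintype.sum_prod_type', ← (Fin.appendEquiv m l).sum_comp]
    rfl
  have h3 : ∀ (a a' : Fin m → ι) (b b' : Fin l → ι),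
      act (m + l) 0 X (by omega) (Fin.append a b) (Fin.append a' b') = if b = b' then X a a' else 0 := by
    intro a a' b b'
    simp only [act, onLegs, h0]
    congr 1
    apply propext
    constructor
    · intro h
      funext i
      simpa using h (Fin.natAdd m i) fun r hr => by
        have h4 : 0 + r.val = m + i.val := congrArg Fin.val hr
        have := r.isLt
        omega
    · rintro rfl j hj
      refine Fin.addCases (fun i hi => ?_) (fun i _ => by simp) j hj
      exact absurd (Fin.ext (by simp [legs])) (hi i)
  have h4 : ∀ (a a' : Fin m → ι) (b b' : Fin l → ι),
      act (m + l) m Y (by omega) (Fin.append a b) (Fin.append a' b') = if a = a' then Y b b' else 0 := by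
    intro a a' b b'
    simp only [act, onLegs, h1]
    congr 1
    apply propext
    constructor
    · intro h
      funext i
      simpa using h (Fin.castAdd l i) fun r hr => by
        have h4 : m + r.val = i.val := congrArg Fin.val hr
        have := i.isLt
        omega
    · rintro rfl j hj
      refine Fin.addCases (fun i _ => by simp) (fun i hi => ?_) j hj
      exact absurd rfl (hi i)
  simp only [Matrix.trace, Matrix.diag, Matrix.mul_apply, h2, h3, h4, mul_ite, ite_mul, zero_mul,
    mul_zero, Finset.sum_ite_irrel, Finset.sum_const_zero, Finset.sum_ite_eq, Finset.sum_ite_eq',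
    Finset.mem_univ, if_true, Finset.sum_mul_sum]

theorem op_mul_mul_op {m : ℕ} (p : ℤ) (v w : (Fin m → ι) → ℂ) (X : TensorOp ι (m + 1)) :
    (op (p + 1) (Matrix.vecMulVec v w) * op p X * op (p + 1) (Matrix.vecMulVec v w) : Ops ι) =
      op p (traceExcept (legs 0 1 (m + 1) (by omega))
        (act (m + 1) 1 (Matrix.vecMulVec v w) (by omega) * X)) *
        op (p + 1) (Matrix.vecMulVec v w) := by
  have h := congrArg (op p) (act_mul_mul_act v w X (by omega) (by omega))
  simpa only [map_mul, op_act, Nat.cast_one, Nat.cast_zero, add_zero] using h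

open BMW
variable {q μ : ℂ} {R : TensorOp ι 2}

/-- The antisymmetrizer as an operator on `V^{⊗n}`. -/
noncomputable def alt (h : IsBMWType R q μ) (n : ℕ) : TensorOp ι n :=
  rho h n (antisymmetrizer q μ n)

theorem op_alt (h : IsBMWType R q μ) (n : ℕ) (p : ℤ) : op p (alt h n) =
    asym q μ (fun i => op i R : ℤ → Ops ι) (fun i => op i (matK R q μ)) p n :=
  h.op_rho_antisymmetrizer n p

theorem op_matK_ne_zero (h : IsBMWType R q μ) (p : ℤ) : op p (matK R q μ) ≠ (0 : Ops ι) := by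
  have := h.nonempty
  intro h0
  exact h.kappa_ne_zero (op_injective p (by rw [map_zero]; exact h0))

theorem commute_op_nest {m : ℕ} (X : TensorOp ι m) (p r : ℤ) (n : ℕ)
    (hpr : p + m ≤ r) : Commute (op p X)
      (nest (fun i => op i R : ℤ → Ops ι) (fun i => op i (matK R q μ)) r n) :=
  nest_commute n r fun i h1 _ => ⟨op_commute _ _ (by omega), op_commute _ _ (by omega)⟩

/-- The chain of R's is invertible, and the outer K acts on factors disjoint from those of the inner
cups, so neither can annihilate them. -/
theorem nest_ne_zero (h : IsBMWType R q μ) : ∀ (n : ℕ) (p : ℤ),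
    nest (fun i => op i R : ℤ → Ops ι) (fun i => op i (matK R q μ)) p n ≠ 0
  | 0, p => by
      have := h.nonempty
      exact one_ne_zero
  | n + 1, p => by
      intro h0
      refine nest_ne_zero h n (p + 2) (eq_zero_of_map_mul_eq_zero (op p) (Y := matK R q μ)
        (fun X => (commute_op_nest X p _ _ (by norm_num)).symm) ?_ h.kappa_ne_zero)
      rw [nest] at h0
      have h1 := asc_mul_desc h.system.ts (p + 1) (2 * n)
      rw [← one_mul (op p _ * _), ← h1, mul_assoc, ← mul_assoc (desc _ _ _), h0, mul_zero]

/-- An antisymmetrizer is not degenerate in its first factor. -/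
theorem eq_zero_of_op_mul_alt (h : IsBMWType R q μ) {k : ℕ} (hk : 1 ≤ k) (hg : Generic q μ k)
    (hc : ∀ n : ℕ, 1 ≤ n → n ≤ k → closure q μ n ≠ 0) (X : TensorOp ι 2) (p : ℤ)
    (h0 : op p X * op (p + 1) (alt h k) = (0 : Ops ι)) : X = 0 := by
  have hs := h.system
  rw [op_alt] at h0
  -- Replacing the antisymmetrizer by cups leaves X times the nest. The chain D and the inner cups N
  -- avoid the factors of X and K_{p+1} or only precede them invertibly, so X K_{p+1} = 0 follows.
  have h1 := hs.mul_nest_eq_zero (Z := op p X) (p + 1) k hg hc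
    (fun i hi => op_commute _ _ (by push_cast; omega)) (by rw [h0, zero_mul])
  obtain ⟨n, rfl⟩ : ∃ n, k = n + 1 := ⟨k - 1, by omega⟩
  rw [nest] at h1
  set D := desc (fun i => op i R : ℤ → Ops ι) (p + 1 + 1) (2 * n) with hD
  have hDc : Commute (op p X) D := desc_commute _ _ fun i h2 _ =>
    op_commute _ _ (by push_cast; omega)
  set N := nest (fun i => op i R : ℤ → Ops ι) (fun i => op i (matK R q μ)) (p + 1 + 2) n with hN
  have h2 : op p X * op (p + 1) (matK R q μ) * N = 0 := by
    have h3 := asc_mul_desc hs.ts (p + 1 + 1) (2 * n)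
    calc op p X * op (p + 1) (matK R q μ) * N
        = asc (fun i => op i R⁻¹ : ℤ → Ops ι) (p + 1 + 1) (2 * n) * (D * op p X) *
          op (p + 1) (matK R q μ) * N := by rw [← mul_assoc, h3, one_mul]
      _ = asc (fun i => op i R⁻¹ : ℤ → Ops ι) (p + 1 + 1) (2 * n) *
          (op p X * (D * op (p + 1) (matK R q μ) * N)) := by
          rw [← hDc.eq]; simp only [mul_assoc]
      _ = 0 := by rw [h1, mul_zero]
  have h3 : op p X * op (p + 1) (matK R q μ) = (0 : Ops ι) := by
    by_contra hne
    refine nest_ne_zero h n (p + 1 + 2) (eq_zero_of_map_mul_eq_zero (op p)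
      (Y := act 3 0 X (by omega) * act 3 1 (matK R q μ) (by omega))
      (fun X => (commute_op_nest X p _ _ (by push_cast; omega)).symm) ?_ fun hY => hne ?_)
    · rw [map_mul, op_act, op_act]; simpa using h2
    · have := congrArg (op p) hY
      rw [map_mul, op_act, op_act, map_zero] at this
      simpa using this
  have hX2 : Commute (op p X) (op (p + 1 + 1) (matK R q μ)) := op_commute _ _ (by push_cast; omega)
  -- K_{p+2} equals K_{p+2} K_{p+1} times an invertible operator and commutes with X, so X K_{p+2} =
  -- 0 as well; now the factors are disjoint and X can be isolated.
  have h4 : op p X * op (p + 1 + 1) (matK R q μ) = (0 : Ops ι) := by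
    have h5 := hs.ee_eq_ess (i := p + 1 + 1) (j := p + 1) (by omega)
    calc op p X * op (p + 1 + 1) (matK R q μ)
        = op p X * (op (p + 1 + 1) (matK R q μ) * op (p + 1) R * op (p + 1 + 1) R) *
          op (p + 1 + 1) R⁻¹ * op (p + 1) R⁻¹ := by
          have h6 := hs.st (p + 1)
          have h7 := hs.st (p + 1 + 1)
          simp only [mul_assoc]
          rw [← mul_assoc (op (p + 1 + 1) R) (op (p + 1 + 1) R⁻¹), h7, one_mul, h6, mul_one]
      _ = op (p + 1 + 1) (matK R q μ) * (op p X * op (p + 1) (matK R q μ)) *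
          op (p + 1 + 1) R⁻¹ * op (p + 1) R⁻¹ := by
          rw [← h5, ← mul_assoc, hX2.eq, mul_assoc (op (p + 1 + 1) (matK R q μ))]
      _ = 0 := by rw [h3, mul_zero, zero_mul, zero_mul]
  by_contra hne
  exact op_matK_ne_zero h (p + 1 + 1) (eq_zero_of_map_mul_eq_zero (op p) (Y := X)
    (fun X => op_commute _ _ (by push_cast; omega)) h4 hne)

end TensorOp

/-! ### Closing the first strand, and the rank of K -/

namespace TensorOp
variable {ι : Type*} [Fintype ι] [DecidableEq ι]
open BMW
variable {q μ : ℂ} {R : TensorOp ι 2}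

theorem alt_mul_alt (h : IsBMWType R q μ) {n : ℕ} (hg : Generic q μ n) :
    alt h n * alt h n = alt h n := by
  have := h.nonempty
  apply op_injective (0 : ℤ)
  rw [map_mul, op_alt, h.system.asym_idem 0 n hg]

/-- `A_1 K_0 A_1 = c A_1` for an antisymmetrizer `A` of rank one. -/
theorem op_alt_mul_matK_mul_op_alt (h : IsBMWType R q μ) {k : ℕ} (hk : 1 ≤ k) (hg : Generic q μ k)
    (hc : ∀ n : ℕ, 1 ≤ n → n ≤ k → closure q μ n ≠ 0) (hr : (alt h k).rank ≤ 1) (p : ℤ) :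
    (op (p + 1) (alt h k) * op p (matK R q μ) * op (p + 1) (alt h k) : Ops ι) =
      closure q μ k • op (p + 1) (alt h k) := by
  have hs := h.system
  obtain ⟨n, rfl⟩ : ∃ n, k = n + 1 := ⟨k - 1, by omega⟩
  set K := matK R q μ with hK
  obtain ⟨v, w, hvw⟩ := Matrix.exists_eq_vecMulVec_of_rank_le_one hr
  have h1 := op_mul_mul_op p v w (act (n + 1 + 1) 0 K (by omega))
  rw [← hvw] at h1
  set Y := traceExcept (legs 0 1 (n + 1 + 1) (by omega))
    (act (n + 1 + 1) 1 (alt h (n + 1)) (by omega) * act (n + 1 + 1) 0 K (by omega)) with hY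
  rw [op_act, Nat.cast_zero, add_zero] at h1
  set c := closure q μ (n + 1) with hcdef
  suffices hYc : Y - c • 1 = 0 by
    rw [h1, sub_eq_zero.mp hYc, map_smul, map_one, smul_mul_assoc, one_mul]
  have h2 := hs.e_asym_e_left p n hg
  have h3 : asym q μ (fun i => op i R : ℤ → Ops ι) (fun i => op i K) (p + 2) n *
      op (p + 1) (alt h (n + 1)) = op (p + 1) (alt h (n + 1)) := by
    rw [op_alt]
    refine hs.asym_mul_of (p + 2) n (hg.mono (by omega)) fun i hi => ?_
    have := hs.s_mul_asym (p + 1) (n + 1) hg (i + 1) (by omega)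
    rwa [show p + 1 + ((i + 1 : ℕ) : ℤ) = p + 2 + i by push_cast; ring] at this
  rw [← op_alt h] at h2
  -- K A K A is evaluated in two ways, by compression A K A = Y A and by closing a strand, K A K = c
  -- K a^{(k-1)}. The difference has the form X A with X = K (Y - c), so nondegeneracy applies.
  have h4 : op p K * op p Y * op (p + 1) (alt h (n + 1)) =
      c • (op p K * op (p + 1) (alt h (n + 1)) : Ops ι) := by
    rw [mul_assoc, ← h1, ← mul_assoc, ← mul_assoc, h2, smul_mul_assoc, mul_assoc, h3]
  have h5 : K * act 2 0 (Y - c • 1) (by omega) = 0 := by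
    refine eq_zero_of_op_mul_alt h hk hg hc _ p ?_
    rw [map_mul, op_act, Nat.cast_zero, add_zero, map_sub, map_smul, map_one, mul_sub, sub_mul, h4,
      mul_smul_comm, mul_one, smul_mul_assoc, sub_self]
  have h6 : op p K * op p (Y - c • 1) = (0 : Ops ι) := by
    have := congrArg (op p) h5
    rwa [map_mul, op_act, Nat.cast_zero, add_zero, map_zero] at this
  set y : Ops ι := op p (Y - c • 1) with hy
  have hyc : Commute y (op (p + 1) K) := op_commute _ _ (by push_cast; omega)
  -- From K_p y = 0 one gets R_{p+1} R_p K_{p+1} y = K_p K_{p+1} y = K_p y K_{p+1} = 0; then K_{p+1}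
  -- and y act on disjoint factors.
  have h7 : op (p + 1) K * y = 0 := by
    have h8 := hs.ee_eq_sse (i := p) (j := p + 1) (by omega)
    calc op (p + 1) K * y = op p R⁻¹ * op (p + 1) R⁻¹ * (op p K * op (p + 1) K) * y := by
          have h9 := hs.ts p
          have h10 := hs.ts (p + 1)
          rw [h8]
          simp only [← mul_assoc]
          rw [mul_assoc (op p R⁻¹), h10, mul_one, h9, one_mul]
      _ = op p R⁻¹ * op (p + 1) R⁻¹ * (op p K * y * op (p + 1) K) := by
          rw [mul_assoc _ (op p K * op (p + 1) K), mul_assoc (op p K), mul_assoc (op p K), hyc.eq]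
      _ = 0 := by rw [h6, zero_mul, mul_zero]
  rw [← hyc.eq] at h7
  by_contra hne
  exact op_matK_ne_zero h (p + 1) (eq_zero_of_map_mul_eq_zero (op p)
    (fun X => op_commute _ _ (by push_cast; omega)) h7 hne)

/-- `K` has rank one if the antisymmetrizer `A` has rank one. -/
theorem matK_rank_le_one (h : IsBMWType R q μ) {k : ℕ} (hk : 2 ≤ k) (hg : Generic q μ k)
    (hc : ∀ n : ℕ, 1 ≤ n → n ≤ k → closure q μ n ≠ 0) (hr : (alt h k).rank = 1) :
    (matK R q μ).rank ≤ 1 := by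
  have hs := h.system
  have := h.nonempty
  obtain ⟨n, rfl⟩ : ∃ n, k = n + 1 := ⟨k - 1, by omega⟩
  set K := matK R q μ with hK
  set A := alt h (n + 1) with hA
  set A' := alt h n with hA'
  set c := closure q μ (n + 1) with hcdef
  have hc0 : c ≠ 0 := hc _ (by omega) le_rfl
  have heta : eta q μ ≠ 0 := hc 1 le_rfl (by omega)
  have hAA : A * A = A := alt_mul_alt h hg
  have hAA' : A' * A' = A' := alt_mul_alt h (hg.mono (by omega))
  have hKK : K * K = eta q μ • K := by
    apply op_injective (0 : ℤ)
    rw [map_mul, map_smul]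
    exact hs.ee 0
  set E : TensorOp ι (n + 1 + 1) := act _ 0 K (by omega) with hE
  set A1 : TensorOp ι (n + 1 + 1) := act _ 1 A (by omega) with hA1
  set A2 : TensorOp ι (n + 1 + 1) := act _ 2 A' (by omega) with hA2
  have hEE : E * E = eta q μ • E := by
    apply op_injective (0 : ℤ)
    simp only [hE, map_mul, map_smul, op_act]
    exact hs.ee _
  have hA11 : A1 * A1 = A1 := by
    apply op_injective (0 : ℤ)
    rw [map_mul, hA1, op_act, ← map_mul, hAA]
  have e1 : A1 * E * A1 = c • A1 := by
    apply op_injective (0 : ℤ)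
    have := op_alt_mul_matK_mul_op_alt h (by omega) hg hc hr.le 0
    simpa only [hE, hA1, map_mul, map_smul, op_act, Nat.cast_zero, Nat.cast_one, add_zero] using this
  have e2 : E * A1 * E = c • (E * A2) := by
    apply op_injective (0 : ℤ)
    have := hs.e_asym_e_left 0 n hg
    rw [← op_alt h, ← op_alt h] at this
    simpa only [hE, hA1, hA2, map_mul, map_smul, op_act, Nat.cast_zero, Nat.cast_one, add_zero,
      Nat.cast_ofNat] using this
  -- The two evaluations of tr(K_1 A_2), combined with tr A = 1, tr K = η rk K and tr A' = rk A',
  -- give dim V = rk K · rk A' for A' = ρ_R(a^{(k-1)}).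
  have t1 : (E * A1).trace = c * Fintype.card ι := by
    have h1 : A1.trace = Fintype.card ι := by
      have := trace_act_mul_act (1 : TensorOp ι 1) A (n := n + 1 + 1) (by omega)
      have h2 : act (n + 1 + 1) 0 (1 : TensorOp ι 1) (by omega) = 1 := by
        apply op_injective (0 : ℤ); rw [op_act, map_one, map_one]
      rw [h2, one_mul, Matrix.trace_one, ← Matrix.rank_eq_trace_of_isIdempotentElem hAA, hr] at this
      simpa using this
    have h3 := congrArg Matrix.trace e1
    rw [Matrix.trace_smul, smul_eq_mul, h1, mul_assoc, Matrix.trace_mul_comm A1, mul_assoc,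
      hA11] at h3
    exact h3
  have t2 : eta q μ * (E * A1).trace = c * (K.trace * A'.trace) := by
    have h3 := congrArg Matrix.trace e2
    rw [Matrix.trace_smul, smul_eq_mul, mul_assoc, Matrix.trace_mul_comm E, mul_assoc, hEE,
      mul_smul_comm, Matrix.trace_smul, smul_eq_mul, Matrix.trace_mul_comm A1,
      trace_act_mul_act K A' (by omega)] at h3
    exact h3
  have hKi : ((eta q μ)⁻¹ • K) * ((eta q μ)⁻¹ • K) = (eta q μ)⁻¹ • K := by
    rw [smul_mul_smul_comm, hKK, smul_smul, mul_assoc, inv_mul_cancel₀ heta, mul_one]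
  have hKr : ((eta q μ)⁻¹ • K).rank = K.rank := Matrix.rank_smul_of_mem_nonZeroDivisors K
    (mem_nonZeroDivisors_of_ne_zero (inv_ne_zero heta))
  have hcard : (Fintype.card ι : ℂ) = (K.rank * A'.rank : ℕ) := by
    rw [Nat.cast_mul, ← hKr, Matrix.rank_eq_trace_of_isIdempotentElem hKi,
      Matrix.rank_eq_trace_of_isIdempotentElem hAA', Matrix.trace_smul, smul_eq_mul]
    rw [t1] at t2
    field_simp
    exact mul_left_cancel₀ hc0 (by linear_combination t2)
  have hcard' : Fintype.card ι = K.rank * A'.rank := by exact_mod_cast hcard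
  -- Write A = v wᵀ and read v as a matrix M with row index in the first factor. Nondegeneracy of A
  -- makes its rows independent, and A' acting on the last factors fixes v, so dim V = rk M ≤ rk A'.
  have hle : Fintype.card ι ≤ A'.rank := by
    obtain ⟨v, w, hvw⟩ := Matrix.exists_eq_vecMulVec_of_rank_le_one hr.le
    obtain ⟨d, hd⟩ : ∃ d, w d ≠ 0 := by
      by_contra! h0
      have : A = 0 := by
        rw [hvw]; ext i j; simp [Matrix.vecMulVec_apply, h0]
      rw [this, Matrix.rank_zero] at hr
      omega
    have h1 : act (n + 1) 1 A' (by omega) * A = A := by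
      apply op_injective (0 : ℤ)
      rw [map_mul, op_act, op_alt, op_alt]
      refine hs.asym_mul_of _ n (hg.mono (by omega)) fun i hi => ?_
      have := hs.s_mul_asym 0 (n + 1) hg (i + 1) (by omega)
      rwa [show (0 : ℤ) + ((i + 1 : ℕ) : ℤ) = 0 + ((1 : ℕ) : ℤ) + i by push_cast; ring] at this
    let M : Matrix ι (Fin n → ι) ℂ := Matrix.of fun i b => v (Fin.cons i b)
    have hM : M = M * A'.transpose := by
      ext i b
      have h2 := congrFun (congrFun h1 (Fin.cons i b)) d
      simp only [hvw, Matrix.mul_apply, sum_cons, act_one_apply, Matrix.vecMulVec_apply,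
        ite_mul, zero_mul, Finset.sum_ite_irrel, Finset.sum_const_zero, Finset.sum_ite_eq,
        Finset.mem_univ, if_true, ← mul_assoc, ← Finset.sum_mul] at h2
      have h3 := mul_right_cancel₀ hd h2
      simp only [M, Matrix.mul_apply, Matrix.of_apply, Matrix.transpose_apply]
      rw [← h3]
      exact Finset.sum_congr rfl fun _ _ => mul_comm _ _
    have hli : LinearIndependent ℂ M.row := by
      rw [← Matrix.vecMul_injective_iff]
      refine (injective_iff_map_eq_zero' (Matrix.vecMulLinear M)).mpr fun f => ⟨fun hf => ?_, ?_⟩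
      -- A linear relation f among the rows, used as every row of Y, gives Y_1 A = 0.
      · let Y : TensorOp ι 1 := Matrix.of fun _ b => f (b 0)
        have h2 : act (n + 1) 0 Y (by omega) * A = 0 := by
          ext a b
          obtain ⟨i, a, rfl⟩ : ∃ i a', a = Fin.cons i a' :=
            ⟨a 0, Fin.tail a, (Fin.cons_self_tail a).symm⟩
          have h3 := congrFun hf a
          simp only [Matrix.vecMulLinear_apply, Matrix.vecMul, dotProduct, M, Matrix.of_apply,
            Pi.zero_apply] at h3
          simp only [hvw, Matrix.mul_apply, sum_cons, act_zero_apply, Matrix.vecMulVec_apply,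
            ite_mul, zero_mul, Finset.sum_ite_eq, Finset.mem_univ, if_true, Y, Matrix.of_apply,
            Matrix.zero_apply, ← mul_assoc, ← Finset.sum_mul, h3]
        have h3 : act 2 1 Y second_leg_le = 0 := by
          refine eq_zero_of_op_mul_alt h (by omega) hg hc _ 0 ?_
          have h4 := congrArg (op (1 : ℤ)) h2
          rw [map_mul, op_act, map_zero] at h4
          rw [op_act]
          simpa using h4
        have h4 : Y = 0 := by
          apply op_injective (1 : ℤ)
          have := congrArg (op (0 : ℤ)) h3
          rw [op_act, map_zero] at this
          rw [map_zero]
          simpa using this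
        funext i
        exact congrFun (congrFun h4 fun _ => i) fun _ => i
      · rintro rfl
        exact map_zero _
    calc Fintype.card ι = M.rank := hli.rank_matrix.symm
      _ ≤ A'.transpose.rank := by rw [hM]; exact Matrix.rank_mul_le_right _ _
      _ = A'.rank := Matrix.rank_transpose _
  -- If rk K ≥ 2, then 2 rk A' ≤ dim V ≤ rk A', which is impossible for V ≠ 0.
  by_contra hgt
  have hpos : 0 < Fintype.card ι := Fintype.card_pos
  have h1 : 2 * A'.rank ≤ Fintype.card ι := by
    rw [hcard']; exact Nat.mul_le_mul_right _ (by omega)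
  omega

end TensorOp

/-! ### Loops and operators carried along strands -/

namespace BMW
section
variable {A : Type*} [Ring A]

theorem asc_succ_left (f : ℤ → A) (p : ℤ) (n : ℕ) : asc f p (n + 1) = f p * asc f (p + 1) n := by
  rw [add_comm n 1, asc_add]; simp [asc]

theorem Slides.asc_mul_asc {f g x : ℤ → A} (h : Slides f x) (hfg : ∀ i, f i * g i = 1)
    (hgf : ∀ i, g i * f i = 1) (p : ℤ) (m : ℕ) (r : ℤ) (h1 : p ≤ r) : ∀ n : ℕ, r + n < p + m →
      asc x (r + 1) n * asc g p m = asc g p m * asc x r n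
  | 0, _ => by simp [asc]
  | n + 1, h2 => by
      push_cast at h2
      rw [asc, asc, mul_assoc, show r + 1 + (n : ℤ) = r + n + 1 by ring,
        h.mul_asc hfg hgf p m (r + n) (by omega) (by omega), ← mul_assoc,
        h.asc_mul_asc hfg hgf p m r h1 n (by omega), mul_assoc]

theorem Slides.desc_mul_asc {f g x : ℤ → A} (h : Slides f x) (hfg : ∀ i, f i * g i = 1)
    (hgf : ∀ i, g i * f i = 1) (p : ℤ) (m : ℕ) (r : ℤ) (h1 : p ≤ r) : ∀ n : ℕ, r + n < p + m →
      desc x (r + 1) n * asc g p m = asc g p m * desc x r n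
  | 0, _ => by simp [desc]
  | n + 1, h2 => by
      push_cast at h2
      rw [desc, desc, mul_assoc, h.desc_mul_asc hfg hgf p m r h1 n (by omega), ← mul_assoc,
        show r + 1 + (n : ℤ) = r + n + 1 by ring,
        h.mul_asc hfg hgf p m (r + n) (by omega) (by omega), mul_assoc]

theorem Slides.desc_mul_asc_succ {f x : ℤ → A} (h : Slides f x) (p : ℤ) (m : ℕ) (r : ℤ)
    (h1 : p ≤ r) : ∀ n : ℕ, r + n < p + m → desc f p m * asc x (r + 1) n = asc x r n * desc f p m
  | 0, _ => by simp [asc]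
  | n + 1, h2 => by
      push_cast at h2
      rw [asc, asc, ← mul_assoc, h.desc_mul_asc_succ p m r h1 n (by omega), mul_assoc,
        show r + 1 + (n : ℤ) = r + n + 1 by ring, h.desc_mul p m (r + n) (by omega) (by omega),
        mul_assoc]

/-- `x` is transported through two parallel strands that move to the right. -/
theorem Slides.mul_asc_asc {g x : ℤ → A} (h : Slides g x) (hg : Slides g g) (p : ℤ) : ∀ m : ℕ,
    x p * (asc g (p + 1) m * asc g p m) = asc g (p + 1) m * asc g p m * x (p + m)
  | 0 => by simp [asc]
  | m + 1 => by
      have hc : Commute (g (p + m + 1)) (asc g p m) := asc_commute p m fun i h1 h2 =>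
        hg.far _ _ (by omega)
      have h1 : asc g (p + 1) (m + 1) * asc g p (m + 1) =
          asc g (p + 1) m * asc g p m * (g (p + m + 1) * g (p + m)) := by
        rw [asc, asc, show p + 1 + (m : ℤ) = p + m + 1 by ring]
        calc _ = asc g (p + 1) m * (g (p + m + 1) * asc g p m) * g (p + m) := by
              simp only [mul_assoc]
          _ = _ := by rw [hc.eq]; simp only [mul_assoc]
      rw [h1, ← mul_assoc, h.mul_asc_asc hg p m, mul_assoc, ← h.slide, ← mul_assoc,
        show p + ((m + 1 : ℕ) : ℤ) = p + m + 1 by push_cast; ring]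

/-- The family `f`, with inverse `g`, moves strands past the family `s` and past itself. -/
structure Twist (s f g : ℤ → A) : Prop where
  fg : ∀ i, f i * g i = 1
  gf : ∀ i, g i * f i = 1
  slides_fs : Slides f s
  slides_gs : Slides g s
  slides_fg : Slides f g
  slides_gg : Slides g g

/-- The first strand encircles the next `n` strands. -/
def loop (s g : ℤ → A) (p : ℤ) (n : ℕ) : A := asc g p n * desc s p n

theorem loop_add (s g : ℤ → A) (p : ℤ) (m n : ℕ) :
    loop s g p (m + n) = asc g p m * loop s g (p + m) n * desc s p m := by
  rw [loop, asc_add, desc_add, loop]; simp only [mul_assoc]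

/-- The family `o` consists of translates of an operator on one strand which can be carried along
the strands of `f`. -/
structure Gauge (s f g o : ℤ → A) : Prop where
  mul_f : ∀ i, o i * f i = f i * o (i + 1)
  mul_g : ∀ i, o i * g i = g i * o (i + 1)
  commute_s : ∀ i j, i < j ∨ j + 1 < i → Commute (o i) (s j)
  commute_g : ∀ i j, i < j ∨ j + 1 < i → Commute (o i) (g j)
  commute : ∀ i j, i ≠ j → Commute (o i) (o j)

variable {s f g o : ℤ → A}

/-- The inner chains slide through g_p⋯g_{p+k}, so that two successive loops become a pair of
parallel loops. -/
theorem Twist.loop_mul_g_mul_loop (hT : Twist s f g) (p : ℤ) (k : ℕ) :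
    loop s g (p + 1) k * g p * loop s g (p + 1) k =
      g p * (asc g (p + 1) k * asc g p k * (desc s p k * desc s (p + 1) k)) := by
  have h1 := hT.slides_fs.desc_mul_asc hT.fg hT.gf p (k + 1) p le_rfl k (by push_cast; omega)
  have h2 := hT.slides_fg.asc_mul_asc hT.fg hT.gf p (k + 1) p le_rfl k (by push_cast; omega)
  rw [asc_succ_left] at h1 h2
  calc loop s g (p + 1) k * g p * loop s g (p + 1) k
      = asc g (p + 1) k * (desc s (p + 1) k * (g p * asc g (p + 1) k)) * desc s (p + 1) k := by
        simp only [loop, mul_assoc]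
    _ = asc g (p + 1) k * (g p * asc g (p + 1) k) * desc s p k * desc s (p + 1) k := by
        rw [h1]; simp only [mul_assoc]
    _ = _ := by rw [h2]; simp only [mul_assoc]

theorem Gauge.mul_asc (h : Gauge s f g o) (p : ℤ) : ∀ n : ℕ,
    o p * asc g p n = asc g p n * o (p + n)
  | 0 => by simp [asc]
  | n + 1 => by
      rw [asc, ← mul_assoc, h.mul_asc p n, mul_assoc, h.mul_g, ← mul_assoc]
      congr 2; push_cast; ring

/-- Carrying o across g = f⁻¹ is the same as carrying it back across f, so f exchanges o_p and
o_{p+1}. -/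
theorem Gauge.commute_mul_f (h : Gauge s f g o) (hT : Twist s f g) (p : ℤ) :
    Commute (o p * o (p + 1)) (f p) := by
  have h1 : o (p + 1) * f p = f p * o p := by
    calc o (p + 1) * f p = f p * (g p * o (p + 1)) * f p := by
          rw [← mul_assoc, hT.fg, one_mul]
      _ = f p * o p := by rw [← h.mul_g, mul_assoc, mul_assoc, hT.gf, mul_one]
  rw [Commute, SemiconjBy, mul_assoc, h1, ← mul_assoc, h.mul_f, mul_assoc,
    (h.commute p (p + 1) (by omega)).eq]

theorem Gauge.commute_mul_g (h : Gauge s f g o) (hT : Twist s f g) (p : ℤ) :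
    Commute (o p * o (p + 1)) (g p) := by
  have h1 : Commute (o p * o (p + 1)) (f p) := h.commute_mul_f hT p
  calc o p * o (p + 1) * g p = g p * (f p * (o p * o (p + 1))) * g p := by
        rw [← mul_assoc (g p), hT.gf, one_mul]
    _ = g p * (o p * o (p + 1)) := by
        rw [← h1.eq]; simp only [mul_assoc]; rw [hT.fg, mul_one]
end

section
variable {A : Type*} [Ring A] [Algebra ℂ A] {q μ ε : ℂ} {s t e f g o γ : ℤ → A}

/-- A generator on the encircled strands is lowered by one half of the loop and raised again by the
other. -/
theorem System.s_commute_loop (hT : Twist s f g) (hs : System q μ s t e)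
    (p : ℤ) (n : ℕ) (i : ℤ) (h1 : p < i) (h2 : i < p + n) : Commute (s i) (loop s g p n) := by
  have h3 := hT.slides_fs.mul_asc hT.fg hT.gf p n (i - 1) (by omega) (by omega)
  have h4 := hs.slides_s.desc_mul p n (i - 1) (by omega) (by omega)
  rw [sub_add_cancel] at h3 h4
  rw [Commute, SemiconjBy, loop, ← mul_assoc, h3, mul_assoc, mul_assoc, h4]

theorem System.loop_commute_asym (hT : Twist s f g) (hs : System q μ s t e)
    (p : ℤ) (n : ℕ) (r : ℤ) (m : ℕ) (h1 : p < r) (h2 : r + m ≤ p + n + 1) :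
    Commute (loop s g p n) (asym q μ s e r m) :=
  asym_commute r m fun i h3 h4 => by
    have := (hs.s_commute_loop hT p n i (by omega) (by omega)).symm
    exact ⟨this, hs.commute_e_of this⟩

theorem Gauge.commute_asym (hs : System q μ s t e) (h : Gauge s f g o) (i r : ℤ) (m : ℕ)
    (h1 : i < r ∨ r + m ≤ i) : Commute (o i) (asym q μ s e r m) :=
  asym_commute r m fun j h2 h3 => by
    have := h.commute_s i j (by omega)
    exact ⟨this, hs.commute_e_of this⟩

theorem Slides.commute_asym (hs : System q μ s t e) (h : Slides f s) (i r : ℤ) (m : ℕ)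
    (h1 : i + 1 < r ∨ r + m ≤ i) : Commute (f i) (asym q μ s e r m) :=
  asym_commute r m fun j h2 h3 => by
    have := h.far i j (by omega)
    exact ⟨this, hs.commute_e_of this⟩

/-- Each factor o contributes one loop around the antisymmetrizer; the two signs cancel and the
loops run in parallel. -/
theorem Gauge.mul_mul_asym (hs : System q μ s t e) (hT : Twist s f g) (h : Gauge s f g o) (k : ℕ)
    (hε : ε * ε = 1)
    (ho : ∀ i, o i * asym q μ s e (i + 1) k = ε • (loop s g i k * asym q μ s e (i + 1) k))
    (p : ℤ) : o p * o (p + 1) * asym q μ s e (p + 2) k =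
      asc g (p + 1) k * asc g p k * (desc s p k * desc s (p + 1) k) * asym q μ s e (p + 2) k := by
  have ho1 := ho (p + 1)
  rw [show p + 1 + 1 = p + 2 by ring] at ho1
  set a := asym q μ s e (p + 2) k with ha
  have hfa : Commute (f p) a := hT.slides_fs.commute_asym hs p _ k (by omega)
  have hga : Commute (g p) a := hT.slides_gs.commute_asym hs p _ k (by omega)
  have hol : Commute (o p) (loop s g (p + 1) k) :=
    (asc_commute _ _ fun i _ _ => h.commute_g p i (by omega)).mul_right
      (desc_commute _ _ fun i _ _ => h.commute_s p i (by omega))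
  set L := loop s g (p + 1) k with hL
  have hop : o p = g p * o (p + 1) * f p := by
    rw [← h.mul_g, mul_assoc, hT.gf, mul_one]
  have h1 : o p * a = ε • (g p * L * f p * a) := by
    rw [hop, mul_assoc, hfa.eq, mul_assoc, ← mul_assoc (o _), ho1, smul_mul_assoc, mul_smul_comm,
      mul_assoc L, ← hfa.eq]
    simp only [mul_assoc]
  have h2 : o p * o (p + 1) * a = L * g p * L * f p * a := by
    rw [mul_assoc, ho1, mul_smul_comm, ← mul_assoc, hol.eq, mul_assoc, h1, mul_smul_comm, smul_smul,
      hε, one_smul]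
    simp only [mul_assoc]
  -- At this stage the result is g_p Θ f_p on a, with Θ the parallel loops. Since o_p o_{p+1} and a
  -- commute with f_p, respectively g_p, the conjugation can be undone.
  have h3 := (h.commute_mul_f hT p).eq
  rw [hL, hT.loop_mul_g_mul_loop] at h2
  set Θ := asc g (p + 1) k * asc g p k * (desc s p k * desc s (p + 1) k)
  calc o p * o (p + 1) * a = o p * o (p + 1) * f p * (g p * a) := by
        rw [mul_assoc _ (f p), ← mul_assoc (f p), hT.fg, one_mul]
    _ = f p * (o p * o (p + 1) * a) * g p := by rw [h3, hga.eq]; simp only [mul_assoc]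
    _ = (f p * g p) * Θ * (f p * (a * g p)) := by rw [h2]; simp only [mul_assoc]
    _ = Θ * a := by rw [← hga.eq, ← mul_assoc (f p), hT.fg, one_mul, one_mul]

/-- The crossing s_p travels along the outgoing parallel strands to s_{p+k} and returns along the
incoming ones to s_p. -/
theorem Gauge.commute_s_mul_asym (hs : System q μ s t e) (hT : Twist s f g) (h : Gauge s f g o)
    (k : ℕ) (hε : ε * ε = 1)
    (ho : ∀ i, o i * asym q μ s e (i + 1) k = ε • (loop s g i k * asym q μ s e (i + 1) k))
    (p : ℤ) : (s p * o p * o (p + 1) - o p * o (p + 1) * s p) * asym q μ s e (p + 2) k = 0 := by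
  have h1 := h.mul_mul_asym hs hT k hε ho p
  have hsa : Commute (s p) (asym q μ s e (p + 2) k) := hs.slides_s.commute_asym hs p _ k (by omega)
  have h2 := hT.slides_gs.mul_asc_asc hT.slides_gg p k
  have h3 := hs.s_mul_desc_desc p k
  set a := asym q μ s e (p + 2) k
  rw [sub_mul, mul_assoc _ (s p), hsa.eq, ← mul_assoc _ a, mul_assoc (s p), mul_assoc (s p), h1,
    sub_eq_zero]
  calc _ = s p * (asc g (p + 1) k * asc g p k) * (desc s p k * desc s (p + 1) k) * a := by
        simp only [mul_assoc]
    _ = asc g (p + 1) k * asc g p k * (desc s p k * desc s (p + 1) k) * (s p * a) := by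
        rw [h2, mul_assoc _ (s _), h3]; simp only [mul_assoc]
    _ = _ := by rw [hsa.eq]; simp only [mul_assoc]

/-- Encircling two antisymmetrizers. -/
theorem Gauge.loop_mul_asym_mul_asym (hs : System q μ s t e)
    (h : Gauge s f g o) (k : ℕ) (hε : ε * ε = 1)
    (ho : ∀ i, o i * asym q μ s e (i + 1) k = ε • (loop s g i k * asym q μ s e (i + 1) k))
    (p : ℤ) : loop s g p (k + k) * (asym q μ s e (p + 1) k * asym q μ s e (p + 1 + k) k) =
      o p * o p * (asym q μ s e (p + 1) k * asym q μ s e (p + 1 + k) k) := by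
  have h1 := ho (p + k)
  have h2 := ho p
  rw [show p + k + 1 = p + 1 + (k : ℤ) by ring] at h1
  set a := asym q μ s e (p + 1) k
  set b := asym q μ s e (p + 1 + k) k with hb
  have hab : Commute b a := asym_commute _ _ fun i h3 h4 => by
    have : Commute (s i) b := asym_commute _ _ fun j h5 h6 =>
      ⟨hs.far' (by omega), hs.se_far (by omega)⟩
    exact ⟨this.symm, hs.commute_e_of this.symm⟩
  have hDb : Commute b (desc s p k) := desc_commute _ _ fun i h3 h4 =>
    (hs.slides_s.commute_asym hs i _ k (by omega)).symm
  have hlb : loop s g p k * a * b = ε • (o p * a * b) := by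
    rw [h2, smul_mul_assoc, smul_smul, hε, one_smul]
  -- The loop splits into a loop around the second antisymmetrizer inside one around the first. Each
  -- turns into one factor o, the inner one being carried back to strand p.
  calc loop s g p (k + k) * (a * b)
      = asc g p k * loop s g (p + k) k * (desc s p k * b) * a := by
        rw [loop_add, ← hab.eq]; simp only [mul_assoc]
    _ = asc g p k * (loop s g (p + k) k * b) * desc s p k * a := by
        rw [← hDb.eq]; simp only [mul_assoc]
    _ = ε • (asc g p k * (o (p + k) * b) * desc s p k * a) := by
        rw [h1, mul_smul_comm, smul_mul_assoc, smul_mul_assoc, smul_smul, hε, one_smul]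
    _ = ε • (asc g p k * o (p + k) * (b * desc s p k) * a) := by simp only [mul_assoc]
    _ = ε • (o p * (asc g p k * desc s p k * (b * a))) := by
        rw [← h.mul_asc, hDb.eq]; simp only [mul_assoc]
    _ = ε • (o p * (loop s g p k * a * b)) := by rw [hab.eq, loop, ← mul_assoc _ a]
    _ = _ := by
        rw [hlb, mul_smul_comm, smul_smul, hε, one_smul]; simp only [mul_assoc]

/-- Encircling nested cups. -/
theorem Gauge.loop_mul_nest (hs : System q μ s t e) (hT : Twist s f g) (h : Gauge s f g γ)
    (hγ : ∀ i, γ i * e (i + 1) = loop s g i 2 * e (i + 1)) : ∀ (n : ℕ) (p : ℤ),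
    loop s g p (2 * n) * nest s e (p + 1) n = γ p ^ n * nest s e (p + 1) n
  | 0, p => by simp [loop, asc, desc]
  | n + 1, p => by
      have ih := h.loop_mul_nest hs hT hγ n (p + 2)
      have hLD : Commute (loop s g p (2 * (n + 1))) (desc s (p + 1 + 1) (2 * n)) :=
        desc_commute _ _ fun i h1 h2 => (hs.s_commute_loop hT p _ i (by omega)
          (by push_cast at h2 ⊢; omega)).symm
      have hγD : Commute (γ p ^ (n + 1)) (desc s (p + 1 + 1) (2 * n)) :=
        (desc_commute _ _ fun i h1 h2 => h.commute_s p i (by omega)).pow_left _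
      rw [nest, ← mul_assoc, ← mul_assoc, ← mul_assoc, ← mul_assoc, hLD.eq, hγD.eq,
        show p + 1 + 2 = p + 2 + 1 by ring, mul_assoc _ _ (nest s e _ _), mul_assoc _ _ (nest s e _ _)]
      simp only [mul_assoc]
      congr 1
      have hN : ∀ z, (∀ i, p + 2 < i → Commute z (s i)) → Commute (nest s e (p + 2 + 1) n) z :=
        fun z hz => (nest_commute _ _ fun i h1 h2 =>
          ⟨hz i (by omega), hs.commute_e_of (hz i (by omega))⟩).symm
      have hNd : Commute (nest s e (p + 2 + 1) n) (desc s p 2) := desc_commute _ _ fun i h1 h2 =>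
        hN _ fun j hj => hs.far' (by push_cast at h2; omega)
      have hNe : Commute (nest s e (p + 2 + 1) n) (e (p + 1)) :=
        hN _ fun j hj => (hs.se_far (by omega)).symm
      have hpow : ∀ m : ℕ, asc g p 2 * γ (p + 2) ^ m = γ p ^ m * asc g p 2 := fun m => by
        have h1 : SemiconjBy (asc g p 2) (γ (p + 2)) (γ p) := (h.mul_asc p 2).symm
        exact h1.pow_right m
      set N := nest s e (p + 2 + 1) n with hNdef
      -- Split off the first two encircled strands: the loop around the other cups gives γ_{p+2}^n
      -- by induction, carried back to γ_p^n, and the remaining loop around e_{p+1} gives one more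
      -- γ_p.
      calc loop s g p (2 * (n + 1)) * (e (p + 1) * N)
          = asc g p 2 * loop s g (p + 2) (2 * n) * (desc s p 2 * N) * e (p + 1) := by
            rw [show 2 * (n + 1) = 2 + 2 * n by ring, loop_add, ← hNe.eq,
              show p + ((2 : ℕ) : ℤ) = p + 2 by push_cast; ring]
            simp only [mul_assoc]
        _ = asc g p 2 * (loop s g (p + 2) (2 * n) * N) * desc s p 2 * e (p + 1) := by
            rw [← hNd.eq]; simp only [mul_assoc]
        _ = asc g p 2 * γ (p + 2) ^ n * (N * desc s p 2) * e (p + 1) := by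
            rw [ih]; simp only [mul_assoc]
        _ = γ p ^ n * (asc g p 2 * desc s p 2) * (N * e (p + 1)) := by
            rw [hpow, hNd.eq]; simp only [mul_assoc]
        _ = γ p ^ n * (γ p * e (p + 1)) * N := by
            rw [hNe.eq, hγ, loop]; simp only [mul_assoc]
        _ = _ := by rw [pow_succ]; simp only [mul_assoc]

/-- One loop around 2k strands commutes with both antisymmetrizers. Evaluated on them it is o²,
evaluated on the cups it is γ^k. -/
theorem Gauge.sq_sub_pow_mul_asym_mul_nest (hs : System q μ s t e) (hT : Twist s f g)
    (h : Gauge s f g o) (h' : Gauge s f g γ) (k : ℕ) (hg : Generic q μ k) (hε : ε * ε = 1)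
    (ho : ∀ i, o i * asym q μ s e (i + 1) k = ε • (loop s g i k * asym q μ s e (i + 1) k))
    (hγ : ∀ i, γ i * e (i + 1) = loop s g i 2 * e (i + 1)) (p : ℤ) :
    (o p ^ 2 - γ p ^ k) * asym q μ s e (p + 1) k * nest s e (p + 1) k = 0 := by
  have h1 := h.loop_mul_asym_mul_asym hs k hε ho p
  have h2 := h'.loop_mul_nest hs hT hγ k p
  have h3 := hs.asym_mul_asym_mul_nest (p + 1) k hg
  rw [two_mul] at h2
  have hLa := hs.loop_commute_asym hT p (k + k) (p + 1) k (by omega) (by push_cast; omega)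
  have hLb := hs.loop_commute_asym hT p (k + k) (p + 1 + k) k (by omega) (by push_cast; omega)
  have hγa : Commute (γ p ^ k) (asym q μ s e (p + 1) k) :=
    (h'.commute_asym hs p _ k (by omega)).pow_left _
  have hγb : Commute (γ p ^ k) (asym q μ s e (p + 1 + k) k) :=
    (h'.commute_asym hs p _ k (by omega)).pow_left _
  set a := asym q μ s e (p + 1) k
  set b := asym q μ s e (p + 1 + k) k
  set N := nest s e (p + 1) k
  set L := loop s g p (k + k)
  have hab : Commute a b := asym_commute _ _ fun i h4 h5 => by
    have : Commute (s i) a := asym_commute _ _ fun j h5 h6 =>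
      ⟨hs.far' (by omega), hs.se_far (by omega)⟩
    exact ⟨this.symm, hs.commute_e_of this.symm⟩
  rw [sub_mul, sub_mul, sub_eq_zero]
  calc o p ^ 2 * a * N = o p * o p * (b * (a * N)) := by rw [h3, sq, mul_assoc]
    _ = o p * o p * (a * b) * N := by rw [hab.eq]; simp only [mul_assoc]
    _ = a * (L * b) * N := by rw [← h1, ← mul_assoc, hLa.eq, mul_assoc a]
    _ = b * a * (L * N) := by rw [hLb.eq, ← hab.eq]; simp only [mul_assoc]
    _ = b * (γ p ^ k * a) * N := by rw [h2, hγa.eq]; simp only [mul_assoc]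
    _ = γ p ^ k * (b * (a * N)) := by rw [← mul_assoc b, ← hγb.eq]; simp only [mul_assoc]
    _ = _ := by rw [h3, mul_assoc]

/-- Two gauge families commute if one of them is defined by a contraction and the other respects
the generators `s`. -/
theorem Gauge.sub_mul_eq_zero (hs : System q μ s t e) (hT : Twist s f g) (ho : Gauge s f g o)
    (hso : ∀ i, Commute (o i * o (i + 1)) (s i)) (hu : ∀ i, IsUnit (o i))
    (hγo : ∀ i j, i < j → Commute (γ i) (o j))
    (hγ : ∀ i, γ i * e (i + 1) = e (i + 1) * asc g i 2 * e (i + 1)) (p : ℤ) :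
    (γ p * o p - o p * γ p) * e (p + 1) = 0 := by
  have he := hs.commute_e_of (hso (p + 1))
  have hoe : Commute (o p) (e (p + 1)) := hs.commute_e_of (ho.commute_s p (p + 1) (by omega))
  have hγ12 : Commute (γ p) (o (p + 1) * o (p + 1 + 1)) :=
    (hγo _ _ (by omega)).mul_right (hγo _ _ (by omega))
  have h1 : Commute (o p * (o (p + 1) * o (p + 1 + 1))) (e (p + 1)) := hoe.mul_left he
  have h2 : Commute (o p * (o (p + 1) * o (p + 1 + 1))) (asc g p 2) := by
    simp only [asc, one_mul, Nat.cast_zero, add_zero, Nat.cast_one]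
    refine Commute.mul_right ?_ ?_
    · rw [← mul_assoc]
      exact (ho.commute_mul_g hT p).mul_left (ho.commute_g _ _ (by omega))
    · exact (ho.commute_g _ _ (by omega)).mul_left (ho.commute_mul_g hT (p + 1))
  -- The product o_p o_{p+1} o_{p+2} commutes with e_{p+1} and with g_p g_{p+1}, hence with γ_p
  -- e_{p+1}. The last two factors commute with γ_p and are invertible, so they can be cancelled and
  -- o_p remains.
  have h4 : Commute (o p * (o (p + 1) * o (p + 1 + 1))) (γ p * e (p + 1)) := by
    rw [hγ]
    exact (h1.mul_right h2).mul_right h1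
  refine ((hu (p + 1)).mul (hu (p + 1 + 1))).mul_left_eq_zero.mp ?_
  set O := o (p + 1) * o (p + 1 + 1)
  rw [sub_mul, sub_mul, sub_eq_zero]
  calc γ p * o p * e (p + 1) * O = γ p * e (p + 1) * (o p * O) := by
        rw [mul_assoc (γ p), hoe.eq]; simp only [mul_assoc]
    _ = o p * (O * γ p) * e (p + 1) := by rw [← h4.eq]; simp only [mul_assoc]
    _ = o p * γ p * (O * e (p + 1)) := by rw [← hγ12.eq]; simp only [mul_assoc]
    _ = _ := by rw [he.eq]; simp only [mul_assoc]
end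
end BMW

namespace BMW
section
variable {A : Type*} [Ring A]

theorem prod_ofFn_eq_asc (f : ℤ → A) (p : ℤ) : ∀ n : ℕ,
    (List.ofFn fun i : Fin n => f (p + (i.val : ℕ))).prod = asc f p n
  | 0 => by simp [asc]
  | n + 1 => by
      rw [List.ofFn_succ', List.concat_eq_append, List.prod_append, List.prod_singleton, asc,
        ← prod_ofFn_eq_asc f p n]
      rfl

theorem asc_mul_of [Algebra ℂ A] {f : ℤ → A} {z : A} {c : ℂ} (p : ℤ) : ∀ n : ℕ,
    (∀ i : ℕ, i < n → f (p + i) * z = c • z) → asc f p n * z = c ^ n • z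
  | 0, _ => by simp [asc]
  | n + 1, h => by
      rw [asc, mul_assoc, h n (by omega), mul_smul_comm,
        asc_mul_of p n fun i hi => h i (by omega), smul_smul, pow_succ']

end
end BMW

/-! ### Partial traces as compressions, and compatible pairs -/

namespace TensorOp
variable {ι : Type*} [Fintype ι] [DecidableEq ι] {m n k : ℕ}
open BMW
variable {q μ : ℂ} {R F : TensorOp ι 2}

theorem eq_zero_of_op_mul_op {X : TensorOp ι m} {Y : TensorOp ι n} (p r : ℤ) (hpr : p + m ≤ r)
    (hι : Nonempty ι) (hY : Y ≠ 0) (h : op p X * op r Y = (0 : Ops ι)) : X = 0 := by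
  by_contra hX
  refine hY (op_injective r ?_)
  rw [map_zero]
  exact eq_zero_of_map_mul_eq_zero (op p) (fun Z => op_commute _ _ (Or.inr hpr)) h hX

/-- The compression by an operator of rank one is a partial trace. -/
theorem op_traceExcept_mul {B : TensorOp ι m} (hB : B.rank ≤ 1) (X : TensorOp ι (m + 1)) (p : ℤ) :
    (op p (traceExcept (legs 0 1 (m + 1) (by omega)) (act (m + 1) 1 B (by omega) * X)) *
      op (p + 1) B : Ops ι) = op (p + 1) B * op p X * op (p + 1) B := by
  obtain ⟨v, w, rfl⟩ := Matrix.exists_eq_vecMulVec_of_rank_le_one hB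
  exact (op_mul_mul_op p v w X).symm

/-- An operator obtained by compression can be transported along a strand that passes the
compressing projector. -/
theorem act_mul_eq_of_compress {B : TensorOp ι m} (hι : Nonempty ι) (hB : B ≠ 0) (Y : TensorOp ι 1)
    {H : TensorOp ι 2} (hH : IsUnit H) {Φ : ℤ → Ops ι}
    (hY : ∀ p, op p Y * op (p + 1) B = op (p + 1) B * Φ p * op (p + 1) B)
    (h1 : ∀ p, desc (fun i => op i H : ℤ → Ops ι) p (m + 1) * op (p + 1 + 1) B =
      op (p + 1) B * desc (fun i => op i H : ℤ → Ops ι) p (m + 1))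
    (h2 : ∀ p, desc (fun i => op i H : ℤ → Ops ι) p (m + 1) * Φ (p + 1) =
      Φ p * desc (fun i => op i H : ℤ → Ops ι) p (m + 1)) :
    act 2 0 Y (by omega) * H = H * act 2 1 Y second_leg_le := by
  rw [← sub_eq_zero]
  refine eq_zero_of_op_mul_op 0 2 (by norm_num) hι hB ?_
  simp only [map_sub, map_mul, op_act, Nat.cast_zero, Nat.cast_one, add_zero, zero_add, sub_mul]
  have hY0 := hY 0
  have hY1 := hY 1
  replace h1 := h1 0
  replace h2 := h2 0
  simp only [zero_add, show (1 : ℤ) + 1 = 2 by norm_num] at *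
  set D := desc (fun i => op i H : ℤ → Ops ι) 1 m with hD
  set J := desc (fun i => op i H : ℤ → Ops ι) 0 (m + 1) with hJ
  have hJD : J = D * op 0 H := desc_succ_right _ _ _
  have hDc : Commute (op 0 Y) D := desc_commute _ _ fun i h3 _ =>
    op_commute _ _ (Or.inl (by push_cast; omega))
  have hD1 : asc (fun i => op i H⁻¹ : ℤ → Ops ι) 1 m * D = 1 :=
    asc_mul_desc (fun i => op_inv_mul hH i) _ _
  -- The whole strand J = D H_0 passes the compressed operator, giving J Y_1 B_2 = Y_0 J B_2. As D
  -- avoids factor 0 and is invertible, only H_0 remains, and then B_2 can be cancelled.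
  have h3 : D * (op 0 H * op 1 Y * op 2 B) = D * (op 0 Y * op 0 H * op 2 B) := by
    calc D * (op 0 H * op 1 Y * op 2 B) = J * (op 1 Y * op 2 B) := by
          rw [hJD]; simp only [mul_assoc]
      _ = J * op 2 B * Φ 1 * op 2 B := by rw [hY1]; simp only [mul_assoc]
      _ = op 1 B * (J * Φ 1) * op 2 B := by rw [h1]; simp only [mul_assoc]
      _ = op 1 B * Φ 0 * (J * op 2 B) := by rw [h2]; simp only [mul_assoc]
      _ = (op 1 B * Φ 0 * op 1 B) * J := by rw [h1]; simp only [mul_assoc]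
      _ = op 0 Y * (op 1 B * J) := by rw [← hY0, mul_assoc]
      _ = (op 0 Y * D) * (op 0 H * op 2 B) := by rw [← h1, hJD]; simp only [mul_assoc]
      _ = _ := by rw [hDc.eq]; simp only [mul_assoc]
  rw [sub_eq_zero]
  calc _ = asc (fun i => op i H⁻¹ : ℤ → Ops ι) 1 m * D * (op 0 Y * op 0 H * op 2 B) := by
        rw [hD1, one_mul]
    _ = _ := by rw [mul_assoc, ← h3, ← mul_assoc, hD1, one_mul]

theorem slides_op {X Y : TensorOp ι 2}
    (h : act 3 1 X (by omega) * act 3 0 X (by omega) * act 3 1 Y (by omega) =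
      act 3 0 Y (by omega) * (act 3 1 X (by omega) * act 3 0 X (by omega))) :
    Slides (fun i => op i X : ℤ → Ops ι) (fun i => op i Y) where
  slide i := by
    have := congrArg (op i) h
    simpa only [map_mul, op_act, Nat.cast_zero, Nat.cast_one, add_zero] using this
  far i j hij := op_commute _ _ (by push_cast; omega)

theorem IsUnit.act {X : TensorOp ι m} (hX : IsUnit X) (hι : Nonempty ι) (i : ℕ) (h : i + m ≤ n) :
    act n i X h * act n i X⁻¹ h = 1 ∧ act n i X⁻¹ h * act n i X h = 1 := by
  have hd := (Matrix.isUnit_iff_isUnit_det _).mp hX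
  constructor <;> apply op_injective (0 : ℤ) <;> rw [map_mul, op_act, op_act, ← map_mul]
  · rw [Matrix.mul_nonsing_inv _ hd, map_one, map_one]
  · rw [Matrix.nonsing_inv_mul _ hd, map_one, map_one]

theorem slides_inv {A : Type*} [Ring A] {a b c d x y : A} (hab : a * b = 1) (hba : b * a = 1)
    (hcd : c * d = 1) (hdc : d * c = 1) (h : x * a * c = a * c * y) : d * b * x = y * (d * b) := by
  calc d * b * x = d * b * (x * a * c) * (d * b) := by
        simp only [mul_assoc]
        rw [← mul_assoc c, hcd, one_mul, hab, mul_one]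
    _ = y * (d * b) := by
        rw [h]
        simp only [mul_assoc]
        rw [← mul_assoc b, hba, one_mul, ← mul_assoc d c, hdc, one_mul]

theorem IsCompatiblePair.twist (h : IsCompatiblePair R F) (hι : Nonempty ι) :
    Twist (fun i => op i R : ℤ → Ops ι) (fun i => op i F) (fun i => op i F⁻¹) := by
  obtain ⟨f0, g0⟩ := IsUnit.act (n := 3) h.right.isUnit hι 0 (by omega)
  obtain ⟨f1, g1⟩ := IsUnit.act (n := 3) h.right.isUnit hι 1 (by omega)
  refine ⟨op_mul_inv h.right.isUnit, op_inv_mul h.right.isUnit, slides_op ?_, slides_op ?_,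
    slides_op ?_, slides_op ?_⟩
  · rw [← mul_assoc]; exact h.twist₁.symm
  · exact slides_inv f0 g0 f1 g1 h.twist₂
  · have hb := h.right.braid
    set a := act 3 0 F (by omega)
    set b := act 3 1 F (by omega)
    set a' := act 3 0 F⁻¹ (by omega)
    set b' := act 3 1 F⁻¹ (by omega)
    calc b * a * b' = a' * (a * b * a) * b' := by
          simp only [mul_assoc]; rw [← mul_assoc a', g0, one_mul]
      _ = a' * (b * a) := by
          rw [hb]; simp only [mul_assoc]; rw [f1, mul_one]
  · refine slides_inv f0 g0 f1 g1 ?_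
    have hb := h.right.braid
    set a := act 3 0 F (by omega)
    set b := act 3 1 F (by omega)
    set a' := act 3 0 F⁻¹ (by omega)
    set b' := act 3 1 F⁻¹ (by omega)
    calc b' * a * b = b' * (a * b * a) * a' := by
          simp only [mul_assoc]; rw [f0, mul_one]
      _ = a * b * a' := by
          rw [hb]; simp only [mul_assoc]; rw [← mul_assoc b', g1, one_mul]

theorem gauge_op {Y : TensorOp ι 1}
    (h1 : act 2 0 Y (by omega) * F = F * act 2 1 Y second_leg_le)
    (h2 : act 2 0 Y (by omega) * F⁻¹ = F⁻¹ * act 2 1 Y second_leg_le) :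
    Gauge (fun i => op i R : ℤ → Ops ι) (fun i => op i F) (fun i => op i F⁻¹)
      (fun i => op i Y) where
  mul_f i := by
    have := congrArg (op i) h1
    simpa only [map_mul, op_act, Nat.cast_zero, Nat.cast_one, add_zero] using this
  mul_g i := by
    have := congrArg (op i) h2
    simpa only [map_mul, op_act, Nat.cast_zero, Nat.cast_one, add_zero] using this
  commute_s i j hij := op_commute _ _ (by push_cast; omega)
  commute_g i j hij := op_commute _ _ (by push_cast; omega)
  commute i j hij := op_commute _ _ (by push_cast; omega)

namespace IsOrthogonalType

theorem generic (h : IsOrthogonalType R q k) : Generic q (q ^ (1 - (k : ℤ))) k :=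
  fun i h1 h2 => ⟨h.hasHeight.q_pow_ne i h1 h2, h.hasHeight.mu_ne i h1 h2⟩

theorem closure_ne_zero (h : IsOrthogonalType R q k) (n : ℕ) (h1 : 1 ≤ n) (h2 : n ≤ k) :
    closure q (q ^ (1 - (k : ℤ))) n ≠ 0 :=
  BMW.closure_ne_zero h.hasHeight.bmw.q_ne_zero h.hasHeight.bmw.system.lam_ne h.hasHeight.two_le
    h.generic n h1 h2

theorem rank_alt (h : IsOrthogonalType R q k) : (alt h.hasHeight.bmw k).rank = 1 := h.rank_eq_one

theorem alt_ne_zero (h : IsOrthogonalType R q k) : alt h.hasHeight.bmw k ≠ 0 := by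
  intro h0
  have := h.rank_alt
  rw [h0, Matrix.rank_zero] at this
  omega

/-- Expanded, the height condition is linear in A_2, A_2 R_1 A_2 and A_2 K_1 A_2. The last is c A_2,
so the relation fixes A_2 R_1 A_2, and the skein relation then fixes A_2 R_1⁻¹ A_2. -/
theorem op_alt_mul_inv_mul_op_alt (h : IsOrthogonalType R q k) (p : ℤ) :
    (op (p + 1) (alt h.hasHeight.bmw k) * op p R⁻¹ * op (p + 1) (alt h.hasHeight.bmw k) : Ops ι) =
      (q ^ (1 - (k : ℤ)) * closure q (q ^ (1 - (k : ℤ))) k) •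
        op (p + 1) (alt h.hasHeight.bmw k) := by
  have hb := h.hasHeight.bmw
  have hs := hb.system
  have hk := h.hasHeight.two_le
  have h1 := op_alt_mul_matK_mul_op_alt hb (by omega) h.generic h.closure_ne_zero h.rank_alt.le p
  have h2 : (op (p + 1) (alt hb k) * op (p + 1) (alt hb k) : Ops ι) = op (p + 1) (alt hb k) := by
    rw [← map_mul, alt_mul_alt hb h.generic]
  have h3 := congrArg (op p) h.hasHeight.vanish
  simp only [baxterMinus, map_mul, hb.rho_shift_antisymmetrizer, map_add, map_one, map_smul,
    hb.op_rho_sigma, hb.op_rho_kappa, op_act, map_zero, Nat.cast_zero, Nat.cast_one,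
    add_zero] at h3
  change op (p + 1) (alt hb k) * _ * op (p + 1) (alt hb k) = _ at h3
  have h4 := (closure_top hb.q_ne_zero hs.lam_ne hk h.generic).2
  have h5 := hs.t_eq p
  -- The coefficient of A_2 R_1 A_2 is nonzero, so the relation can be solved for it.
  have hy : (q ^ (2 * k))⁻¹ - 1 ≠ 0 := fun h0 => h.hasHeight.q_pow_ne k (by omega) le_rfl
    (inv_eq_one.mp (sub_eq_zero.mp h0))
  have hα : ((q ^ (2 * k))⁻¹ - 1) / (q - q⁻¹) ≠ 0 := div_ne_zero hy hs.lam_ne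
  set a : Ops ι := op (p + 1) (alt hb k)
  set α := ((q ^ (2 * k))⁻¹ - 1) / (q - q⁻¹)
  set μ := q ^ (1 - (k : ℤ))
  set c := closure q μ k
  set β := μ * ((q ^ (2 * k))⁻¹ - 1) / (μ + q * (q ^ (2 * k))⁻¹)
  simp only [mul_add, add_mul, mul_one, mul_smul_comm, smul_mul_assoc, h1, h2] at h3
  have h6 : a * op p R * a = (-(1 + β * c) / α) • a := by
    have h7 : a * op p R * a = α⁻¹ • (α • (a * op p R * a)) := by
      rw [smul_smul, inv_mul_cancel₀ hα, one_smul]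
    have h8 : α • (a * op p R * a) = -a - β • c • a := by
      rw [← sub_eq_zero, ← h3]; abel
    rw [h7, h8]
    module
  have h9 := h4 (-(1 + β * c) / α) (by rw [mul_div_cancel₀ _ hα]; ring)
  rw [h5, ← h9]
  simp only [mul_add, add_mul, mul_sub, sub_mul, mul_one, mul_smul_comm, smul_mul_assoc, h1, h2, h6]
  module

end IsOrthogonalType
end TensorOp

/-! ### O and G as loops -/

namespace TensorOp
variable {ι : Type*} [Fintype ι] [DecidableEq ι] {k : ℕ}
open BMW
variable {q μ : ℂ} {R F : TensorOp ι 2}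

theorem matK_mul_twist (h : IsBMWType R q μ) (hF : IsCompatiblePair R F) (i : ℤ) :
    (op (i + 1) (matK R q μ) * asc (fun i => op i F⁻¹ : ℤ → Ops ι) i 2 =
      asc (fun i => op i F⁻¹ : ℤ → Ops ι) i 2 * op i (matK R q μ)) := by
  have hT := hF.twist h.nonempty
  exact (h.system.slides_e_of hT.slides_fs).mul_asc hT.fg hT.gf i 2 i le_rfl (by push_cast; omega)

theorem opG_eq (h : IsBMWType R q μ) (F : TensorOp ι 2) : opG h F =
    traceExcept (legs 0 1 (2 + 1) (by omega)) (act (2 + 1) 1 (matK R q μ) (by omega) *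
      (act (2 + 1) 0 F⁻¹ (by omega) * act (2 + 1) 1 F⁻¹ (by omega))) := by
  have := h.nonempty
  rw [opG, mul_assoc]
  congr 2
  apply op_injective (0 : ℤ)
  rw [h.op_rho_kappa, op_act]

/-- `G_i K_{i+1}` expressed by a loop around two strands. -/
theorem op_opG_mul_matK (h : IsBMWType R q μ) (hK : (matK R q μ).rank ≤ 1)
    (F : TensorOp ι 2) (i : ℤ) :
    (op i (opG h F) * op (i + 1) (matK R q μ) : Ops ι) = op (i + 1) (matK R q μ) *
      asc (fun i => op i F⁻¹ : ℤ → Ops ι) i 2 * op (i + 1) (matK R q μ) := by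
  rw [opG_eq, op_traceExcept_mul hK]
  simp [asc, op_act]

/-- G is a compression by the rank-one K, and a strand of F or F⁻¹ slides past both K and F_1⁻¹
F_2⁻¹. -/
theorem opG_gauge (h : IsBMWType R q μ) (hK : (matK R q μ).rank ≤ 1)
    (hF : IsCompatiblePair R F) :
    Gauge (fun i => op i R : ℤ → Ops ι) (fun i => op i F) (fun i => op i F⁻¹)
      (fun i => op i (opG h F)) := by
  have hT := hF.twist h.nonempty
  have key : ∀ {H : TensorOp ι 2}, IsUnit H → Slides (fun i => op i H : ℤ → Ops ι) (fun i => op i R) →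
      Slides (fun i => op i H : ℤ → Ops ι) (fun i => op i F⁻¹) →
      act 2 0 (opG h F) (by omega) * H = H * act 2 1 (opG h F) second_leg_le := by
    intro H hH h1 h2
    refine act_mul_eq_of_compress (Φ := fun i => asc (fun i => op i F⁻¹ : ℤ → Ops ι) i 2) h.nonempty
      (B := matK R q μ) h.kappa_ne_zero (opG h F) hH
      (op_opG_mul_matK h hK F) (fun p => ?_) (fun p => ?_)
    · exact (h.system.slides_e_of h1).desc_mul p 3 (p + 1) (by omega) (by push_cast; omega)
    · exact h2.desc_mul_asc_succ p 3 p le_rfl 2 (by push_cast; omega)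
  exact gauge_op (key hF.right.isUnit hT.slides_fs hT.slides_fg)
    (key (Matrix.isUnit_nonsing_inv_iff.mpr hF.right.isUnit) hT.slides_gs hT.slides_gg)

/-- Sliding the left K through the chain produces K_i K_{i+1}, which equals R_{i+1} R_i K_{i+1}. -/
theorem op_opG_mul_matK_eq_loop (h : IsBMWType R q μ) (hK : (matK R q μ).rank ≤ 1)
    (hF : IsCompatiblePair R F) (i : ℤ) :
    (op i (opG h F) * op (i + 1) (matK R q μ) : Ops ι) =
      loop (fun i => op i R) (fun i => op i F⁻¹) i 2 * op (i + 1) (matK R q μ) := by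
  rw [op_opG_mul_matK h hK, matK_mul_twist h hF, mul_assoc,
    h.system.ee_eq_sse (i := i) (j := i + 1) (by omega), loop]
  simp [desc, mul_assoc]

namespace IsOrthogonalType

theorem rank_matK (h : IsOrthogonalType R q k) : (matK R q (q ^ (1 - (k : ℤ)))).rank ≤ 1 :=
  matK_rank_le_one h.hasHeight.bmw h.hasHeight.two_le h.generic h.closure_ne_zero h.rank_alt

/-- Two overlapping antisymmetrizers of rank one. -/
theorem op_alt_mul_op_alt (h : IsOrthogonalType R q k) (p : ℤ) :
    (op p (alt h.hasHeight.bmw k) * op (p + 1) (alt h.hasHeight.bmw k) : Ops ι) =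
      ((-1) ^ (k - 1) * closure q (q ^ (1 - (k : ℤ))) k) •
        (desc (fun i => op i R : ℤ → Ops ι) p k * op (p + 1) (alt h.hasHeight.bmw k)) := by
  have hb := h.hasHeight.bmw
  have hs := hb.system
  have hk := h.hasHeight.two_le
  have h1 := hs.asym_mul_asc hs.slides_s hs.st hs.ts p k k p le_rfl le_rfl
  rw [← op_alt hb, ← op_alt hb] at h1
  have h2 : ∀ i : ℕ, i < k - 1 → op (p + 1 + i) R⁻¹ * op (p + 1) (alt hb k) =
      (-q) • (op (p + 1) (alt hb k) : Ops ι) := fun i hi => by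
    rw [op_alt]
    exact hs.t_of_s_left (hs.s_mul_asym (p + 1) k h.generic i (by omega))
  have h3 := asc_mul_of (f := fun i => (op i R⁻¹ : Ops ι)) (p + 1) (k - 1) h2
  have h4 := h.op_alt_mul_inv_mul_op_alt p
  have h5 := asc_succ_left (fun i => (op i R⁻¹ : Ops ι)) p (k - 1)
  rw [Nat.sub_add_cancel (by omega)] at h5
  have h6 := desc_mul_asc hs.st p k
  set a : Ops ι := op (p + 1) (alt hb k)
  set c := closure q (q ^ (1 - (k : ℤ))) k
  -- R_2⁻¹⋯R_k⁻¹ acts on A_2 as (-q)^{k-1}, and μ = q^{1-k} cancels its power of q; only the sign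
  -- survives.
  have h7 : (-q) ^ (k - 1) * (q ^ (1 - (k : ℤ)) * c) = (-1) ^ (k - 1) * c := by
    obtain ⟨n, rfl⟩ : ∃ n, k = n + 1 := ⟨k - 1, by omega⟩
    have hq := hb.q_ne_zero
    rw [zpow_one_sub hq, Nat.add_sub_cancel, neg_pow, pow_succ q n]
    field_simp
  -- Insert R_k⋯R_1 R_1⁻¹⋯R_k⁻¹ and slide A_1 through the inverses, where it becomes A_2; the result
  -- contains A_2 R_1⁻¹ A_2.
  calc op p (alt hb k) * a = desc (fun i => op i R : ℤ → Ops ι) p k *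
        (asc (fun i => op i R⁻¹ : ℤ → Ops ι) p k * op p (alt hb k)) * a := by
        rw [← mul_assoc, h6, one_mul]
    _ = desc (fun i => op i R : ℤ → Ops ι) p k *
        (a * op p R⁻¹ * (asc (fun i => op i R⁻¹ : ℤ → Ops ι) (p + 1) (k - 1) * a)) := by
        rw [← h1, h5]; simp only [mul_assoc]
    _ = _ := by rw [h3, mul_smul_comm, h4, smul_smul, h7, mul_smul_comm]

theorem opO_eq (h : IsOrthogonalType R q k) (F : TensorOp ι 2) : opO h F =
    (closure q (q ^ (1 - (k : ℤ))) k)⁻¹ • traceExcept (legs 0 1 (k + 1) (by omega))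
      (act (k + 1) 1 (alt h.hasHeight.bmw k) (by omega) *
        (List.ofFn fun i : Fin k => act (k + 1) i.val F⁻¹ (by omega)).prod) := by
  have hb := h.hasHeight.bmw
  rw [opO, hb.rho_shift_antisymmetrizer,
    eq_inv_of_mul_eq_one_left (closure_top hb.q_ne_zero hb.system.lam_ne h.hasHeight.two_le
      h.generic).1]
  rfl

theorem op_opO_mul_alt (h : IsOrthogonalType R q k) (F : TensorOp ι 2) (p : ℤ) :
    (op p (opO h F) * op (p + 1) (alt h.hasHeight.bmw k) : Ops ι) =
      op (p + 1) (alt h.hasHeight.bmw k) * ((closure q (q ^ (1 - (k : ℤ))) k)⁻¹ •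
        asc (fun i => op i F⁻¹ : ℤ → Ops ι) p k) * op (p + 1) (alt h.hasHeight.bmw k) := by
  rw [opO_eq, map_smul, smul_mul_assoc, op_traceExcept_mul h.rank_alt.le, map_list_prod,
    List.map_ofFn, mul_smul_comm, smul_mul_assoc, ← prod_ofFn_eq_asc]
  simp only [Function.comp_def, op_act]

theorem opO_mul_eq (h : IsOrthogonalType R q k) (hF : IsCompatiblePair R F) :
    (act 2 0 (opO h F) (by omega) * F = F * act 2 1 (opO h F) second_leg_le ∧
      act 2 0 (opO h F) (by omega) * F⁻¹ = F⁻¹ * act 2 1 (opO h F) second_leg_le) := by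
  have hb := h.hasHeight.bmw
  have hT := hF.twist hb.nonempty
  have key : ∀ {H : TensorOp ι 2}, IsUnit H → Slides (fun i => op i H : ℤ → Ops ι) (fun i => op i R) →
      Slides (fun i => op i H : ℤ → Ops ι) (fun i => op i F⁻¹) →
      act 2 0 (opO h F) (by omega) * H = H * act 2 1 (opO h F) second_leg_le := by
    intro H hH h1 h2
    refine act_mul_eq_of_compress (Φ := fun i => (closure q (q ^ (1 - (k : ℤ))) k)⁻¹ •
      asc (fun i => op i F⁻¹ : ℤ → Ops ι) i k) hb.nonempty h.alt_ne_zero (opO h F) hH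
      (h.op_opO_mul_alt F) (fun p => ?_) (fun p => ?_)
    · rw [op_alt, op_alt]
      exact hb.system.desc_mul_asym h1 p (k + 1) k (p + 1) (by omega) (by push_cast; omega)
    · rw [mul_smul_comm, smul_mul_assoc]
      congr 1
      exact h2.desc_mul_asc_succ p (k + 1) p le_rfl k (by push_cast; omega)
  exact ⟨key hF.right.isUnit hT.slides_fs hT.slides_fg,
    key (Matrix.isUnit_nonsing_inv_iff.mpr hF.right.isUnit) hT.slides_gs hT.slides_gg⟩

/-- `O_i A_{i+1}` expressed by a loop around `k` strands. -/
theorem op_opO_mul_alt_eq_loop (h : IsOrthogonalType R q k) (hF : IsCompatiblePair R F) (p : ℤ) :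
    (op p (opO h F) * op (p + 1) (alt h.hasHeight.bmw k) : Ops ι) =
      ((-1 : ℂ) ^ (k - 1)) • (loop (fun i => op i R) (fun i => op i F⁻¹) p k *
        op (p + 1) (alt h.hasHeight.bmw k)) := by
  have hb := h.hasHeight.bmw
  have hT := hF.twist hb.nonempty
  have h1 := hb.system.asym_mul_asc hT.slides_fs hT.fg hT.gf p k k p le_rfl le_rfl
  rw [← op_alt hb, ← op_alt hb] at h1
  have hc := h.closure_ne_zero k (by have := h.hasHeight.two_le; omega) le_rfl
  rw [h.op_opO_mul_alt F, mul_smul_comm, smul_mul_assoc, h1, mul_assoc, h.op_alt_mul_op_alt,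
    mul_smul_comm, smul_smul, loop, mul_assoc]
  congr 1
  field_simp

/-- A vector v with O v = 0 gives (v vᵀ)_1 A_2 annihilated by the invertible loop; then v vᵀ = 0, so
v = 0. -/
theorem isUnit_opO (h : IsOrthogonalType R q k) (hF : IsCompatiblePair R F) :
    IsUnit (opO h F) := by
  have hb := h.hasHeight.bmw
  have hT := hF.twist hb.nonempty
  rw [Matrix.isUnit_iff_isUnit_det, isUnit_iff_ne_zero]
  intro h0
  obtain ⟨v, hv, hv0⟩ := Matrix.exists_mulVec_eq_zero_iff.mpr h0
  have h1 : opO h F * Matrix.vecMulVec v v = 0 := by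
    rw [Matrix.mul_vecMulVec, hv0, Matrix.zero_vecMulVec]
  have h2 : Matrix.vecMulVec v v = 0 := by
    refine eq_zero_of_op_mul_op 0 (0 + 1) (by norm_num) hb.nonempty h.alt_ne_zero ?_
    have hc : Commute (op 0 (Matrix.vecMulVec v v)) (op (0 + 1) (alt hb k) : Ops ι) :=
      op_commute _ _ (by norm_num)
    have h3 : loop (fun i => op i R) (fun i => op i F⁻¹) 0 k *
        (op 0 (Matrix.vecMulVec v v) * op (0 + 1) (alt hb k)) = (0 : Ops ι) := by
      have h4 : op 0 (opO h F) * (op 0 (Matrix.vecMulVec v v) * op (0 + 1) (alt hb k)) =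
          (0 : Ops ι) := by
        rw [← mul_assoc, ← map_mul, h1, map_zero, zero_mul]
      rw [hc.eq, ← mul_assoc, h.op_opO_mul_alt_eq_loop hF, smul_mul_assoc] at h4
      rw [hc.eq, ← mul_assoc]
      exact (smul_eq_zero.mp h4).resolve_left (pow_ne_zero _ (by norm_num))
    calc _ = asc (fun i => op i R⁻¹ : ℤ → Ops ι) 0 k * (desc (fun i => op i F : ℤ → Ops ι) 0 k *
          loop (fun i => op i R) (fun i => op i F⁻¹) 0 k) *
          (op 0 (Matrix.vecMulVec v v) * op (0 + 1) (alt hb k)) := by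
          rw [loop, ← mul_assoc (desc _ _ _), desc_mul_asc hT.fg, one_mul,
            asc_mul_desc hb.system.ts, one_mul]
      _ = 0 := by simp only [mul_assoc] at h3 ⊢; rw [h3, mul_zero, mul_zero]
  refine hv (funext fun i => ?_)
  have := congrFun (congrFun h2 i) i
  rw [Matrix.vecMulVec_apply] at this
  exact mul_self_eq_zero.mp this

end IsOrthogonalType

end TensorOp

/-! ### Partial traces in coordinates -/

namespace TensorOp
theorem sum_fin_one {ι : Type*} [Fintype ι] 
    (f : (Fin 1 → ι) → ℂ) : ∑ x, f x = ∑ i, f fun _ => i :=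
  ((Equiv.funUnique (Fin 1) ι).symm.sum_comp f).symm

theorem act_zero_apply_three {ι : Type*} [DecidableEq ι]
    (X : TensorOp ι 2) (a b c x y z : ι) :
    act 3 0 X (by omega) ![a, b, c] ![x, y, z] = if c = z then X ![a, b] ![x, y] else 0 := by
  have h1 : ∀ a b c : ι, ![a, b, c] ∘ legs 0 2 3 (by omega) = ![a, b] := by
    intro a b c
    funext i
    fin_cases i <;> rfl
  simp only [act, onLegs, h1]
  congr 1
  apply propext
  constructor
  · intro h
    exact h 2 (by decide)
  · rintro rfl j hj
    fin_cases j
    · exact absurd rfl (hj 0)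
    · exact absurd rfl (hj 1)
    · rfl

variable {ι : Type*} [Fintype ι] [DecidableEq ι]
variable {R : TensorOp ι 2}

/-! ### The operator `D_R` -/

theorem traceExcept_act_zero_mul (X : TensorOp ι 2) (Y : TensorOp ι 1) :
    traceExcept (legs 0 1 2 (by omega)) (act 2 0 Y (by omega) * X) =
      Y * traceExcept (legs 0 1 2 (by omega)) X := by
  ext a b
  have ha : a = fun _ => a 0 := funext fun j => by rw [Subsingleton.elim j 0]
  rw [traceExcept_apply (m := 1), Matrix.mul_apply, sum_fin_one (fun x => Y a x * _)]
  simp only [Matrix.mul_apply, traceExcept_apply (m := 1), sum_cons (m := 1),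
    act_zero_apply (m := 1), ite_mul, zero_mul,
    Finset.sum_ite_eq, Finset.mem_univ, if_true, Finset.mul_sum]
  rw [Finset.sum_comm, ← ha]

theorem traceExcept_mul_act_zero (X : TensorOp ι 2) (Y : TensorOp ι 1) :
    traceExcept (legs 0 1 2 (by omega)) (X * act 2 0 Y (by omega)) =
      traceExcept (legs 0 1 2 (by omega)) X * Y := by
  ext a b
  have hb : b = fun _ => b 0 := funext fun j => by rw [Subsingleton.elim j 0]
  rw [traceExcept_apply (m := 1), Matrix.mul_apply, sum_fin_one (fun x => _ * Y x b)]
  simp only [Matrix.mul_apply, traceExcept_apply (m := 1), sum_cons (m := 1),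
    act_zero_apply (m := 1), mul_ite, mul_zero,
    Finset.sum_ite_eq', Finset.mem_univ, if_true, Finset.sum_mul]
  rw [Finset.sum_comm, ← hb]

theorem traceExcept_act_one_mul (X : TensorOp ι 2) (Y : TensorOp ι 1) :
    traceExcept (legs 0 1 2 (by omega)) (act 2 1 Y second_leg_le * X) =
      traceExcept (legs 0 1 2 (by omega)) (X * act 2 1 Y second_leg_le) := by
  ext a b
  rw [traceExcept_apply (m := 1), traceExcept_apply (m := 1)]
  simp only [Matrix.mul_apply, sum_cons (m := 1),
    act_one_apply (m := 1), ite_mul, mul_ite, zero_mul, mul_zero, Finset.sum_ite_irrel,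
    Finset.sum_const_zero, Finset.sum_ite_eq, Finset.sum_ite_eq', Finset.mem_univ, if_true]
  rw [Finset.sum_comm]
  exact Finset.sum_congr rfl fun _ _ => Finset.sum_congr rfl fun _ _ => mul_comm _ _

theorem traceExcept_outerLegs_apply (X : TensorOp ι 3) (a b c d : ι) :
    traceExcept outerLegs X ![a, c] ![b, d] = ∑ x, X ![a, x, c] ![b, x, d] := by
  have hs : ∀ f : (Fin 3 → ι) → ℂ, ∑ x, f x = ∑ i, ∑ j, ∑ l, f ![i, j, l] := fun f => by
    rw [sum_cons]
    refine Finset.sum_congr rfl fun i _ => ?_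
    rw [sum_cons]
    refine Finset.sum_congr rfl fun j _ => ?_
    rw [sum_fin_one]
    refine Finset.sum_congr rfl fun l _ => ?_
    congr 1
    funext r
    fin_cases r <;> rfl
  have h1 : ∀ i j l a c : ι, ![i, j, l] ∘ outerLegs = ![a, c] ↔ i = a ∧ l = c := by
    intro i j l a c
    rw [funext_iff, Fin.forall_fin_two]
    rfl
  have h2 : ∀ i j l a b c : ι, (∀ r, (∀ i, outerLegs i ≠ r) → ![i, j, l] r = ![a, b, c] r) ↔
      j = b := by
    intro i j l a b c
    constructor
    · intro h
      exact h 1 (by decide)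
    · rintro rfl r hr
      fin_cases r
      · exact absurd rfl (hr 0)
      · rfl
      · exact absurd rfl (hr 1)
  simp only [traceExcept, hs, h1, h2, ite_and, Finset.sum_ite_irrel, Finset.sum_const_zero,
    Finset.sum_ite_eq, Finset.sum_ite_eq', Finset.mem_univ, if_true]

/-- In coordinates skew invertibility is ordinary invertibility of a partially transposed R, the
form in which it is used below. -/
theorem IsSkewInverse.sum_eq {Ψ : TensorOp ι 2} (h : IsSkewInverse R Ψ) (a b c d : ι) :
    ∑ x, ∑ y, R ![a, x] ![b, y] * Ψ ![y, c] ![x, d] = if a = d ∧ c = b then 1 else 0 := by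
  have h1 := congrFun (congrFun h.right ![a, c]) ![b, d]
  rw [traceExcept_outerLegs_apply] at h1
  have h2 : ∀ (i a b j x y : ι), act 3 1 Ψ (by omega) ![i, a, b] ![j, x, y] =
      if i = j then Ψ ![a, b] ![x, y] else 0 := fun i a b j x y =>
    act_one_apply (m := 2) Ψ (by omega) i j ![a, b] ![x, y]
  have hs : ∀ f : (Fin 3 → ι) → ℂ, ∑ x, f x = ∑ i, ∑ j, ∑ l, f ![i, j, l] := fun f => by
    rw [sum_cons]
    refine Finset.sum_congr rfl fun i _ => ?_
    rw [sum_cons]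
    refine Finset.sum_congr rfl fun j _ => ?_
    rw [sum_fin_one]
    refine Finset.sum_congr rfl fun l _ => ?_
    congr 1
    funext r
    fin_cases r <;> rfl
  simp only [Matrix.mul_apply, hs, act_zero_apply_three, h2, mul_ite, ite_mul, zero_mul, mul_zero,
    Finset.sum_ite_irrel, Finset.sum_const_zero, Finset.sum_ite_eq, Finset.sum_ite_eq',
    Finset.mem_univ, if_true] at h1
  exact h1

/-- `Tr_(2) R_1 X_2` determines `X`. -/
theorem IsSkewInvertible.eq_of_traceExcept_eq (h : IsSkewInvertible R) {X Y : TensorOp ι 1}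
    (hXY : traceExcept (legs 0 1 2 (by omega)) (R * act 2 1 X second_leg_le) =
      traceExcept (legs 0 1 2 (by omega)) (R * act 2 1 Y second_leg_le)) : X = Y := by
  obtain ⟨Ψ, hΨ⟩ := h
  -- Regrouping the indices by tensor factor turns X ↦ Tr_(2) R_1 X_2 into multiplication by A, with
  -- inverse B built from Ψ.
  let A : Matrix (ι × ι) (ι × ι) ℂ := Matrix.of fun u v => R ![u.1, v.1] ![u.2, v.2]
  let B : Matrix (ι × ι) (ι × ι) ℂ := Matrix.of fun v u => Ψ ![v.2, u.2] ![v.1, u.1]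
  have hAB : A * B = 1 := by
    ext ⟨a, b⟩ ⟨d, c⟩
    rw [Matrix.mul_apply, Fintype.sum_prod_type]
    simp only [A, B, Matrix.of_apply]
    rw [hΨ.sum_eq, Matrix.one_apply]
    simp only [Prod.mk.injEq, eq_comm (a := c)]
  have hBA : B * A = 1 := mul_eq_one_comm.mp hAB
  have h1 : ∀ X : TensorOp ι 1, A.mulVec (fun v => X (fun _ => v.2) (fun _ => v.1)) =
      fun u => traceExcept (legs 0 1 2 (by omega)) (R * act 2 1 X second_leg_le)
        (fun _ => u.1) (fun _ => u.2) := by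
    intro X
    funext u
    rw [traceExcept_apply (m := 1)]
    simp only [Matrix.mulVec, dotProduct, Fintype.sum_prod_type, Matrix.mul_apply,
      sum_cons (m := 1), act_one_apply (m := 1), mul_ite, mul_zero, Finset.sum_ite_irrel,
      Finset.sum_const_zero, Finset.sum_ite_eq', Finset.mem_univ, if_true, sum_fin_one,
      A, Matrix.of_apply]
    refine Finset.sum_congr rfl fun i _ => Finset.sum_congr rfl fun j _ => ?_
    congr 2 <;> funext r <;> fin_cases r <;> rfl
  have h2 := congrArg (B.mulVec) ((h1 X).trans ((congrArg (fun (Z : TensorOp ι 1) (u : ι × ι) =>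
    Z (fun _ => u.1) (fun _ => u.2)) hXY).trans (h1 Y).symm))
  rw [Matrix.mulVec_mulVec, Matrix.mulVec_mulVec, hBA, Matrix.one_mulVec, Matrix.one_mulVec] at h2
  ext a b
  have h3 := congrFun h2 (b 0, a 0)
  have hc : ∀ a : Fin 1 → ι, (fun _ => a 0) = a := fun a =>
    funext fun j => by rw [Subsingleton.elim j 0]
  simpa only [hc] using h3

/-- Trace Tr_(2) R_1 Ψ_2 = P over its last factor: Ψ becomes D_R and P becomes 1. -/
theorem IsSkewInvertible.traceExcept_mul_matD (h : IsSkewInvertible R) :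
    traceExcept (legs 0 1 2 (by omega)) (R * act 2 1 (matD h) second_leg_le) = 1 := by
  ext a b
  have hc : ∀ (i j : ι), (Fin.cons i fun _ => j : Fin 2 → ι) = ![i, j] := fun i j => by
    funext r; fin_cases r <;> rfl
  have hab : a = b ↔ a 0 = b 0 := by rw [funext_iff, Fin.forall_fin_one]
  rw [traceExcept_apply (m := 1), Matrix.one_apply]
  simp only [Matrix.mul_apply, sum_cons (m := 1), act_one_apply (m := 1), mul_ite, mul_zero,
    Finset.sum_ite_irrel, Finset.sum_const_zero, Finset.sum_ite_eq', Finset.mem_univ, if_true,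
    sum_fin_one, matD, traceExcept_apply (m := 1), hc, Finset.mul_sum]
  have h1 := h.choose_spec.sum_eq (a 0) (b 0)
  calc _ = ∑ z, ∑ x, ∑ y, R ![a 0, x] ![b 0, y] * h.choose ![y, z] ![x, z] := by
        refine (Finset.sum_congr rfl fun x _ => Finset.sum_comm).trans ?_
        rw [Finset.sum_comm]
    _ = _ := by
        simp only [h1, hab]
        by_cases h2 : a 0 = b 0
        · simp only [h2, eq_comm (a := b 0), and_self,
            Finset.sum_ite_eq', Finset.mem_univ, if_true]
        · rw [if_neg h2]
          refine Finset.sum_eq_zero fun z _ => if_neg ?_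
          rintro ⟨rfl, h3⟩
          exact h2 h3

/-- `D_R` commutes with the symmetries of `R`. -/
theorem IsSkewInvertible.matD_commute (h : IsSkewInvertible R) {X : TensorOp ι 1} (hX : IsUnit X)
    (hι : Nonempty ι)
    (hRX : R * act 2 0 X (by omega) * act 2 1 X second_leg_le =
      act 2 0 X (by omega) * act 2 1 X second_leg_le * R) : matD h * X = X * matD h := by
  obtain ⟨h0, h0'⟩ := IsUnit.act (n := 2) hX hι 0 (by omega)
  obtain ⟨h1, h1'⟩ := IsUnit.act (n := 2) hX hι 1 (by omega)
  have hd := (Matrix.isUnit_iff_isUnit_det _).mp hX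
  have hD := h.traceExcept_mul_matD
  have hm : ∀ Y Z : TensorOp ι 1, act 2 1 (Y * Z) second_leg_le =
      act 2 1 Y second_leg_le * act 2 1 Z second_leg_le := fun Y Z => by
    apply op_injective (0 : ℤ)
    rw [map_mul, op_act, op_act, op_act, map_mul]
  -- The conjugate of D_R satisfies the same characterising equation: X_1 X_2 is moved through R,
  -- X_1 leaves the trace and X_2 cancels by cyclicity.
  have key : X * matD h * X⁻¹ = matD h := by
    apply h.eq_of_traceExcept_eq
    rw [hD, hm, hm]
    have hc : act 2 0 X⁻¹ (by omega) * act 2 1 X⁻¹ second_leg_le =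
        act 2 1 X⁻¹ second_leg_le * act 2 0 X⁻¹ (by omega) := by
      apply op_injective (0 : ℤ)
      rw [map_mul, map_mul, op_act, op_act]
      exact op_commute _ _ (by norm_num)
    have hcD : act 2 0 X⁻¹ (by omega) * act 2 1 (matD h) second_leg_le =
        act 2 1 (matD h) second_leg_le * act 2 0 X⁻¹ (by omega) := by
      apply op_injective (0 : ℤ)
      rw [map_mul, map_mul, op_act, op_act]
      exact op_commute _ _ (by norm_num)
    set x := act 2 0 X (by omega)
    set y := act 2 1 X second_leg_le
    set x' := act 2 0 X⁻¹ (by omega)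
    set y' := act 2 1 X⁻¹ second_leg_le
    set d := act 2 1 (matD h) second_leg_le
    have h2 : R * (y * d * y') = x * (y * (R * d * y')) * x' := by
      calc R * (y * d * y') = R * x * y * (y' * x') * (y * d * y') := by
            rw [mul_assoc (R * x), ← mul_assoc y, h1, one_mul, mul_assoc R, h0, mul_one]
        _ = x * y * R * (x' * y') * (y * d * y') := by rw [hRX, hc]
        _ = x * y * R * (x' * d) * y' := by
            simp only [mul_assoc]; rw [← mul_assoc y' y, h1', one_mul]
        _ = x * y * R * d * (x' * y') := by rw [hcD]; simp only [mul_assoc]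
        _ = _ := by rw [hc]; simp only [mul_assoc]
    rw [h2, traceExcept_mul_act_zero, traceExcept_act_zero_mul, traceExcept_act_one_mul,
      mul_assoc (R * d), h1', mul_one, hD, mul_one, Matrix.mul_nonsing_inv _ hd]
  calc matD h * X = X * matD h * X⁻¹ * X := by rw [key]
    _ = X * matD h := by rw [mul_assoc, Matrix.nonsing_inv_mul _ hd, mul_one]

end TensorOp

/-! ### The relations for O, G and R -/

namespace TensorOp
variable {ι : Type*} [Fintype ι] [DecidableEq ι] {k : ℕ}
open BMW
variable {q : ℂ} {R F : TensorOp ι 2}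

namespace IsOrthogonalType

theorem opO_gauge (h : IsOrthogonalType R q k) (hF : IsCompatiblePair R F) :
    Gauge (fun i => op i R : ℤ → Ops ι) (fun i => op i F) (fun i => op i F⁻¹)
      (fun i => op i (opO h F)) :=
  gauge_op (h.opO_mul_eq hF).1 (h.opO_mul_eq hF).2

theorem op_opO_mul_asym (h : IsOrthogonalType R q k) (hF : IsCompatiblePair R F) (i : ℤ) :
    (op i (opO h F) * asym q (q ^ (1 - (k : ℤ))) (fun i => op i R)
      (fun i => op i (matK R q (q ^ (1 - (k : ℤ))))) (i + 1) k : Ops ι) =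
      ((-1 : ℂ) ^ (k - 1)) • (loop (fun i => op i R) (fun i => op i F⁻¹) i k *
        asym q (q ^ (1 - (k : ℤ))) (fun i => op i R)
          (fun i => op i (matK R q (q ^ (1 - (k : ℤ))))) (i + 1) k) := by
  rw [← op_alt h.hasHeight.bmw]
  exact h.op_opO_mul_alt_eq_loop hF i

theorem neg_one_pow_mul_self (n : ℕ) : ((-1 : ℂ) ^ n) * (-1) ^ n = 1 := by
  rw [← mul_pow]; simp

theorem opO_commute (h : IsOrthogonalType R q k) (hF : IsCompatiblePair R F) :
    R * act 2 0 (opO h F) (by omega) * act 2 1 (opO h F) second_leg_le =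
      act 2 0 (opO h F) (by omega) * act 2 1 (opO h F) second_leg_le * R := by
  have hb := h.hasHeight.bmw
  rw [← sub_eq_zero]
  refine eq_zero_of_op_mul_op 0 (0 + 2) (by norm_num) hb.nonempty h.alt_ne_zero ?_
  have := (h.opO_gauge hF).commute_s_mul_asym hb.system (hF.twist hb.nonempty) k
    (neg_one_pow_mul_self (k - 1)) (h.op_opO_mul_asym hF) 0
  rw [← op_alt hb] at this
  simpa only [map_sub, map_mul, op_act, Nat.cast_zero, Nat.cast_one, add_zero] using this

/-- The loop identity gives O² = G^k in front of an antisymmetrizer on nested cups; both are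
removed, first the antisymmetrizer and then the nonzero nest. -/
theorem opO_sq (h : IsOrthogonalType R q k) (hF : IsCompatiblePair R F) :
    opO h F ^ 2 = opG h.hasHeight.bmw F ^ k := by
  have hb := h.hasHeight.bmw
  have h1 := (h.opO_gauge hF).sq_sub_pow_mul_asym_mul_nest hb.system (hF.twist hb.nonempty)
    (opG_gauge hb h.rank_matK hF) k h.generic (neg_one_pow_mul_self (k - 1))
    (h.op_opO_mul_asym hF) (op_opG_mul_matK_eq_loop hb h.rank_matK hF) 0
  simp only [← map_pow, ← map_sub] at h1
  have h2 := hb.system.mul_nest_eq_zero _ k h.generic h.closure_ne_zero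
    (fun i hi => op_commute _ _ (by push_cast; omega)) h1
  rw [← sub_eq_zero]
  by_contra hne
  exact nest_ne_zero hb k (0 + 1) (eq_zero_of_map_mul_eq_zero (op 0)
    (fun X => (commute_op_nest X 0 (0 + 1) k (by norm_num)).symm) h2 hne)

theorem opG_mul_opO (h : IsOrthogonalType R q k) (hF : IsCompatiblePair R F) :
    opG h.hasHeight.bmw F * opO h F = opO h F * opG h.hasHeight.bmw F := by
  have hb := h.hasHeight.bmw
  have h1 := (h.opO_gauge hF).sub_mul_eq_zero hb.system (hF.twist hb.nonempty)
    (γ := fun i => op i (opG hb F)) (fun i => by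
      have := congrArg (op i) (h.opO_commute hF)
      simp only [map_mul, op_act, Nat.cast_zero, Nat.cast_one, add_zero] at this
      rw [Commute, SemiconjBy, ← this, mul_assoc])
    (fun i => (h.isUnit_opO hF).map (op i))
    (fun i j hij => op_commute _ _ (by push_cast; omega))
    (op_opG_mul_matK hb h.rank_matK F) 0
  simp only [← map_mul, ← map_sub] at h1
  exact sub_eq_zero.mp (eq_zero_of_op_mul_op 0 (0 + 1) (by norm_num) hb.nonempty
    hb.kappa_ne_zero h1)

end IsOrthogonalType
end TensorOp

theorem mainTheorem6 {ι : Type*} [Fintype ι] [DecidableEq ι] (k : ℕ) (q : ℂ)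
    (R F : TensorOp ι 2) (hR : TensorOp.IsOrthogonalType R q k)
    (hRF : TensorOp.IsCompatiblePair R F) :
    let O : TensorOp ι 1 := TensorOp.opO hR F
    let G : TensorOp ι 1 := TensorOp.opG hR.hasHeight.bmw F
    let D : TensorOp ι 1 := TensorOp.matD hR.hasHeight.skewInvertible
    let O₁ : TensorOp ι 2 := TensorOp.act 2 0 O (by omega)
    let O₂ : TensorOp ι 2 := TensorOp.act 2 1 O (by omega)
    (O₁ * F = F * O₂ ∧ O₁ * F⁻¹ = F⁻¹ * O₂) ∧
    R * O₁ * O₂ = O₁ * O₂ * R ∧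
    (D * O - O * D = 0 ∧ G * O - O * G = 0) ∧
    O ^ 2 = G ^ k := by
  intro O G D O₁ O₂
  have hO := hR.opO_mul_eq hRF
  exact ⟨hO, hR.opO_commute hRF, ⟨sub_eq_zero.mpr (hR.hasHeight.skewInvertible.matD_commute
    (hR.isUnit_opO hRF) hR.hasHeight.bmw.nonempty (hR.opO_commute hRF)),
    sub_eq_zero.mpr (hR.opG_mul_opO hRF)⟩, hR.opO_sq hRF⟩
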